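/- **Setting.** Let $d\in\mathbb N$ and $\tfrac12\le\theta<1$. $\mathcal S_\theta(\mathbb R^d)$ is the space of all $f\in C^\infty(\mathbb R^d)$ such that for some $C>0$ $$\sup_{\alpha,\beta}\sup_x C^{-|\alpha|-|\beta|}(\alpha!)^{-\theta}(\beta!)^{-\theta}|x^\alpha\partial^\beta f(x)|<\infty ,$$ and $\mathcal S'_\theta(\mathbb R^d)$ is its dual: the linear forms $u$ on $\mathcal S_\theta$ such that for every $\varepsilon>0$ there is $C_\varepsilon$ with $|u(f)|\le C_\varepsilon\sup_{\alpha,\beta,x}\varepsilon^{-|\alpha|-|\beta|}(\alpha!)^{-\theta}(\beta!)^{-\theta}|x^\alpha\partial^\beta f(x)|$ for all $f$. $\mathcal S_\theta$ is embedded in $\mathcal S'_\theta$ by $f\mapsto(g\mapsto\int fg\,dx)$. Let $\varphi(z,y)=\frac12\langle \mathbf Az,z\rangle+\langle \mathbf Bz,y\rangle+\frac12\langle \mathbf Cy,y\rangle$ (bilinear brackets, $z\in\mathbb C^d$, $y\in\mathbb R^d$) with complex $d\times d$ matrices $\mathbf A,\mathbf B,\mathbf C$, where $\mathbf A,\mathbf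 C$ are symmetric, $\det \mathbf B\ne0$ and $\operatorname{Im}\mathbf C>0$. Put $c_\varphi=2^{-d/2}\pi^{-3d/4}(\det\operatorname{Im}\mathbf C)^{-1/4}|\det \mathbf B|$, $\Phi(z)=\max_{y}(-\operatorname{Im}\varphi(z,y))$, and $T_\varphi u(z)=c_\varphi\langle u_y,e^{i\varphi(z,y)}\rangle$ for $u\in\mathcal S'_\theta$. For a function $U$ on $\mathbb C^d$, $T_\varphi^*U=v\in\mathcal S'_\theta$ means that $$\langle v,f\rangle=\int_{\mathbb C^d}U(z)\,\overline{T_\varphi\bar f(z)}\,e^{-2\Phi(z)}\,d\lambda(z)\qquad\text{for all } f\in\mathcal S_\theta ,$$ with absolutely convergent integrals. Let $\chi(y,\eta)=-\mathbf B^{-1}(\eta+\mathbf Cy)$, a bijection of $\mathbb R^{2d}$ onto $\mathbb C^d$. A point $p\in\mathbb R^{2d}\setminus\{0\}$ is not in $\mathrm{WF}(u)\subset\mathbb R^{2d}\setminus\{0\}$ if there are an open conic neighbourhood $L\subset\mathbb C^d\setminus\{0\}$ of $\chi(p)$ and $\varepsilon,K>0$ with $|T_\varphi u(z)|\le K e^{-\varepsilon|z|^{1/\theta}+\Phi(z)}$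 for all $z\in L$. For a closed cone $\Gamma\subset\mathbb R^{2d}\setminus\{0\}$ let $\mathcal S'_{\theta,\Gamma}=\{u\in\mathcal S'_\theta:\mathrm{WF}(u)\subset\Gamma\}$, with the following notion of convergence: $u_n\to u$ if $u_n-u\to0$ weakly in $\mathcal S'_\theta$ and every $p\in\mathbb R^{2d}\setminus(\Gamma\cup\{0\})$ admits an open conic neighbourhood $L\subset\mathbb C^d\setminus\{0\}$ of $\chi(p)$ and $\varepsilon,K>0$ such that $|T_\varphi(u_n-u)(z)|\le K e^{-\varepsilon|z|^{1/\theta}+\Phi(z)}$ for all $n$ and all $z\in L$. A map is continuous if it preserves convergent sequences and their limits. Let $MS^\theta(\mathbb C^d)$ be the set of entire functions $h$ such that for every $\varepsilon>0$ there is $D_\varepsilon>0$ with $|h(z)|\le D_\varepsilon e^{\varepsilon|z|^{1/\theta}}$ for all $z\in\mathbb C^d$. **Theorem.** Let $(h_\alpha)_{\alpha\in\mathbb N^d}$ be a family in $MS^\theta(\mathbb C^d)$ with $|h_\alpha(z)|\le D_{\varepsilon,\alpha}e^{\varepsilon|z|^{1/\theta}}$ for all $\varepsilon>0$, $\alpha$,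 $z$, where for every $\varepsilon>0$ there is $D'_\varepsilon>0$ with $$D_{\varepsilon,\alpha}\le\frac{D'_\varepsilon\,\varepsilon^{|\alpha|}}{\alpha!^{\theta}}\qquad\text{for all }\alpha\in\mathbb N^d .$$ Then for every $u\in\mathcal S'_\theta(\mathbb R^d)$ the ultradistributions $T_\varphi^*(h_\alpha\,\partial_z^\alpha T_\varphi u)\in\mathcal S'_\theta(\mathbb R^d)$ exist, and the series $$Au=\sum_{\alpha\in\mathbb N^d}T_\varphi^*\bigl(h_\alpha\,\partial_z^\alpha T_\varphi u\bigr)$$ converges unconditionally in the weak topology of $\mathcal S'_\theta(\mathbb R^d)$; it defines a linear operator $A$ on $\mathcal S'_\theta(\mathbb R^d)$ which for every closed cone $\Gamma\subset\mathbb R^{2d}\setminus\{0\}$ maps $\mathcal S'_{\theta,\Gamma}(\mathbb R^d)$ continuously into itself. Moreover $\mathrm{WF}(Au)\subset\mathrm{WF}(u)$ for every $u\in\mathcal S'_\theta(\mathbb R^d)$, and $A$ maps $\mathcal S_\theta(\mathbb R^d)$ into itself. In particular, differential operators with polynomial coefficients are microlocal: if $P=\sum c_{\alpha\beta}\,x^\alpha\partial^\beta$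 (finite sum, $c_{\alpha\beta}\in\mathbb C$), then $\mathrm{WF}(Pu)\subset\mathrm{WF}(u)$ for every $u\in\mathcal S'_\theta(\mathbb R^d)$. -/

import Mathlib

open MeasureTheory Filter Topology
open scoped ContDiff

/-- Real Euclidean space `ℝ^d`. -/
abbrev RSp (d : ℕ) : Type := EuclideanSpace ℝ (Fin d)

/-- Complex Euclidean space `ℂ^d`, with the Hermitian norm and Lebesgue measure. -/
abbrev CSp (d : ℕ) : Type := EuclideanSpace ℂ (Fin d)

/-- Multi-indices `α ∈ ℕ^d`. -/
abbrev MIdx (d : ℕ) : Type := Fin d → ℕ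

/-- The length `|α|`. -/
def MIdx.len {d : ℕ} (α : MIdx d) : ℕ := ∑ i, α i

/-- The factorial `α!`. -/
def MIdx.fact {d : ℕ} (α : MIdx d) : ℕ := ∏ i, (α i).factorial

/-- The partial derivative `∂_i g` over the field `𝕜`
(the holomorphic derivative `∂/∂z_i` if `𝕜 = ℂ`). -/
noncomputable def pderiv (𝕜 : Type) [RCLike 𝕜] [NormedSpace 𝕜 ℂ] {d : ℕ} (i : Fin d)
    (g : EuclideanSpace 𝕜 (Fin d) → ℂ) : EuclideanSpace 𝕜 (Fin d) → ℂ :=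
  fun x => fderiv 𝕜 g x (EuclideanSpace.single i 1)

/-- The derivative `∂^α g = ∂_0^{α_0} ⋯ ∂_{d-1}^{α_{d-1}} g`. -/
noncomputable def mderiv (𝕜 : Type) [RCLike 𝕜] [NormedSpace 𝕜 ℂ] {d : ℕ} (α : MIdx d)
    (g : EuclideanSpace 𝕜 (Fin d) → ℂ) : EuclideanSpace 𝕜 (Fin d) → ℂ :=
  (List.finRange d).foldr (fun i f => (pderiv 𝕜 i)^[α i] f) g

/-! ### Gelfand–Shilov functions -/

/-- `GSBound θ C M f` says that
`sup_{α,β} sup_x C^{-|α|-|β|} (α!)^{-θ} (β!)^{-θ} |x^α ∂^β f(x)| ≤ M`. -/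
def GSBound {d : ℕ} (θ C M : ℝ) (f : RSp d → ℂ) : Prop :=
  ∀ (α β : MIdx d) (x : RSp d), |∏ i, x i ^ α i| * ‖mderiv ℝ β f x‖ ≤
    M * (C ^ (α.len + β.len) * (α.fact : ℝ) ^ θ * (β.fact : ℝ) ^ θ)

section Smooth

variable {d : ℕ}

lemma contDiff_pderiv (i : Fin d) {f : RSp d → ℂ} (hf : ContDiff ℝ ∞ f) :
    ContDiff ℝ ∞ (pderiv ℝ i f) := by
  have h : ContDiff ℝ ∞ (fderiv ℝ f) := hf.fderiv_right (by simp)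
  exact h.clm_apply contDiff_const

/-- The space of smooth functions. -/
def Smooth (d : ℕ) : Submodule ℂ (RSp d → ℂ) where
  carrier := {f | ContDiff ℝ ∞ f}
  add_mem' {f g} hf hg := by
    have hf' : ContDiff ℝ ∞ f := hf
    have hg' : ContDiff ℝ ∞ g := hg
    exact hf'.add hg'
  zero_mem' := (contDiff_const : ContDiff ℝ ∞ fun _ : RSp d => (0 : ℂ))
  smul_mem' c f hf := by
    have hf' : ContDiff ℝ ∞ f := hf
    exact hf'.const_smul c

lemma Smooth.differentiableAt (f : Smooth d) (x : RSp d) : DifferentiableAt ℝ (f : RSp d → ℂ) x :=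
  (ContDiff.differentiable (n := ∞) f.2 (by simp)) x

/-- Partial derivatives as endomorphisms of the space of smooth functions. -/
noncomputable def Smooth.pd (i : Fin d) : Module.End ℂ (Smooth d) where
  toFun f := ⟨pderiv ℝ i f, contDiff_pderiv i f.2⟩
  map_add' f g := by
    ext x
    simp [pderiv, fderiv_add (Smooth.differentiableAt f x) (Smooth.differentiableAt g x)]
  map_smul' c f := by
    ext x
    simp [pderiv, fderiv_const_smul (Smooth.differentiableAt f x)]

/-- Multiplication by a coordinate, as an endomorphism of the space of smooth functions. -/
noncomputable def Smooth.mx (j : Fin d) : Module.End ℂ (Smooth d) where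
  toFun f := ⟨fun x => (x j : ℂ) * (f : RSp d → ℂ) x, by
    have h : ContDiff ℝ ∞ (f : RSp d → ℂ) := f.2
    have h2 : ContDiff ℝ ∞ (fun x : RSp d => ((x j : ℝ) : ℂ)) :=
      Complex.ofRealCLM.contDiff.comp (EuclideanSpace.proj j : RSp d →L[ℝ] ℝ).contDiff
    exact h2.mul h⟩
  map_add' f g := by
    ext x
    simp [mul_add]
  map_smul' c f := by
    ext x
    simp [mul_left_comm]

lemma Smooth.pd_comm (i j : Fin d) : Commute (Smooth.pd i) (Smooth.pd j) := by
  ext f x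
  have h : ContDiff ℝ ∞ (f : RSp d → ℂ) := f.2
  have hd : Differentiable ℝ (fderiv ℝ (f : RSp d → ℂ)) :=
    (h.fderiv_right (m := ∞) (by simp)).differentiable (by simp)
  have hs : IsSymmSndFDerivAt ℝ (f : RSp d → ℂ) x :=
    h.contDiffAt.isSymmSndFDerivAt (by
      rw [minSmoothness_of_isRCLikeNormedField]
      exact WithTop.coe_le_coe.2 (le_top : (2 : ℕ∞) ≤ ⊤))
  have key : ∀ a b : Fin d, pderiv ℝ a (pderiv ℝ b (f : RSp d → ℂ)) x =
      fderiv ℝ (fderiv ℝ (f : RSp d → ℂ)) x (EuclideanSpace.single a 1)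
        (EuclideanSpace.single b 1) := by
    intro a b
    unfold pderiv
    rw [fderiv_clm_apply (hd x) (by fun_prop)]
    simp
  change pderiv ℝ i (pderiv ℝ j (f : RSp d → ℂ)) x = pderiv ℝ j (pderiv ℝ i (f : RSp d → ℂ)) x
  rw [key, key]
  exact hs _ _

lemma Smooth.pd_mx (i j : Fin d) :
    Smooth.pd i * Smooth.mx j = Smooth.mx j * Smooth.pd i + if i = j then 1 else 0 := by
  ext f x
  have h2 : HasFDerivAt (fun x : RSp d => ((x j : ℝ) : ℂ))
      (Complex.ofRealCLM.comp (EuclideanSpace.proj j : RSp d →L[ℝ] ℝ)) x :=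
    (Complex.ofRealCLM.comp (EuclideanSpace.proj j : RSp d →L[ℝ] ℝ)).hasFDerivAt
  have h3 := h2.mul (Smooth.differentiableAt f x).hasFDerivAt
  have h4 : ((Smooth.pd i * Smooth.mx j) f : RSp d → ℂ) x =
      fderiv ℝ (fun x : RSp d => ((x j : ℝ) : ℂ) * (f : RSp d → ℂ) x) x
        (EuclideanSpace.single i 1) := rfl
  have h5 : ((Smooth.mx j * Smooth.pd i) f : RSp d → ℂ) x =
      (x j : ℂ) * fderiv ℝ (f : RSp d → ℂ) x (EuclideanSpace.single i 1) := rfl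
  have h6 : fderiv ℝ (fun x : RSp d => ((x j : ℝ) : ℂ) * (f : RSp d → ℂ) x) x = _ :=
    HasFDerivAt.fderiv h3
  rw [h4, h6]
  rw [LinearMap.add_apply, Submodule.coe_add, Pi.add_apply, h5]
  by_cases hij : i = j
  · subst hij
    simp
  · simp [hij, Ne.symm hij]

/-- The product of `∂_i^{β_i}` along a list of indices. -/
noncomputable def Smooth.pdl (l : List (Fin d)) (β : MIdx d) : Module.End ℂ (Smooth d) :=
  (l.map fun i => Smooth.pd i ^ β i).prod

lemma Smooth.coe_pdl (β : MIdx d) (f : Smooth d) :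
    (Smooth.pdl (List.finRange d) β f : RSp d → ℂ) = mderiv ℝ β f := by
  unfold mderiv Smooth.pdl
  induction List.finRange d with
  | nil => rfl
  | cons i l ih =>
    rw [List.map_cons, List.prod_cons, Module.End.mul_apply, List.foldr_cons, ← ih]
    generalize (List.map (fun i => Smooth.pd i ^ β i) l).prod f = g
    induction β i with
    | zero => rfl
    | succ n ihn => rw [pow_succ', Module.End.mul_apply, Function.iterate_succ_apply', ← ihn]; rfl

lemma Smooth.pdl_comm (l : List (Fin d)) (β : MIdx d) (j : Fin d) :
    Commute (Smooth.pdl l β) (Smooth.pd j) := by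
  refine Commute.list_prod_left _ _ fun y hy => ?_
  obtain ⟨i, -, rfl⟩ := List.mem_map.1 hy
  exact (Smooth.pd_comm i j).pow_left _

lemma Smooth.pdl_not_mem (l : List (Fin d)) (β : MIdx d) (j : Fin d) (hj : j ∉ l) :
    Smooth.pdl l (β + Pi.single j 1) = Smooth.pdl l β := by
  unfold Smooth.pdl
  congr 1
  refine List.map_congr_left fun i hi => ?_
  have : i ≠ j := fun h => hj (h ▸ hi)
  simp [this]

lemma Smooth.pdl_add_single (l : List (Fin d)) (hl : l.Nodup) (β : MIdx d) (j : Fin d)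
    (hj : j ∈ l) : Smooth.pdl l (β + Pi.single j 1) = Smooth.pdl l β * Smooth.pd j := by
  induction l with
  | nil => simp at hj
  | cons i l ih =>
    have e : ∀ γ : MIdx d, Smooth.pdl (i :: l) γ = Smooth.pd i ^ γ i * Smooth.pdl l γ := by
      intro γ; simp [Smooth.pdl]
    rw [e, e]
    rw [List.nodup_cons] at hl
    by_cases hij : i = j
    · subst hij
      rw [Smooth.pdl_not_mem l β i hl.1, mul_assoc, (Smooth.pdl_comm l β i).eq, ← mul_assoc]
      simp [pow_succ]
    · rw [ih hl.2 (by simpa [Ne.symm hij] using hj)]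
      simp [hij, mul_assoc]

lemma Smooth.pd_pow_mx (i j : Fin d) (n : ℕ) : Smooth.pd i ^ (n + 1) * Smooth.mx j =
    Smooth.mx j * Smooth.pd i ^ (n + 1) + if i = j then ((n : ℂ) + 1) • Smooth.pd i ^ n else 0 := by
  induction n with
  | zero => simpa using Smooth.pd_mx i j
  | succ n ih =>
    rw [pow_succ', mul_assoc, ih, mul_add, ← mul_assoc, Smooth.pd_mx, add_mul, mul_assoc]
    by_cases hij : i = j
    · subst hij
      simp only [if_true, one_mul, mul_smul_comm, ← pow_succ']
      rw [add_assoc]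
      congr 1
      push_cast
      module
    · simp [hij, pow_succ']

/-- Commutation of `∂^γ` with multiplication by a coordinate. -/
lemma Smooth.pdl_mx (l : List (Fin d)) (hl : l.Nodup) (γ : MIdx d) (j : Fin d) :
    (Smooth.pdl l γ * Smooth.mx j = Smooth.mx j * Smooth.pdl l γ ∨ j ∈ l) ∧
    (γ j = 0 → Smooth.pdl l γ * Smooth.mx j = Smooth.mx j * Smooth.pdl l γ) ∧
    (j ∈ l → Smooth.pdl l (γ + Pi.single j 1) * Smooth.mx j =
      Smooth.mx j * Smooth.pdl l (γ + Pi.single j 1) + ((γ j : ℂ) + 1) • Smooth.pdl l γ) := by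
  induction l with
  | nil => simp [Smooth.pdl]
  | cons i l ih =>
    have e : ∀ γ : MIdx d, Smooth.pdl (i :: l) γ = Smooth.pd i ^ γ i * Smooth.pdl l γ := by
      intro γ; simp [Smooth.pdl]
    rw [List.nodup_cons] at hl
    obtain ⟨h1, h2, h3⟩ := ih hl.2
    have hp : i ≠ j → ∀ n, Smooth.pd i ^ n * Smooth.mx j = Smooth.mx j * Smooth.pd i ^ n := by
      intro hij n
      cases n with
      | zero => simp
      | succ n => simpa [hij] using Smooth.pd_pow_mx i j n
    refine ⟨?_, ?_, ?_⟩
    · by_cases hij : j = i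
      · exact Or.inr (by simp [hij])
      · rcases h1 with h1 | h1
        · left
          rw [e, mul_assoc, h1, ← mul_assoc, hp (Ne.symm hij), mul_assoc]
        · exact Or.inr (by simp [h1])
    · intro h0
      rw [e, mul_assoc, h2 h0, ← mul_assoc]
      by_cases hij : i = j
      · subst hij; simp [h0]
      · rw [hp hij, mul_assoc]
    · intro hj
      rw [e, e]
      by_cases hij : i = j
      · subst hij
        rw [Smooth.pdl_not_mem l γ i hl.1]
        have h1' := h1.resolve_right hl.1
        have h4 := Smooth.pd_pow_mx i i (γ i)
        have h5 : (γ + Pi.single i 1 : MIdx d) i = γ i + 1 := by simp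
        rw [h5, mul_assoc, h1', ← mul_assoc, h4]
        simp [add_mul, mul_assoc]
      · have hj' : j ∈ l := by simpa [Ne.symm hij] using hj
        have h5 : (γ + Pi.single j 1 : MIdx d) i = γ i := by simp [hij]
        rw [h5, mul_assoc, h3 hj', mul_add, ← mul_assoc, hp hij, mul_assoc, mul_smul_comm]

lemma mderiv_add (β : MIdx d) {f g : RSp d → ℂ} (hf : ContDiff ℝ ∞ f) (hg : ContDiff ℝ ∞ g) :
    mderiv ℝ β (f + g) = mderiv ℝ β f + mderiv ℝ β g := by
  have h := Smooth.coe_pdl β ((⟨f, hf⟩ : Smooth d) + ⟨g, hg⟩)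
  rw [map_add, Submodule.coe_add, Smooth.coe_pdl, Smooth.coe_pdl] at h
  exact h.symm

lemma mderiv_smul (β : MIdx d) (c : ℂ) {f : RSp d → ℂ} (hf : ContDiff ℝ ∞ f) :
    mderiv ℝ β (c • f) = c • mderiv ℝ β f := by
  have h := Smooth.coe_pdl β (c • (⟨f, hf⟩ : Smooth d))
  rw [map_smul, Submodule.coe_smul, Smooth.coe_pdl] at h
  exact h.symm

lemma mderiv_zero_idx (f : RSp d → ℂ) : mderiv ℝ (0 : MIdx d) f = f := by
  unfold mderiv
  induction List.finRange d with
  | nil => rfl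
  | cons i l ih => simp

lemma mderiv_pderiv (β : MIdx d) (j : Fin d) {f : RSp d → ℂ} (hf : ContDiff ℝ ∞ f) :
    mderiv ℝ β (pderiv ℝ j f) = mderiv ℝ (β + Pi.single j 1) f := by
  have h := Smooth.coe_pdl (β + Pi.single j 1) ⟨f, hf⟩
  rw [Smooth.pdl_add_single _ (List.nodup_finRange d) _ _ (List.mem_finRange j)] at h
  rw [← h]
  exact (Smooth.coe_pdl β (Smooth.pd j ⟨f, hf⟩)).symm

lemma mderiv_mul_coord_zero (β : MIdx d) (j : Fin d) (hj : β j = 0) {f : RSp d → ℂ}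
    (hf : ContDiff ℝ ∞ f) (x : RSp d) :
    mderiv ℝ β (fun y : RSp d => (y j : ℂ) * f y) x = (x j : ℂ) * mderiv ℝ β f x := by
  have h := (Smooth.pdl_mx (List.finRange d) (List.nodup_finRange d) β j).2.1 hj
  have h1 := Smooth.coe_pdl β (Smooth.mx j ⟨f, hf⟩)
  rw [← Module.End.mul_apply, h] at h1
  have h2 := Smooth.coe_pdl β ⟨f, hf⟩
  have h3 := (congrFun h1 x).symm
  refine h3.trans ?_
  rw [← h2]
  rfl

lemma mderiv_mul_coord_succ (γ : MIdx d) (j : Fin d) {f : RSp d → ℂ}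
    (hf : ContDiff ℝ ∞ f) (x : RSp d) :
    mderiv ℝ (γ + Pi.single j 1) (fun y : RSp d => (y j : ℂ) * f y) x =
      (x j : ℂ) * mderiv ℝ (γ + Pi.single j 1) f x + ((γ j : ℂ) + 1) * mderiv ℝ γ f x := by
  have h := (Smooth.pdl_mx (List.finRange d) (List.nodup_finRange d) γ j).2.2
    (List.mem_finRange j)
  have h1 := Smooth.coe_pdl (γ + Pi.single j 1) (Smooth.mx j ⟨f, hf⟩)
  rw [← Module.End.mul_apply, h] at h1
  have h2 := Smooth.coe_pdl (γ + Pi.single j 1) ⟨f, hf⟩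
  have h2' := Smooth.coe_pdl γ ⟨f, hf⟩
  have h3 := (congrFun h1 x).symm
  refine h3.trans ?_
  rw [← h2, ← h2']
  rfl

end Smooth

section Bounds

variable {d : ℕ}

lemma MIdx.len_add_single (α : MIdx d) (j : Fin d) :
    MIdx.len (α + Pi.single j 1) = MIdx.len α + 1 := by
  simp [MIdx.len, Finset.sum_add_distrib]

lemma MIdx.fact_add_single (α : MIdx d) (j : Fin d) :
    MIdx.fact (α + Pi.single j 1) = (α j + 1) * MIdx.fact α := by
  unfold MIdx.fact
  rw [← Finset.mul_prod_erase _ _ (Finset.mem_univ j),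
    ← Finset.mul_prod_erase Finset.univ (fun i => (α i).factorial) (Finset.mem_univ j), ← mul_assoc]
  congr 1
  · simp [Nat.factorial_succ]
  · refine Finset.prod_congr rfl fun i hi => ?_
    simp [Finset.ne_of_mem_erase hi]

lemma MIdx.prod_pow_add_single (α : MIdx d) (j : Fin d) (x : RSp d) :
    ∏ i, x i ^ (α + Pi.single j 1 : MIdx d) i = (∏ i, x i ^ α i) * x j := by
  simp only [Pi.add_apply, pow_add, Finset.prod_mul_distrib]
  congr 1
  rw [Finset.prod_eq_single j] <;> simp +contextual

lemma MIdx.le_len (α : MIdx d) (j : Fin d) : α j ≤ MIdx.len α :=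
  Finset.single_le_sum (f := α) (fun _ _ => Nat.zero_le _) (Finset.mem_univ j)

/-- The growth constant of `(n + 1)^{±θ}`. -/
noncomputable def gsR (θ : ℝ) : ℝ := (2 : ℝ) ^ |θ|

lemma one_le_gsR (θ : ℝ) : 1 ≤ gsR θ := Real.one_le_rpow (by norm_num) (abs_nonneg θ)

lemma rpow_le_gsR (θ t : ℝ) (ht : t ≤ |θ|) (n m : ℕ) (hn : n ≤ m) :
    ((n : ℝ) + 1) ^ t ≤ gsR θ ^ m := by
  have h1 : (n : ℝ) + 1 ≤ 2 ^ n := by exact_mod_cast Nat.lt_two_pow_self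
  calc ((n : ℝ) + 1) ^ t ≤ ((n : ℝ) + 1) ^ |θ| :=
        Real.rpow_le_rpow_of_exponent_le (by linarith [n.cast_nonneg (α := ℝ)]) ht
    _ ≤ ((2 : ℝ) ^ n) ^ |θ| := Real.rpow_le_rpow (by positivity) h1 (abs_nonneg _)
    _ = gsR θ ^ n := by
        rw [gsR, ← Real.rpow_natCast, ← Real.rpow_natCast, ← Real.rpow_mul (by norm_num),
          ← Real.rpow_mul (by norm_num), mul_comm]
    _ ≤ gsR θ ^ m := pow_le_pow_right₀ (one_le_gsR θ) hn

lemma MIdx.fact_pos (α : MIdx d) : (0 : ℝ) < (MIdx.fact α : ℝ) := by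
  exact_mod_cast Finset.prod_pos fun i _ => Nat.factorial_pos _

lemma GSBound.nonneg {θ C M : ℝ} {f : RSp d → ℂ} (h : GSBound θ C M f) : 0 ≤ M := by
  have h0 := h 0 0 0
  simp [MIdx.len, MIdx.fact] at h0
  exact (norm_nonneg _).trans h0

lemma GSBound.norm_le {θ C M : ℝ} {f : RSp d → ℂ} (h : GSBound θ C M f) (x : RSp d) :
    ‖f x‖ ≤ M := by
  have h0 := h 0 0 x
  simpa [MIdx.len, MIdx.fact, mderiv_zero_idx] using h0

lemma GSBound.mono {θ C C' M : ℝ} {f : RSp d → ℂ} (h : GSBound θ C M f) (hC : 0 < C)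
    (hCC : C ≤ C') : GSBound θ C' M f := by
  intro α β x
  refine (h α β x).trans ?_
  have := h.nonneg
  have := Real.rpow_nonneg (MIdx.fact_pos α).le θ
  have := Real.rpow_nonneg (MIdx.fact_pos β).le θ
  gcongr

lemma GSBound.add {θ C M N : ℝ} {f g : RSp d → ℂ} (hf : ContDiff ℝ ∞ f) (hg : ContDiff ℝ ∞ g)
    (h : GSBound θ C M f) (h' : GSBound θ C N g) : GSBound θ C (M + N) (f + g) := by
  intro α β x
  rw [mderiv_add β hf hg, add_mul, Pi.add_apply]
  refine le_trans ?_ (add_le_add (h α β x) (h' α β x))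
  rw [← mul_add]
  gcongr
  exact norm_add_le _ _

lemma GSBound.smul {θ C M : ℝ} {f : RSp d → ℂ} (hf : ContDiff ℝ ∞ f)
    (h : GSBound θ C M f) (c : ℂ) : GSBound θ C (‖c‖ * M) (c • f) := by
  intro α β x
  rw [mderiv_smul β c hf, Pi.smul_apply, norm_smul, mul_left_comm, mul_assoc]
  exact mul_le_mul_of_nonneg_left (h α β x) (norm_nonneg c)

lemma GSBound.pderiv {θ C M : ℝ} {f : RSp d → ℂ} (hf : ContDiff ℝ ∞ f) (hC : 0 < C)
    (h : GSBound θ C M f) (j : Fin d) :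
    GSBound θ (2 * gsR θ * C) ((C + C⁻¹) * M) (pderiv ℝ j f) := by
  intro α β x
  rw [mderiv_pderiv β j hf]
  refine (h α _ x).trans ?_
  have hM := h.nonneg
  have hA := Real.rpow_nonneg (MIdx.fact_pos α).le θ
  have hB := Real.rpow_nonneg (MIdx.fact_pos β).le θ
  have h1 := rpow_le_gsR θ θ (le_abs_self θ) (β j) (α.len + β.len)
    ((MIdx.le_len β j).trans (Nat.le_add_left _ _))
  have hR := one_le_gsR θ
  rw [MIdx.len_add_single, MIdx.fact_add_single, Nat.cast_mul, Nat.cast_add, Nat.cast_one,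
    Real.mul_rpow (by positivity) (MIdx.fact_pos β).le, ← add_assoc, pow_succ]
  have h2 : gsR θ ^ (α.len + β.len) ≤ (2 * gsR θ) ^ (α.len + β.len) := by
    gcongr; linarith
  have h3 : C ≤ C + C⁻¹ := by linarith [inv_pos.2 hC]
  rw [mul_pow (2 * gsR θ) C]
  calc _ = M * (C * (C ^ (α.len + β.len) * (((β j : ℝ) + 1) ^ θ *
            ((α.fact : ℝ) ^ θ * (β.fact : ℝ) ^ θ)))) := by ring
    _ ≤ M * ((C + C⁻¹) * (C ^ (α.len + β.len) * ((2 * gsR θ) ^ (α.len + β.len) *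
            ((α.fact : ℝ) ^ θ * (β.fact : ℝ) ^ θ)))) := by
        have := h1.trans h2
        have hC' : 0 ≤ C + C⁻¹ := hC.le.trans h3
        gcongr
    _ = _ := by ring

lemma GSBound.mul_coord {θ C M : ℝ} {f : RSp d → ℂ} (hf : ContDiff ℝ ∞ f) (hC : 0 < C)
    (h : GSBound θ C M f) (j : Fin d) :
    GSBound θ (2 * gsR θ * C) ((C + C⁻¹) * M) (fun x : RSp d => (x j : ℂ) * f x) := by
  intro α β x
  have hM := h.nonneg
  have hA := Real.rpow_nonneg (MIdx.fact_pos α).le θ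
  have hB := Real.rpow_nonneg (MIdx.fact_pos β).le θ
  have hR := one_le_gsR θ
  -- the term in which all derivatives fall on `f`
  have key1 : |∏ i, x i ^ α i| * ‖(x j : ℂ) * mderiv ℝ β f x‖ ≤ C * (M *
      ((2 * gsR θ * C) ^ (α.len + β.len) * (α.fact : ℝ) ^ θ * (β.fact : ℝ) ^ θ)) := by
    have h0 := h (α + Pi.single j 1) β x
    rw [MIdx.prod_pow_add_single, abs_mul] at h0
    rw [norm_mul, Complex.norm_real, Real.norm_eq_abs, ← mul_assoc]
    refine h0.trans ?_
    have h1 := rpow_le_gsR θ θ (le_abs_self θ) (α j) (α.len + β.len)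
      ((MIdx.le_len α j).trans (Nat.le_add_right _ _))
    rw [MIdx.len_add_single, MIdx.fact_add_single, Nat.cast_mul, Nat.cast_add, Nat.cast_one,
      Real.mul_rpow (by positivity) (MIdx.fact_pos α).le, add_right_comm, pow_succ]
    have h2 : gsR θ ^ (α.len + β.len) ≤ (2 * gsR θ) ^ (α.len + β.len) := by
      gcongr; linarith
    rw [mul_pow (2 * gsR θ) C]
    calc _ = M * (C * (C ^ (α.len + β.len) * (((α j : ℝ) + 1) ^ θ *
              ((α.fact : ℝ) ^ θ * (β.fact : ℝ) ^ θ)))) := by ring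
      _ ≤ M * (C * (C ^ (α.len + β.len) * ((2 * gsR θ) ^ (α.len + β.len) *
              ((α.fact : ℝ) ^ θ * (β.fact : ℝ) ^ θ)))) := by
          have := h1.trans h2
          gcongr
      _ = _ := by ring
  rcases Nat.eq_zero_or_pos (β j) with hj | hj
  · rw [mderiv_mul_coord_zero β j hj hf]
    refine key1.trans ?_
    rw [add_mul, add_mul, mul_assoc]
    have : 0 ≤ C⁻¹ * M * ((2 * gsR θ * C) ^ (α.len + β.len) * (α.fact : ℝ) ^ θ *
      (β.fact : ℝ) ^ θ) := by positivity
    linarith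
  · obtain ⟨γ, rfl⟩ : ∃ γ : MIdx d, β = γ + Pi.single j 1 := by
      refine ⟨β - Pi.single j 1, ?_⟩
      funext i
      by_cases hi : i = j
      · subst hi; simp; omega
      · simp [hi]
    have key2 : |∏ i, x i ^ α i| * ‖((γ j : ℂ) + 1) * mderiv ℝ γ f x‖ ≤ C⁻¹ * (M *
        ((2 * gsR θ * C) ^ (α.len + MIdx.len (γ + Pi.single j 1)) * (α.fact : ℝ) ^ θ *
          (MIdx.fact (γ + Pi.single j 1) : ℝ) ^ θ)) := by
      have h0 := h α γ x
      have hn : ‖(γ j : ℂ) + 1‖ = (γ j : ℝ) + 1 := by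
        have : (γ j : ℂ) + 1 = ((γ j + 1 : ℕ) : ℂ) := by push_cast; rfl
        rw [this, Complex.norm_natCast]; push_cast; rfl
      have hpos : (0 : ℝ) < (γ j : ℝ) + 1 := by positivity
      rw [norm_mul, hn, mul_left_comm]
      refine (mul_le_mul_of_nonneg_left h0 hpos.le).trans ?_
      have hG := Real.rpow_nonneg (MIdx.fact_pos γ).le θ
      have h1 := rpow_le_gsR θ (-θ) (neg_le_abs θ) (γ j) (α.len + γ.len + 1)
        ((MIdx.le_len γ j).trans (by omega))
      have h2 : (γ j : ℝ) + 1 ≤ 2 ^ (α.len + γ.len + 1) := by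
        have h2' : (γ j : ℝ) + 1 ≤ 2 ^ (γ j) := by exact_mod_cast Nat.lt_two_pow_self
        exact h2'.trans (pow_le_pow_right₀ (by norm_num)
          ((MIdx.le_len γ j).trans (by omega)))
      have h3 : (1 : ℝ) ≤ gsR θ ^ (α.len + γ.len + 1) * ((γ j : ℝ) + 1) ^ θ := by
        have e : ((γ j : ℝ) + 1) ^ (-θ) * ((γ j : ℝ) + 1) ^ θ = 1 := by
          rw [← Real.rpow_add hpos]; simp
        refine e.symm.le.trans ?_
        exact mul_le_mul_of_nonneg_right h1 (Real.rpow_nonneg hpos.le θ)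
      rw [MIdx.len_add_single, MIdx.fact_add_single, Nat.cast_mul, Nat.cast_add, Nat.cast_one,
        Real.mul_rpow hpos.le (MIdx.fact_pos γ).le, ← add_assoc]
      have e2 : C⁻¹ * C ^ (α.len + γ.len + 1) = C ^ (α.len + γ.len) := by
        rw [pow_succ]; field_simp
      calc _ = M * (C ^ (α.len + γ.len) * ((α.fact : ℝ) ^ θ * (γ.fact : ℝ) ^ θ)) *
              (((γ j : ℝ) + 1) * 1) := by ring
        _ ≤ M * (C ^ (α.len + γ.len) * ((α.fact : ℝ) ^ θ * (γ.fact : ℝ) ^ θ)) *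
              (2 ^ (α.len + γ.len + 1) *
                (gsR θ ^ (α.len + γ.len + 1) * ((γ j : ℝ) + 1) ^ θ)) := by
            gcongr
        _ = _ := by
            rw [← e2, mul_pow, mul_pow]; ring
    rw [mderiv_mul_coord_succ γ j hf]
    refine (mul_le_mul_of_nonneg_left (norm_add_le _ _) (abs_nonneg _)).trans ?_
    rw [mul_add]
    refine (add_le_add key1 key2).trans (le_of_eq ?_)
    ring

lemma GSBound.integrable {θ C M : ℝ} {f : RSp d → ℂ} (hf : ContDiff ℝ ∞ f)
    (h : GSBound θ C M f) : Integrable f := by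
  have hb : ∀ i : Fin d, ∃ K : ℝ, ∀ x : RSp d, |x i| ^ (d + 1) * ‖f x‖ ≤ K := by
    intro i
    refine ⟨M * (C ^ (MIdx.len (Pi.single i (d + 1) : MIdx d) + MIdx.len (0 : MIdx d)) *
      (MIdx.fact (Pi.single i (d + 1) : MIdx d) : ℝ) ^ θ * (MIdx.fact (0 : MIdx d) : ℝ) ^ θ),
      fun x => ?_⟩
    have h0 := h (Pi.single i (d + 1)) 0 x
    rw [mderiv_zero_idx, Finset.prod_eq_single i (by simp +contextual)
      (by simp), Pi.single_eq_same, abs_pow] at h0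
    exact h0
  choose K hK using hb
  set S : ℝ := 2 ^ d * (M + (d : ℝ) ^ d * ∑ i, K i) with hS
  have hdom : ∀ x : RSp d, ‖f x‖ ≤ S * (1 + ‖x‖) ^ (-((d : ℝ) + 1)) := by
    intro x
    have hx : ‖x‖ ≤ ∑ i, |x i| := by
      rw [EuclideanSpace.norm_eq]
      refine Real.sqrt_le_iff.2 ⟨Finset.sum_nonneg fun i _ => abs_nonneg _, ?_⟩
      simp only [Real.norm_eq_abs]
      exact Finset.sum_sq_le_sq_sum_of_nonneg fun i _ => abs_nonneg _
    have hx2 : ‖x‖ ^ (d + 1) ≤ (d : ℝ) ^ d * ∑ i, |x i| ^ (d + 1) := by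
      refine (pow_le_pow_left₀ (norm_nonneg _) hx _).trans ?_
      rcases Nat.eq_zero_or_pos d with hd | hd
      · subst hd; simp
      have hc := pow_sum_div_card_le_sum_pow (s := Finset.univ) (f := fun i : Fin d => |x i|)
        (fun i _ => abs_nonneg _) d
      have hd' : (0 : ℝ) < (d : ℝ) ^ d := by positivity
      rw [Finset.card_univ, Fintype.card_fin, div_le_iff₀ hd'] at hc
      rw [mul_comm]
      exact hc
    have hx3 : (1 + ‖x‖) ^ (d + 1) ≤ 2 ^ d * (1 + ‖x‖ ^ (d + 1)) := by
      have := add_pow_le (zero_le_one' ℝ) (norm_nonneg x) (d + 1)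
      simpa using this
    have hx4 : (1 + ‖x‖) ^ (d + 1) * ‖f x‖ ≤ S := by
      calc (1 + ‖x‖) ^ (d + 1) * ‖f x‖
          ≤ (2 ^ d * (1 + (d : ℝ) ^ d * ∑ i, |x i| ^ (d + 1))) * ‖f x‖ := by
            refine mul_le_mul_of_nonneg_right (hx3.trans ?_) (norm_nonneg _)
            gcongr
        _ = 2 ^ d * (‖f x‖ + (d : ℝ) ^ d * ∑ i, |x i| ^ (d + 1) * ‖f x‖) := by
            rw [← Finset.sum_mul]; ring
        _ ≤ S := by
            rw [hS]
            gcongr with i _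
            · exact h.norm_le x
            · exact hK i x
    have hpos : (0 : ℝ) < 1 + ‖x‖ := by positivity
    have e : (1 + ‖x‖) ^ (-((d : ℝ) + 1)) = ((1 + ‖x‖) ^ (d + 1))⁻¹ := by
      rw [Real.rpow_neg hpos.le]
      congr 1
      exact_mod_cast Real.rpow_natCast (1 + ‖x‖) (d + 1)
    rw [e, ← div_eq_mul_inv, le_div_iff₀ (by positivity), mul_comm]
    exact hx4
  have hint : Integrable (fun x : RSp d => S * (1 + ‖x‖) ^ (-((d : ℝ) + 1))) :=
    (integrable_one_add_norm (by simp)).const_mul S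
  exact hint.mono' hf.continuous.aestronglyMeasurable (Filter.Eventually.of_forall hdom)

end Bounds

/-- The Gelfand–Shilov space `S_θ(ℝ^d)`. -/
def GS (d : ℕ) (θ : ℝ) : Submodule ℂ (RSp d → ℂ) where
  carrier := {f | ContDiff ℝ ∞ f ∧ ∃ C > 0, ∃ M, GSBound θ C M f}
  add_mem' := by
    rintro f g ⟨hf, C, hC, M, h⟩ ⟨hg, C', hC', M', h'⟩
    exact ⟨hf.add hg, max C C', lt_max_of_lt_left hC, M + M',
      (h.mono hC (le_max_left _ _)).add hf hg (h'.mono hC' (le_max_right _ _))⟩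
  zero_mem' := by
    have h0 : ContDiff ℝ ∞ (0 : RSp d → ℂ) :=
      (contDiff_const : ContDiff ℝ ∞ fun _ : RSp d => (0 : ℂ))
    refine ⟨h0, 1, one_pos, 0, fun α β x => ?_⟩
    have := mderiv_smul β 0 h0
    simp only [zero_smul] at this
    simp [this]
  smul_mem' := by
    rintro c f ⟨hf, C, hC, M, h⟩
    exact ⟨hf.const_smul c, C, hC, ‖c‖ * M, h.smul hf c⟩

/-- The tempered ultradistributions `S'_θ(ℝ^d)`: the linear forms `u` on `S_θ(ℝ^d)` such that for
every `ε > 0` there is `K` with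
`|u(f)| ≤ K sup_{α,β} sup_x ε^{-|α|-|β|} (α!)^{-θ} (β!)^{-θ} |x^α ∂^β f(x)|`. -/
def GSDual (d : ℕ) (θ : ℝ) : Submodule ℂ (GS d θ →ₗ[ℂ] ℂ) where
  carrier := {u | ∀ ε > 0, ∃ K, ∀ (f : GS d θ) (M : ℝ),
    GSBound θ ε M (f : RSp d → ℂ) → ‖u f‖ ≤ K * M}
  add_mem' := by
    intro u v hu hv ε hε
    obtain ⟨K, hK⟩ := hu ε hε
    obtain ⟨L, hL⟩ := hv ε hε
    refine ⟨K + L, fun f M h => ?_⟩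
    rw [add_mul]
    exact (norm_add_le _ _).trans (add_le_add (hK f M h) (hL f M h))
  zero_mem' := fun ε _ => ⟨0, fun f M _ => by simp⟩
  smul_mem' := by
    intro c u hu ε hε
    obtain ⟨K, hK⟩ := hu ε hε
    refine ⟨‖c‖ * K, fun f M h => ?_⟩
    rw [LinearMap.smul_apply, norm_smul, mul_assoc]
    exact mul_le_mul_of_nonneg_left (hK f M h) (norm_nonneg _)

/-- Multiplication by the coordinate `x_j` on `S_θ`. -/
def GS.mulX {d : ℕ} {θ : ℝ} (j : Fin d) : GS d θ →ₗ[ℂ] GS d θ where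
  toFun f := ⟨fun x : RSp d => (x j : ℂ) * (f : RSp d → ℂ) x, by
    obtain ⟨hf, C, hC, M, h⟩ := f.2
    have hR := one_le_gsR θ
    exact ⟨(Smooth.mx j ⟨f, hf⟩).2, _, by positivity, _, h.mul_coord hf hC j⟩⟩
  map_add' f g := by
    ext x
    simp [mul_add]
  map_smul' c f := by
    ext x
    simp [mul_left_comm]

/-- The partial derivative `∂_j` on `S_θ`. -/
noncomputable def GS.deriv {d : ℕ} {θ : ℝ} (j : Fin d) : GS d θ →ₗ[ℂ] GS d θ where
  toFun f := ⟨pderiv ℝ j f, by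
    obtain ⟨hf, C, hC, M, h⟩ := f.2
    have hR := one_le_gsR θ
    exact ⟨contDiff_pderiv j hf, _, by positivity, _, h.pderiv hf hC j⟩⟩
  map_add' f g := by
    have h := (Smooth.pd j).map_add ⟨f, f.2.1⟩ ⟨g, g.2.1⟩
    exact Subtype.ext (congrArg (fun k : Smooth d => (k : RSp d → ℂ)) h)
  map_smul' c f := by
    have h := (Smooth.pd j).map_smul c ⟨f, f.2.1⟩
    exact Subtype.ext (congrArg (fun k : Smooth d => (k : RSp d → ℂ)) h)

/-- Multiplication by `x_j` on ultradistributions: `(x_j u)(f) = u(x_j f)`. -/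
noncomputable def GSDual.mulX {d : ℕ} {θ : ℝ} (j : Fin d) : Module.End ℂ (GSDual d θ) where
  toFun u := ⟨(u : GS d θ →ₗ[ℂ] ℂ) ∘ₗ GS.mulX j, by
    intro ε hε
    have hR := one_le_gsR θ
    obtain ⟨K, hK⟩ := u.2 (2 * gsR θ * ε) (by positivity)
    refine ⟨K * (ε + ε⁻¹), fun f M h => ?_⟩
    rw [mul_assoc]
    exact hK (GS.mulX j f) _ (h.mul_coord f.2.1 hε j)⟩
  map_add' u v := rfl
  map_smul' c u := rfl

/-- The derivative `∂_j` on ultradistributions: `(∂_j u)(f) = -u(∂_j f)`. -/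
noncomputable def GSDual.deriv {d : ℕ} {θ : ℝ} (j : Fin d) : Module.End ℂ (GSDual d θ) where
  toFun u := ⟨(u : GS d θ →ₗ[ℂ] ℂ) ∘ₗ (-GS.deriv j), by
    intro ε hε
    have hR := one_le_gsR θ
    obtain ⟨K, hK⟩ := u.2 (2 * gsR θ * ε) (by positivity)
    refine ⟨K * (ε + ε⁻¹), fun f M h => ?_⟩
    have e : ((u : GS d θ →ₗ[ℂ] ℂ) ∘ₗ (-GS.deriv j)) f =
        -((u : GS d θ →ₗ[ℂ] ℂ) (GS.deriv j f)) := map_neg (u : GS d θ →ₗ[ℂ] ℂ) (GS.deriv j f)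
    rw [e, norm_neg, mul_assoc]
    exact hK (GS.deriv j f) _ (h.pderiv f.2.1 hε j)⟩
  map_add' u v := rfl
  map_smul' c u := rfl

/-- The differential operator `Σ c_{α,β} x^α ∂^β` with polynomial coefficients,
acting on ultradistributions. -/
noncomputable def polyDiffOp {d : ℕ} (θ : ℝ) (c : MIdx d × MIdx d →₀ ℂ) :
    Module.End ℂ (GSDual d θ) :=
  c.sum fun p a => a •
    (((List.finRange d).map fun j => GSDual.mulX j ^ p.1 j).prod *
      ((List.finRange d).map fun j => GSDual.deriv j ^ p.2 j).prod)

lemma GS.integrable {d : ℕ} {θ : ℝ} (f : GS d θ) : Integrable (f : RSp d → ℂ) := by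
  obtain ⟨hf, C, hC, M, h⟩ := f.2
  exact h.integrable hf

lemma GS.integrable_mul {d : ℕ} {θ : ℝ} (f g : GS d θ) :
    Integrable fun x : RSp d => (f : RSp d → ℂ) x * (g : RSp d → ℂ) x := by
  obtain ⟨hg, C, hC, M, h⟩ := g.2
  exact (GS.integrable f).mul_bdd hg.continuous.aestronglyMeasurable
    (Filter.Eventually.of_forall h.norm_le)

/-- The embedding `S_θ ⊂ S'_θ`, `f ↦ (g ↦ ∫ f g dx)`. -/
noncomputable def GS.toDual {d : ℕ} {θ : ℝ} (f : GS d θ) : GSDual d θ :=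
  ⟨{ toFun := fun g => ∫ x : RSp d, (f : RSp d → ℂ) x * (g : RSp d → ℂ) x
     map_add' := fun g k => by
       rw [← integral_add (GS.integrable_mul f g) (GS.integrable_mul f k)]
       simp [mul_add]
     map_smul' := fun c g => by
       rw [RingHom.id_apply, smul_eq_mul, ← integral_const_mul]
       simp [mul_left_comm] }, by
    intro ε hε
    refine ⟨∫ x : RSp d, ‖(f : RSp d → ℂ) x‖, fun g M h => ?_⟩
    rw [← integral_mul_const]
    refine norm_integral_le_of_norm_le ((GS.integrable f).norm.mul_const M)
      (Filter.Eventually.of_forall fun x => ?_)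
    rw [norm_mul]
    exact mul_le_mul_of_nonneg_left (h.norm_le x) (norm_nonneg _)⟩

/-! ### The FBI transform -/

/-- An FBI phase `φ(z, y) = ½⟨Az, z⟩ + ⟨Bz, y⟩ + ½⟨Cy, y⟩` (bilinear brackets). -/
structure FBIPhase (d : ℕ) where
  A : Matrix (Fin d) (Fin d) ℂ
  B : Matrix (Fin d) (Fin d) ℂ
  C : Matrix (Fin d) (Fin d) ℂ
  symmA : A.IsSymm
  symmC : C.IsSymm
  detB : B.det ≠ 0
  posC : (C.map Complex.im).PosDef

namespace FBIPhase

open scoped Matrix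

variable {d : ℕ} (φ : FBIPhase d)

/-- The real vector `y` as a complex vector. -/
def cvec (y : RSp d) : Fin d → ℂ := fun i => (y i : ℂ)

/-- The value `φ(z, y)`. -/
noncomputable def val (z : CSp d) (y : RSp d) : ℂ :=
  1 / 2 * ((φ.A *ᵥ z.ofLp) ⬝ᵥ z.ofLp) + (φ.B *ᵥ z.ofLp) ⬝ᵥ cvec y +
    1 / 2 * ((φ.C *ᵥ cvec y) ⬝ᵥ cvec y)

/-- The constant `c_φ = 2^{-d/2} π^{-3d/4} (det Im C)^{-1/4} |det B|`. -/
noncomputable def const : ℝ :=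
  (2 : ℝ) ^ (-(d : ℝ) / 2) * Real.pi ^ (-3 * (d : ℝ) / 4) *
    (φ.C.map Complex.im).det ^ (-(1 : ℝ) / 4) * ‖φ.B.det‖

/-- The weight `Φ(z) = max_y (-Im φ(z, y))`. -/
noncomputable def weight (z : CSp d) : ℝ := ⨆ y : RSp d, -(φ.val z y).im

/-- The bijection `χ^♭_φ : T^*ℝ^d → ℂ^d`, `(y, -φ'_y(z, y)) ↦ z`; as `φ'_y(z, y) = Bz + Cy`, it
sends `(y, η)` to `-B⁻¹ (η + C y)`. -/
noncomputable def chi (p : RSp d × RSp d) : CSp d :=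
  WithLp.toLp 2 (-(φ.B⁻¹ *ᵥ (cvec p.2 + φ.C *ᵥ cvec p.1)))

/-- The kernel `y ↦ e^{iφ(z, y)}`. -/
noncomputable def kernel (z : CSp d) : RSp d → ℂ := fun y => Complex.exp (Complex.I * φ.val z y)

open scoped Classical in
/-- The FBI transform `T_φ u(z) = c_φ ⟨u_y, e^{iφ(z,y)}⟩` of an ultradistribution. For
`θ ≥ 1/2` the Gaussian kernel lies in `S_θ` for every `z`, so that the second case is void. -/
noncomputable def fbi {θ : ℝ} (u : GSDual d θ) (z : CSp d) : ℂ :=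
  if h : φ.kernel z ∈ GS d θ then φ.const * (u : GS d θ →ₗ[ℂ] ℂ) ⟨φ.kernel z, h⟩ else 0

/-- The FBI transform `T_φ g(z) = c_φ ∫ g(y) e^{iφ(z,y)} dy` of a function. -/
noncomputable def fbiFun (g : RSp d → ℂ) (z : CSp d) : ℂ :=
  φ.const * ∫ y : RSp d, g y * φ.kernel z y

/-- The integrand of the sesquilinear pairing `(U, T_φ f̄)` in `L²(ℂ^d, e^{-2Φ} dλ)`. -/
noncomputable def adjIntegrand (U : CSp d → ℂ) (f : RSp d → ℂ) (z : CSp d) : ℂ :=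
  U z * starRingEnd ℂ (φ.fbiFun (fun y => starRingEnd ℂ (f y)) z) *
    (Real.exp (-2 * φ.weight z) : ℂ)

/-- `v = T_φ^* U`: the adjoint of `T_φ` with respect to `L²(ℂ^d, e^{-2Φ} dλ)`, that is
`⟨v, f⟩ = (v, f̄) = ∫ U(z) \overline{T_φ f̄(z)} e^{-2Φ(z)} dλ(z)` for all test functions `f`,
with absolutely convergent integrals. -/
def IsAdjoint {θ : ℝ} (U : CSp d → ℂ) (v : GSDual d θ) : Prop :=
  ∀ f : GS d θ, Integrable (φ.adjIntegrand U f) ∧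
    (v : GS d θ →ₗ[ℂ] ℂ) f = ∫ z : CSp d, φ.adjIntegrand U f z

/-! ### The global wave front set -/

/-- The estimate `|T_φ u(z)| ≤ K e^{-ε|z|^{1/θ} + Φ(z)}` for all `z ∈ L`. -/
def DecaysOn {θ : ℝ} (u : GSDual d θ) (L : Set (CSp d)) (K ε : ℝ) : Prop :=
  ∀ z ∈ L, ‖φ.fbi u z‖ ≤ K * Real.exp (-ε * ‖z‖ ^ (1 / θ) + φ.weight z)

/-- `L` is an open conic neighbourhood of `z₀` in `ℂ^d ∖ {0}`. -/
def IsConicNhd (L : Set (CSp d)) (z₀ : CSp d) : Prop :=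
  IsOpen L ∧ z₀ ∈ L ∧ (0 : CSp d) ∉ L ∧ ∀ z ∈ L, ∀ t : ℝ, 0 < t → t • z ∈ L

/-- The global wave front set `WF(u) ⊂ ℝ^{2d} ∖ {0}`. -/
def WF {θ : ℝ} (u : GSDual d θ) : Set (RSp d × RSp d) :=
  {p | p ≠ 0 ∧ ¬ ∃ L, IsConicNhd L (φ.chi p) ∧ ∃ ε > 0, ∃ K > 0, φ.DecaysOn u L K ε}

/-- `Γ` is a closed cone in `T^*ℝ^d ∖ {0}`. -/
def IsClosedCone (Γ : Set (RSp d × RSp d)) : Prop :=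
  0 ∉ Γ ∧ (∃ F, IsClosed F ∧ Γ = F \ {0}) ∧ ∀ p ∈ Γ, ∀ t : ℝ, 0 < t → t • p ∈ Γ

/-- The space `S'_{θ,Γ} = {u ∈ S'_θ | WF(u) ⊂ Γ}`. -/
def DualWF (θ : ℝ) (Γ : Set (RSp d × RSp d)) : Set (GSDual d θ) := {u | φ.WF u ⊆ Γ}

/-- Convergence `u_n → v` in `S'_{θ,Γ}`, that is `u_n - v → 0`: weak convergence in `S'_θ`,
together with decay estimates near the points outside `Γ` that are uniform in `n`. -/
def TendstoWF {θ : ℝ} (Γ : Set (RSp d × RSp d)) (u : ℕ → GSDual d θ) (v : GSDual d θ) : Prop :=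
  (∀ f : GS d θ, Tendsto (fun n => ((u n - v : GSDual d θ) : GS d θ →ₗ[ℂ] ℂ) f) atTop (𝓝 0)) ∧
  ∀ p, p ≠ 0 → p ∉ Γ → ∃ L, IsConicNhd L (φ.chi p) ∧ ∃ ε > 0, ∃ K > 0,
    ∀ n, φ.DecaysOn (u n - v) L K ε

end FBIPhase

/-- The space `MS^θ(ℂ^d)` of entire multipliers. -/
def MS (d : ℕ) (θ : ℝ) : Set (CSp d → ℂ) :=
  {h | Differentiable ℂ h ∧
    ∀ ε > 0, ∃ D > 0, ∀ z, ‖h z‖ ≤ D * Real.exp (ε * ‖z‖ ^ (1 / θ))}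

open MeasureTheory Filter Topology
open scoped ContDiff Matrix

/-! ### Elementary inequalities -/

/-! The transform `fbi` turns ultradistributions into entire functions $F$ with $|F|\le
G_\varepsilon e^{\varepsilon|z|^{1/\theta}+\Phi}$ for every $\varepsilon>0$, and turns elements of
$\mathcal S_\theta$ into functions with $|F|\le Ge^{-\delta|z|^{1/\theta}+\Phi}$ for some
$\delta>0$. Growth comes from Gelfand–Shilov bounds of the Gaussian kernel (`exists_gsBound_kernel`,
`exists_norm_fbi_le`). Decay comes from operators of order one that become multiplication by
$(Bz)_j$ (`exists_norm_fbi_toDual_le`). The two rates make the pairing defining $T_\varphi^*$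
absolutely convergent (`adj`). Moreover $T_\varphi T_\varphi^*U=U$ for entire $U$ of this growth
(`fbi_adj`), which is the mean value property for a Gaussian measure. Hence $T_\varphi
Au=\sum_\alpha h_\alpha\partial^\alpha T_\varphi u$ (`hasSum_fbi_symOp`), and everything becomes an
estimate on entire functions.

These estimates are Cauchy's, on polydiscs of radius $\lambda m^{1-\theta}$ with $m=|\alpha|+1$. As
$\Phi$ is quadratic, moving $z$ by $w$ in the polydisc changes it by $O(|z||w|+|w|^2)$. By Young's
inequality $|z|m^{1-\theta}\le|z|^{1/\theta}+m$, and $m^{2(1-\theta)}\le m$ because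
$\theta\ge\frac12$. So $\partial^\alpha F$ costs $\alpha!^\theta K^{|\alpha|+1}$ and an arbitrarily
small multiple of $|z|^{1/\theta}$ in the exponent (`exists_norm_mderiv_le`). The hypothesis on
$h_\alpha$ cancels $\alpha!^\theta$ and leaves a geometric series.

The same argument localizes in cones (`exists_norm_mderiv_le_of_decay`). In a slightly smaller cone,
either the polydisc stays inside the region of decay, or its radius exceeds $c|z|$; then
$|z|^{1/\theta}=O(m)$, and any exponential of $|z|^{1/\theta}$ is absorbed in $K^{|\alpha|+1}$. This
gives $\mathrm{WF}(Au)\subset\mathrm{WF}(u)$ with uniform constants. Continuity follows from these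
constants and from uniform boundedness in $\mathcal S'_\theta$ (`GSDual.exists_forall_norm_le`),
since weakly convergent sequences are equicontinuous.

For $f\in\mathcal S_\theta$ the decay of $T_\varphi f$ holds on all of $\mathbb C^d$ and is
inherited by $T_\varphi Af$. Since $Af=T_\varphi^*(T_\varphi Af)$ (`adj_fbi_symOp`), $Af$ is an
integral of Gaussians that converges in $\mathcal S_\theta$ (`exists_eq_toDual_adj`). Polynomial
differential operators are treated directly: $T_\varphi(x_ku)$ and $T_\varphi(\partial_ju)$ are
first-order expressions in $T_\varphi u$ with coefficients of degree at most one. -/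

/-- Young's inequality with exponents $1/\theta$ and $1/(1-\theta)$. It separates $|z|$ from
$|\alpha|$ in the mixed terms produced by Cauchy's estimates. -/
lemma mul_rpow_one_sub_le {θ a m : ℝ} (hθ : 0 < θ) (hθ' : θ < 1) (ha : 0 ≤ a) (hm : 0 ≤ m) :
    a * m ^ (1 - θ) ≤ a ^ (1 / θ) + m := by
  have hpq : (1 / θ).HolderConjugate (1 / (1 - θ)) := by
    rw [Real.holderConjugate_iff]
    refine ⟨by rw [lt_div_iff₀ hθ]; linarith, by simp⟩
  have h := Real.young_inequality_of_nonneg ha (Real.rpow_nonneg hm (1 - θ)) hpq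
  have h1 : (m ^ (1 - θ)) ^ (1 / (1 - θ)) = m := by
    rw [← Real.rpow_mul hm, mul_one_div_cancel (by linarith), Real.rpow_one]
  rw [h1] at h
  refine h.trans (add_le_add ?_ ?_)
  · rw [div_div_eq_mul_div, div_one]
    exact mul_le_of_le_one_right (Real.rpow_nonneg ha _) hθ'.le
  · rw [div_div_eq_mul_div, div_one]
    exact mul_le_of_le_one_right hm (by linarith)

lemma add_rpow_inv_le {θ a b : ℝ} (hθ : 1 / 2 ≤ θ) (ha : 0 ≤ a) (hb : 0 ≤ b) :
    (a + b) ^ (1 / θ) ≤ 4 * (a ^ (1 / θ) + b ^ (1 / θ)) := by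
  have hθ0 : 0 < θ := by linarith
  have hq : 1 / θ ≤ 2 := by rw [div_le_iff₀ hθ0]; linarith
  have hq0 : 0 ≤ 1 / θ := by positivity
  have h2 : (2 : ℝ) ^ (1 / θ) ≤ 4 := by
    calc (2 : ℝ) ^ (1 / θ) ≤ 2 ^ (2 : ℝ) := Real.rpow_le_rpow_of_exponent_le (by norm_num) hq
      _ = 4 := by norm_num
  have key : ∀ {x y : ℝ}, 0 ≤ x → 0 ≤ y → x ≤ y →
      (x + y) ^ (1 / θ) ≤ 4 * (x ^ (1 / θ) + y ^ (1 / θ)) := by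
    intro x y hx hy hxy
    calc (x + y) ^ (1 / θ) ≤ (2 * y) ^ (1 / θ) :=
          Real.rpow_le_rpow (by positivity) (by linarith) hq0
      _ = 2 ^ (1 / θ) * y ^ (1 / θ) := Real.mul_rpow (by norm_num) hy
      _ ≤ 4 * y ^ (1 / θ) := mul_le_mul_of_nonneg_right h2 (Real.rpow_nonneg hy _)
      _ ≤ _ := by linarith [Real.rpow_nonneg hx (1 / θ)]
  rcases le_total a b with h | h
  · exact key ha hb h
  · rw [add_comm a b, add_comm (a ^ _)]
    exact key hb ha h

lemma rpow_inv_le_one_add_sq {θ t : ℝ} (hθ : 1 / 2 ≤ θ) (ht : 0 ≤ t) :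
    t ^ (1 / θ) ≤ 1 + t ^ 2 := by
  have hθ0 : 0 < θ := by linarith
  have hq : 1 / θ ≤ 2 := by rw [div_le_iff₀ hθ0]; linarith
  rcases le_total t 1 with h | h
  · have := Real.rpow_le_one ht h (by positivity : 0 ≤ 1 / θ)
    nlinarith [sq_nonneg t]
  · have := Real.rpow_le_rpow_of_exponent_le h hq
    rw [Real.rpow_two] at this
    linarith

/-- The $\theta$-th power of $s^n/n!\le e^s$ at $s=\mu t^{1/\theta}$, with $e^{\theta s}\le e^s$. -/
lemma pow_le_factorial_rpow_mul_exp {θ t μ : ℝ} (hθ : 0 < θ) (hθ' : θ < 1) (ht : 0 ≤ t)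
    (hμ : 0 < μ) (n : ℕ) :
    t ^ n ≤ (n.factorial : ℝ) ^ θ * (μ ^ (-θ)) ^ n * Real.exp (μ * t ^ (1 / θ)) := by
  have hs : 0 ≤ t ^ (1 / θ) := Real.rpow_nonneg ht _
  have h1 := Real.pow_div_factorial_le_exp (μ * t ^ (1 / θ)) (by positivity) n
  have hf : (0 : ℝ) < n.factorial := by exact_mod_cast n.factorial_pos
  rw [div_le_iff₀ hf] at h1
  have h2 : t ^ n = (((t ^ (1 / θ)) ^ n)) ^ θ := by
    rw [← Real.rpow_natCast (t ^ (1 / θ)), ← Real.rpow_mul hs, mul_comm, Real.rpow_mul hs,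
      ← Real.rpow_mul ht, one_div_mul_cancel hθ.ne', Real.rpow_one, Real.rpow_natCast]
  have h3 : (t ^ (1 / θ)) ^ n = (μ ^ n)⁻¹ * (μ * t ^ (1 / θ)) ^ n := by
    rw [mul_pow]; field_simp
  rw [h2, h3]
  have h4 : ((μ ^ n)⁻¹) ^ θ = (μ ^ (-θ)) ^ n := by
    rw [← Real.rpow_natCast, ← Real.rpow_natCast, ← Real.rpow_neg hμ.le, ← Real.rpow_mul hμ.le,
      ← Real.rpow_mul hμ.le]
    ring_nf
  rw [Real.mul_rpow (by positivity) (by positivity), h4]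
  have h5 : (Real.exp (μ * t ^ (1 / θ))) ^ θ ≤ Real.exp (μ * t ^ (1 / θ)) := by
    rw [← Real.exp_mul]
    exact Real.exp_le_exp.2 (mul_le_of_le_one_right (by positivity) hθ'.le)
  calc (μ ^ (-θ)) ^ n * ((μ * t ^ (1 / θ)) ^ n) ^ θ
      ≤ (μ ^ (-θ)) ^ n * (Real.exp (μ * t ^ (1 / θ)) * n.factorial) ^ θ := by
        gcongr
    _ = (μ ^ (-θ)) ^ n * (Real.exp (μ * t ^ (1 / θ)) ^ θ * (n.factorial : ℝ) ^ θ) := by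
        rw [Real.mul_rpow (Real.exp_pos _).le hf.le]
    _ ≤ (μ ^ (-θ)) ^ n * (Real.exp (μ * t ^ (1 / θ)) * (n.factorial : ℝ) ^ θ) := by
        gcongr
    _ = _ := by ring

/-- Factorial bounds on all moments give exponential decay. -/
lemma le_exp_of_forall_pow_le {θ t X Y R : ℝ} (hθ : 0 < θ) (hθ' : θ < 1) (ht : 0 ≤ t)
    (hX : 0 ≤ X) (hY : 0 ≤ Y) (hR : 0 < R)
    (h : ∀ n : ℕ, t ^ n * X ≤ Y * R ^ n * (n.factorial : ℝ) ^ θ) :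
    X ≤ 2 * Y * Real.exp (-(θ / 2 * (t / R) ^ (1 / θ))) := by
  set s : ℝ := (t / R) ^ (1 / θ) with hs
  have htR : 0 ≤ t / R := by positivity
  have hs0 : 0 ≤ s := Real.rpow_nonneg htR _
  have hsθ : ∀ n : ℕ, (s ^ n) ^ θ = (t / R) ^ n := by
    intro n
    rw [hs, ← Real.rpow_natCast, ← Real.rpow_mul htR, ← Real.rpow_mul htR, ← Real.rpow_natCast]
    congr 1
    field_simp
  have hq0 : 0 ≤ 1 / θ := by positivity
  -- The power $1/\theta$ turns $n!^\theta$ into $n!$. The extra factor $2^{-n}/n!$ makes the right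
  -- side geometric, while the left side sums to the exponential series at $s/2$.
  have h1 : ∀ n : ℕ, X ^ (1 / θ) * ((s / 2) ^ n / n.factorial) ≤ Y ^ (1 / θ) * (1 / 2) ^ n := by
    intro n
    have hf : (0 : ℝ) < n.factorial := by exact_mod_cast n.factorial_pos
    have h2 : X * (s ^ n) ^ θ ≤ Y * (n.factorial : ℝ) ^ θ := by
      rw [hsθ, div_pow, ← mul_div_assoc, div_le_iff₀ (by positivity)]
      calc X * t ^ n = t ^ n * X := by ring
        _ ≤ _ := h n
        _ = _ := by ring
    have h3 := Real.rpow_le_rpow (by positivity) h2 hq0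
    rw [Real.mul_rpow hX (by positivity), Real.mul_rpow hY (by positivity),
      ← Real.rpow_mul (by positivity), ← Real.rpow_mul hf.le, mul_one_div_cancel hθ.ne',
      Real.rpow_one, Real.rpow_one] at h3
    calc X ^ (1 / θ) * ((s / 2) ^ n / n.factorial)
        = (X ^ (1 / θ) * s ^ n) * ((1 / 2) ^ n / n.factorial) := by rw [div_pow, div_pow]; ring
      _ ≤ (Y ^ (1 / θ) * n.factorial) * ((1 / 2) ^ n / n.factorial) := by gcongr
      _ = _ := by field_simp
  have hS1 : HasSum (fun n : ℕ => X ^ (1 / θ) * ((s / 2) ^ n / n.factorial))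
      (X ^ (1 / θ) * Real.exp (s / 2)) := by
    have := NormedSpace.expSeries_div_hasSum_exp (s / 2)
    rw [← Real.exp_eq_exp_ℝ] at this
    exact this.mul_left _
  have hS2 : HasSum (fun n : ℕ => Y ^ (1 / θ) * (1 / 2 : ℝ) ^ n) (Y ^ (1 / θ) * 2) :=
    hasSum_geometric_two.mul_left _
  have h4 := hasSum_le h1 hS1 hS2
  have h5 := Real.rpow_le_rpow (by positivity) h4 hθ.le
  rw [Real.mul_rpow (by positivity) (by positivity), Real.mul_rpow (by positivity) (by norm_num),
    ← Real.rpow_mul hX, ← Real.rpow_mul hY, one_div_mul_cancel hθ.ne', Real.rpow_one,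
    Real.rpow_one, ← Real.exp_mul] at h5
  have h6 : (2 : ℝ) ^ θ ≤ 2 := by
    calc (2 : ℝ) ^ θ ≤ 2 ^ (1 : ℝ) := Real.rpow_le_rpow_of_exponent_le (by norm_num) hθ'.le
      _ = 2 := by norm_num
  rw [Real.exp_neg, ← div_eq_mul_inv, le_div_iff₀ (Real.exp_pos _)]
  calc X * Real.exp (θ / 2 * s) = X * Real.exp (s / 2 * θ) := by ring_nf
    _ ≤ Y * 2 ^ θ := h5
    _ ≤ Y * 2 := by gcongr
    _ = 2 * Y := by ring

/-! ### Multi-indices -/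

section MultiIndex

variable {d : ℕ}

lemma MIdx.fact_le_pow (α : MIdx d) : MIdx.fact α ≤ (MIdx.len α + 1) ^ MIdx.len α := by
  unfold MIdx.fact
  calc ∏ i, (α i).factorial ≤ ∏ i, (MIdx.len α + 1) ^ α i := by
        refine Finset.prod_le_prod' fun i _ => (Nat.factorial_le_pow _).trans ?_
        exact Nat.pow_le_pow_left ((MIdx.le_len α i).trans (Nat.le_succ _)) _
    _ = _ := by rw [Finset.prod_pow_eq_pow_sum]; rfl

/-- Cauchy's factor $\alpha!\,r^{-|\alpha|}$ for $r=\lambda m^{1-\theta}$, $m=|\alpha|+1$: since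
$\alpha!\le m^{|\alpha|}$, the radius compensates $\alpha!^{1-\theta}$ and only $\alpha!^\theta$
survives. -/
lemma MIdx.fact_mul_inv_pow_le {θ lam : ℝ} (hθ' : θ < 1) (hl : 0 < lam)
    (α : MIdx d) :
    (α.fact : ℝ) * ((lam * ((α.len : ℝ) + 1) ^ (1 - θ)) ^ α.len)⁻¹ ≤
      (α.fact : ℝ) ^ θ * (lam⁻¹) ^ α.len := by
  have hm : (0 : ℝ) < (α.len : ℝ) + 1 := by positivity
  have h1 : (α.fact : ℝ) ^ (1 - θ) ≤ (((α.len : ℝ) + 1) ^ (1 - θ)) ^ α.len := by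
    calc (α.fact : ℝ) ^ (1 - θ) ≤ ((((α.len : ℝ) + 1)) ^ α.len) ^ (1 - θ) := by
          refine Real.rpow_le_rpow (by positivity) ?_ (by linarith)
          exact_mod_cast MIdx.fact_le_pow α
      _ = _ := by
          rw [← Real.rpow_natCast, ← Real.rpow_natCast, ← Real.rpow_mul hm.le,
            ← Real.rpow_mul hm.le, mul_comm]
  have h2 : (α.fact : ℝ) = (α.fact : ℝ) ^ θ * (α.fact : ℝ) ^ (1 - θ) := by
    rw [← Real.rpow_add (MIdx.fact_pos α)]; simp
  have h3 : (0 : ℝ) < (((α.len : ℝ) + 1) ^ (1 - θ)) ^ α.len := by positivity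
  have hF : (0 : ℝ) ≤ (α.fact : ℝ) ^ θ := by positivity
  calc (α.fact : ℝ) * ((lam * ((α.len : ℝ) + 1) ^ (1 - θ)) ^ α.len)⁻¹
      = (α.fact : ℝ) ^ θ * (lam⁻¹) ^ α.len *
        ((α.fact : ℝ) ^ (1 - θ) * ((((α.len : ℝ) + 1) ^ (1 - θ)) ^ α.len)⁻¹) := by
        nth_rewrite 1 [h2]
        rw [mul_pow, mul_inv, inv_pow]; ring
    _ ≤ (α.fact : ℝ) ^ θ * (lam⁻¹) ^ α.len * 1 := by
        gcongr
        rw [← div_eq_mul_inv, div_le_one h3]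
        exact h1
    _ = _ := mul_one _

/-- A finite set of multi-indices lies in a box, and over a box the sum factors into $d$ geometric
sums. -/
lemma MIdx.summable_pow_len {ρ : ℝ} (h0 : 0 ≤ ρ) (h1 : ρ < 1) :
    Summable fun α : MIdx d => ρ ^ α.len := by
  refine summable_of_sum_le (c := ((1 - ρ)⁻¹) ^ d) (fun α => by positivity) fun s => ?_
  obtain ⟨N, hN⟩ : ∃ N : ℕ, ∀ α ∈ s, ∀ i, α i < N := by
    refine ⟨s.sup MIdx.len + 1, fun α hα i => Nat.lt_succ_of_le ?_⟩
    exact (MIdx.le_len α i).trans (Finset.le_sup hα)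
  calc ∑ α ∈ s, ρ ^ α.len
      ≤ ∑ α ∈ Fintype.piFinset (fun _ : Fin d => Finset.range N), ρ ^ MIdx.len α := by
        refine Finset.sum_le_sum_of_subset_of_nonneg (fun α hα => ?_) fun _ _ _ => by positivity
        exact Fintype.mem_piFinset.2 fun i => Finset.mem_range.2 (hN α hα i)
    _ = ∏ _i : Fin d, ∑ k ∈ Finset.range N, ρ ^ k := by
        rw [Finset.prod_univ_sum]
        refine Finset.sum_congr rfl fun α _ => ?_
        rw [Finset.prod_pow_eq_pow_sum]; rfl
    _ ≤ ∏ _i : Fin d, (1 - ρ)⁻¹ := by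
        refine Finset.prod_le_prod (fun _ _ => Finset.sum_nonneg fun _ _ => by positivity)
          fun _ _ => ?_
        rw [← tsum_geometric_of_lt_one h0 h1]
        exact (summable_geometric_of_lt_one h0 h1).sum_le_tsum _ fun _ _ => by positivity
    _ = _ := by simp

end MultiIndex

/-- Here $\theta\ge\frac12$ is essential: $2(1-\theta)\le1$, so the square of the Cauchy radius
grows at most linearly in $m$ and can be absorbed in a power $K^m$. The next lemma uses
$(1-\theta)/\theta\le1$ in the same way. -/
lemma rpow_one_sub_sq_le {θ m : ℝ} (hθ : 1 / 2 ≤ θ) (hm : 1 ≤ m) :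
    (m ^ (1 - θ)) ^ 2 ≤ m := by
  rw [← Real.rpow_natCast, ← Real.rpow_mul (by linarith)]
  calc m ^ ((1 - θ) * (2 : ℕ)) ≤ m ^ (1 : ℝ) :=
        Real.rpow_le_rpow_of_exponent_le hm (by push_cast; linarith)
    _ = m := Real.rpow_one m

lemma rpow_one_sub_rpow_inv_le {θ m : ℝ} (hθ : 1 / 2 ≤ θ) (hm : 1 ≤ m) :
    (m ^ (1 - θ)) ^ (1 / θ) ≤ m := by
  rw [← Real.rpow_mul (by linarith)]
  calc m ^ ((1 - θ) * (1 / θ)) ≤ m ^ (1 : ℝ) := by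
        refine Real.rpow_le_rpow_of_exponent_le hm ?_
        rw [mul_one_div, div_le_iff₀ (by linarith)]; linarith
    _ = m := Real.rpow_one m

/-! ### Entire functions on `ℂ^d` -/

section Entire

variable {d : ℕ}

lemma contDiff_pderiv_complex (i : Fin d) {F : CSp d → ℂ} (hF : ContDiff ℂ ∞ F) :
    ContDiff ℂ ∞ (pderiv ℂ i F) := by
  have h : ContDiff ℂ ∞ (fderiv ℂ F) := hF.fderiv_right (by simp)
  exact h.clm_apply contDiff_const

lemma contDiff_iterate_pderiv_complex (i : Fin d) {F : CSp d → ℂ} (hF : ContDiff ℂ ∞ F) (n : ℕ) :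
    ContDiff ℂ ∞ ((pderiv ℂ i)^[n] F) := by
  induction n with
  | zero => exact hF
  | succ n ih => rw [Function.iterate_succ_apply']; exact contDiff_pderiv_complex i ih

lemma contDiff_foldr_pderiv_complex (l : List (Fin d)) (α : MIdx d) {F : CSp d → ℂ}
    (hF : ContDiff ℂ ∞ F) :
    ContDiff ℂ ∞ (l.foldr (fun i f => (pderiv ℂ i)^[α i] f) F) := by
  induction l with
  | nil => exact hF
  | cons i l ih => exact contDiff_iterate_pderiv_complex i ih _

lemma contDiff_mderiv_complex (α : MIdx d) {F : CSp d → ℂ} (hF : ContDiff ℂ ∞ F) :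
    ContDiff ℂ ∞ (mderiv ℂ α F) :=
  contDiff_foldr_pderiv_complex _ α hF

lemma hasDerivAt_line (i : Fin d) {F : CSp d → ℂ} (hF : ContDiff ℂ ∞ F) (z : CSp d) (t : ℂ) :
    HasDerivAt (fun t : ℂ => F (z + t • EuclideanSpace.single i 1))
      (pderiv ℂ i F (z + t • EuclideanSpace.single i 1)) t := by
  have h1 : HasFDerivAt F (fderiv ℂ F (z + t • EuclideanSpace.single i 1))
      (z + t • EuclideanSpace.single i 1) :=
    (hF.differentiable (by simp) _).hasFDerivAt
  have h2 : HasDerivAt (fun t : ℂ => z + t • (EuclideanSpace.single i 1 : CSp d))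
      (EuclideanSpace.single i 1) t := by
    simpa using ((hasDerivAt_id t).smul_const (EuclideanSpace.single i 1 : CSp d)).const_add z
  exact h1.comp_hasDerivAt t h2

lemma iteratedDeriv_line (i : Fin d) {F : CSp d → ℂ} (hF : ContDiff ℂ ∞ F) (z : CSp d) (n : ℕ) :
    iteratedDeriv n (fun t : ℂ => F (z + t • EuclideanSpace.single i 1)) =
      fun t => (pderiv ℂ i)^[n] F (z + t • EuclideanSpace.single i 1) := by
  induction n with
  | zero => simp
  | succ n ih =>
    rw [iteratedDeriv_succ, ih]
    funext t
    rw [Function.iterate_succ_apply']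
    exact (hasDerivAt_line i (contDiff_iterate_pderiv_complex i hF n) z t).deriv

lemma norm_iterate_pderiv_le (i : Fin d) {F : CSp d → ℂ} (hF : ContDiff ℂ ∞ F) (z : CSp d) (n : ℕ)
    {r S : ℝ} (hr : 0 < r)
    (h : ∀ t : ℂ, ‖t‖ ≤ r → ‖F (z + t • EuclideanSpace.single i 1)‖ ≤ S) :
    ‖(pderiv ℂ i)^[n] F z‖ ≤ n.factorial * (r ^ n)⁻¹ * S := by
  have hd : Differentiable ℂ (fun t : ℂ => F (z + t • EuclideanSpace.single i 1)) :=
    fun t => (hasDerivAt_line i hF z t).differentiableAt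
  have h1 := Complex.norm_iteratedDeriv_le_of_forall_mem_sphere_norm_le (c := 0) n hr
    hd.diffContOnCl (C := S) (fun t ht => h t (by simpa using (mem_sphere_zero_iff_norm.1 ht).le))
  rw [iteratedDeriv_line i hF] at h1
  simp only [zero_smul, add_zero] at h1
  refine h1.trans (le_of_eq ?_)
  rw [div_eq_mul_inv]; ring

/-- Cauchy's estimates on polydiscs. -/
lemma norm_mderiv_le (α : MIdx d) {F : CSp d → ℂ} (hF : ContDiff ℂ ∞ F) (z : CSp d)
    {r S : ℝ} (hr : 0 < r) (h : ∀ w : CSp d, (∀ j, ‖w j‖ ≤ r) → ‖F (z + w)‖ ≤ S) :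
    ‖mderiv ℂ α F z‖ ≤ α.fact * (r ^ α.len)⁻¹ * S := by
  -- The bound is assumed only on the polydisc in the directions of `l`. In the induction the
  -- one-variable estimate then adds the direction `i` to a polydisc that does not yet use it.
  have key : ∀ l : List (Fin d), l.Nodup → ∀ z : CSp d,
      (∀ w : CSp d, (∀ j, ‖w j‖ ≤ r) → (∀ j, j ∉ l → w j = 0) → ‖F (z + w)‖ ≤ S) →
      ‖l.foldr (fun i f => (pderiv ℂ i)^[α i] f) F z‖ ≤
        (l.map fun i => ((α i).factorial : ℝ) * (r ^ α i)⁻¹).prod * S := by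
    intro l
    induction l with
    | nil =>
      intro _ z hz
      simpa using hz 0 (fun _ => by simpa using hr.le) (by simp)
    | cons i l ih =>
      intro hl z hz
      rw [List.nodup_cons] at hl
      rw [List.foldr_cons, List.map_cons, List.prod_cons, mul_assoc]
      refine norm_iterate_pderiv_le i (contDiff_foldr_pderiv_complex l α hF) z (α i) hr
        fun t ht => ih hl.2 _ fun w hw hw0 => ?_
      rw [add_assoc]
      refine hz _ (fun j => ?_) fun j hj => ?_
      · by_cases hji : j = i
        · subst hji
          simpa [hw0 j hl.1] using ht
        · simpa [hji] using hw j
      · rw [List.mem_cons, not_or] at hj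
        simp [hj.1, hw0 j hj.2]
  have h1 := key (List.finRange d) (List.nodup_finRange d) z fun w hw _ => h w hw
  have e : ((List.finRange d).map fun i => ((α i).factorial : ℝ) * (r ^ α i)⁻¹).prod =
      α.fact * (r ^ α.len)⁻¹ := by
    rw [← List.ofFn_eq_map, List.prod_ofFn, Finset.prod_mul_distrib, Finset.prod_inv_distrib,
      Finset.prod_pow_eq_pow_sum]
    simp [MIdx.fact, MIdx.len]
  rw [← e]
  exact h1

/-- Cauchy's estimates with the radius `λ (|α| + 1)^{1-θ}`. -/
lemma norm_mderiv_le_of_radius {θ lam : ℝ} (hθ' : θ < 1) (hl : 0 < lam) (α : MIdx d)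
    {F : CSp d → ℂ} (hF : ContDiff ℂ ∞ F) (z : CSp d) {S : ℝ}
    (h : ∀ w : CSp d, (∀ j, ‖w j‖ ≤ lam * ((α.len : ℝ) + 1) ^ (1 - θ)) → ‖F (z + w)‖ ≤ S) :
    ‖mderiv ℂ α F z‖ ≤ (α.fact : ℝ) ^ θ * (lam⁻¹) ^ α.len * S := by
  have hr : 0 < lam * ((α.len : ℝ) + 1) ^ (1 - θ) := by positivity
  have hS : 0 ≤ S := (norm_nonneg _).trans (h 0 fun j => by simpa using hr.le)
  exact (norm_mderiv_le α hF z hr h).trans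
    (mul_le_mul_of_nonneg_right (MIdx.fact_mul_inv_pow_le hθ' hl α) hS)

lemma norm_le_of_coord_le {w : CSp d} {r : ℝ} (h : ∀ j, ‖w j‖ ≤ r) : ‖w‖ ≤ d * r := by
  rw [EuclideanSpace.norm_eq]
  refine Real.sqrt_le_iff.2 ⟨?_, ?_⟩
  · rcases Nat.eq_zero_or_pos d with hd | hd
    · subst hd; simp
    · exact mul_nonneg (Nat.cast_nonneg _) ((norm_nonneg _).trans (h ⟨0, hd⟩))
  · calc ∑ i, ‖w i‖ ^ 2 ≤ (∑ i, ‖w i‖) ^ 2 :=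
          Finset.sum_sq_le_sq_sum_of_nonneg fun i _ => norm_nonneg _
      _ ≤ (d * r) ^ 2 := by
          refine pow_le_pow_left₀ (Finset.sum_nonneg fun i _ => norm_nonneg _) ?_ 2
          simpa using Finset.sum_le_sum fun i (_ : i ∈ Finset.univ) => h i

/-! ### Real and imaginary parts of vectors -/

/-- The inclusion `ℝ^d ⊂ ℂ^d`. -/
noncomputable def toC : RSp d →L[ℝ] CSp d :=
  LinearMap.toContinuousLinearMap
    { toFun := fun x => WithLp.toLp 2 fun i => (x i : ℂ)
      map_add' := fun x y => by ext i; simp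
      map_smul' := fun c x => by ext i; simp }

/-- The real part of a complex vector. -/
noncomputable def reV : CSp d →L[ℝ] RSp d :=
  LinearMap.toContinuousLinearMap
    { toFun := fun x => WithLp.toLp 2 fun i => (x i).re
      map_add' := fun x y => by ext i; simp
      map_smul' := fun c x => by ext i; simp }

/-- The imaginary part of a complex vector. -/
noncomputable def imV : CSp d →L[ℝ] RSp d :=
  LinearMap.toContinuousLinearMap
    { toFun := fun x => WithLp.toLp 2 fun i => (x i).im
      map_add' := fun x y => by ext i; simp
      map_smul' := fun c x => by ext i; simp }

@[simp] lemma toC_apply (x : RSp d) (i : Fin d) : toC x i = (x i : ℂ) := rfl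
@[simp] lemma reV_apply (w : CSp d) (i : Fin d) : reV w i = (w i).re := rfl
@[simp] lemma imV_apply (w : CSp d) (i : Fin d) : imV w i = (w i).im := rfl
@[simp] lemma reV_toC (x : RSp d) : reV (toC x) = x := by ext i; simp
@[simp] lemma imV_toC (x : RSp d) : imV (toC x) = 0 := by ext i; simp

lemma norm_sq_eq_reV_add_imV (w : CSp d) : ‖w‖ ^ 2 = ‖reV w‖ ^ 2 + ‖imV w‖ ^ 2 := by
  rw [EuclideanSpace.norm_sq_eq, EuclideanSpace.norm_sq_eq, EuclideanSpace.norm_sq_eq,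
    ← Finset.sum_add_distrib]
  refine Finset.sum_congr rfl fun i _ => ?_
  rw [Complex.sq_norm, Complex.normSq_apply]
  simp [sq_abs]; ring

lemma norm_reV_le (w : CSp d) : ‖reV w‖ ≤ ‖w‖ := by
  refine le_of_sq_le_sq ?_ (norm_nonneg _)
  rw [norm_sq_eq_reV_add_imV]; nlinarith [sq_nonneg ‖imV w‖]

lemma norm_imV_le (w : CSp d) : ‖imV w‖ ≤ ‖w‖ := by
  refine le_of_sq_le_sq ?_ (norm_nonneg _)
  rw [norm_sq_eq_reV_add_imV]; nlinarith [sq_nonneg ‖reV w‖]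

lemma toC_single (i : Fin d) : toC (EuclideanSpace.single i (1 : ℝ)) = EuclideanSpace.single i 1 := by
  ext j
  by_cases h : j = i <;> simp [h]

lemma pderiv_comp_toC (i : Fin d) {F : CSp d → ℂ} (hF : ContDiff ℂ ∞ F) :
    pderiv ℝ i (fun x => F (toC x)) = fun x => pderiv ℂ i F (toC x) := by
  funext x
  have h1 : HasFDerivAt F (fderiv ℂ F (toC x)) (toC x) :=
    (hF.differentiable (by simp) _).hasFDerivAt
  have h2 := (h1.restrictScalars ℝ).comp x (toC (d := d)).hasFDerivAt
  have h3 : fderiv ℝ (fun x => F (toC x)) x = _ := h2.fderiv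
  unfold pderiv
  rw [h3, ← toC_single]
  rfl

/-- This is what makes Cauchy's estimates available for the real derivatives in `GSBound`. -/
lemma mderiv_comp_toC (β : MIdx d) {F : CSp d → ℂ} (hF : ContDiff ℂ ∞ F) :
    mderiv ℝ β (fun x => F (toC x)) = fun x => mderiv ℂ β F (toC x) := by
  unfold mderiv
  induction List.finRange d with
  | nil => rfl
  | cons i l ih =>
    rw [List.foldr_cons, List.foldr_cons, ih]
    have hG := contDiff_foldr_pderiv_complex l β hF
    revert hG
    generalize l.foldr (fun i f => (pderiv ℂ i)^[β i] f) F = G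
    intro hG
    induction β i with
    | zero => rfl
    | succ n ihn =>
      rw [Function.iterate_succ_apply', ihn, Function.iterate_succ_apply',
        pderiv_comp_toC i (contDiff_iterate_pderiv_complex i hG n)]

lemma contDiff_comp_toC {F : CSp d → ℂ} (hF : ContDiff ℂ ∞ F) :
    ContDiff ℝ ∞ fun x => F (toC x) :=
  (hF.restrict_scalars ℝ).comp (toC (d := d)).contDiff

end Entire

/-! ### Gelfand–Shilov bounds for entire functions with Gaussian decay -/

section GSEntire

variable {d : ℕ}

lemma prod_abs_pow_le {θ μ : ℝ} (hθ : 0 < θ) (hθ' : θ < 1) (hμ : 0 < μ) (α : MIdx d) (x : RSp d) :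
    |∏ i, x i ^ α i| ≤
      (α.fact : ℝ) ^ θ * (μ ^ (-θ)) ^ α.len * Real.exp (d * (μ * ‖x‖ ^ (1 / θ))) := by
  rw [Finset.abs_prod]
  calc ∏ i, |x i ^ α i|
      ≤ ∏ i, (((α i).factorial : ℝ) ^ θ * (μ ^ (-θ)) ^ α i * Real.exp (μ * ‖x‖ ^ (1 / θ))) := by
        refine Finset.prod_le_prod (fun _ _ => abs_nonneg _) fun i _ => ?_
        rw [abs_pow]
        refine (pow_le_pow_left₀ (abs_nonneg _) (PiLp.norm_apply_le x i) _).trans ?_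
        exact pow_le_factorial_rpow_mul_exp hθ hθ' (norm_nonneg _) hμ _
    _ = _ := by
        rw [Finset.prod_mul_distrib, Finset.prod_mul_distrib, Finset.prod_pow_eq_pow_sum,
          Real.finsetProd_rpow _ _ fun _ _ => by positivity]
        simp [MIdx.fact, MIdx.len, Real.exp_nat_mul]

set_option maxHeartbeats 1000000 in
/-- Entire functions with Gaussian decay in the real directions restrict to elements
of `S_θ(ℝ^d)`. -/
lemma gsBound_of_entire {θ c b δ : ℝ} (hθ : 1 / 2 ≤ θ) (hθ' : θ < 1) (hc : 0 < c) (hb : 0 ≤ b)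
    (hδ : 0 < δ) : ∃ C > 0, ∃ K > 0, ∀ (F : CSp d → ℂ) (G a : ℝ) (x₀ : RSp d),
      0 ≤ a → 0 ≤ G → ContDiff ℂ ∞ F →
      (∀ w, ‖F w‖ ≤ G * Real.exp (-c * ‖reV w - x₀‖ ^ 2 + a * ‖imV w‖ + b * ‖imV w‖ ^ 2)) →
      GSBound θ C (K * (G * Real.exp (δ * (‖x₀‖ ^ (1 / θ) + a ^ (1 / θ))))) fun x => F (toC x) := by
  have hθ0 : 0 < θ := by linarith
  -- All constants are fixed before `F`, `G`, `a` and `x₀`, so the result applies uniformly to the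
  -- kernels for all $z$. The value of `lam` makes the mixed term $a|\operatorname{Im}w|$ cost at
  -- most $\delta a^{1/\theta}$ plus a multiple of $m$.
  set lam : ℝ := δ / (d + 1) with hlam
  have hl : 0 < lam := by positivity
  have hdl : d * lam ≤ δ := by
    rw [hlam, mul_div_assoc', div_le_iff₀ (by positivity)]; nlinarith
  -- The weight $x^\alpha$ costs $e^{d\mu|x|^{1/\theta}}$. With this `μ` it uses at most
  -- $\delta|x_0|^{1/\theta}$ and the Gaussian left over after the derivatives are estimated.
  set μ : ℝ := min δ (c / 2) / (4 * (d + 1)) with hμd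
  have hμ : 0 < μ := by have := lt_min hδ (half_pos hc); positivity
  have hμ1 : d * μ * 4 ≤ min δ (c / 2) := by
    have h0 := (lt_min hδ (half_pos hc)).le
    rw [hμd, mul_div_assoc', div_mul_eq_mul_div, div_le_iff₀ (by positivity)]
    nlinarith
  set E : ℝ := d * lam + (c + b) * (d * lam) ^ 2 with hE
  have hE0 : 0 ≤ E := by positivity
  set C : ℝ := max (μ ^ (-θ)) (lam⁻¹ * Real.exp E) with hCdef
  have hCpos : 0 < C := lt_max_of_lt_right (by positivity)
  refine ⟨C, hCpos, Real.exp (E + c / 2), Real.exp_pos _, ?_⟩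
  intro F G a x₀ ha hG hF hbd α β x
  set m : ℝ := (β.len : ℝ) + 1 with hm
  have hm1 : 1 ≤ m := by rw [hm]; linarith [(β.len).cast_nonneg (α := ℝ)]
  set r : ℝ := lam * m ^ (1 - θ) with hr
  have hr0 : 0 ≤ r := by positivity
  have hC1 : μ ^ (-θ) ≤ C := le_max_left _ _
  have hC2 : lam⁻¹ * Real.exp E ≤ C := le_max_right _ _
  clear_value E C μ lam
  set X : ℝ := ‖x - x₀‖ with hX
  set A : ℝ := a ^ (1 / θ) with hA
  have hA0 : 0 ≤ A := Real.rpow_nonneg ha _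
  -- the derivative
  have h1 : ‖mderiv ℝ β (fun x => F (toC x)) x‖ ≤ (β.fact : ℝ) ^ θ * (lam⁻¹) ^ β.len *
      (G * Real.exp (-(c / 2) * X ^ 2 + δ * A + E * m)) := by
    rw [mderiv_comp_toC β hF]
    refine norm_mderiv_le_of_radius hθ' hl β hF (toC x) fun w hw => (hbd _).trans ?_
    have hw' : ‖w‖ ≤ d * r := norm_le_of_coord_le hw
    have e1 : reV (toC x + w) - x₀ = (x - x₀) + reV w := by
      rw [map_add, reV_toC]; abel
    have e2 : imV (toC x + w) = imV w := by rw [map_add, imV_toC, zero_add]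
    rw [e1, e2]
    have hre := (norm_reV_le w).trans hw'
    have him := (norm_imV_le w).trans hw'
    have h2 : X ≤ ‖x - x₀ + reV w‖ + ‖reV w‖ := by
      have := norm_sub_le (x - x₀ + reV w) (reV w)
      rwa [add_sub_cancel_right] at this
    -- Displacing the centre of the polydisc costs half of the Gaussian decay in $x-x_0$.
    have h3 : X ^ 2 / 2 ≤ ‖x - x₀ + reV w‖ ^ 2 + ‖reV w‖ ^ 2 := by
      nlinarith [sq_nonneg (‖x - x₀ + reV w‖ - ‖reV w‖), norm_nonneg (x - x₀)]
    have h4 : ‖reV w‖ ^ 2 ≤ (d * r) ^ 2 := by gcongr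
    have h5 : ‖imV w‖ ^ 2 ≤ (d * r) ^ 2 := by gcongr
    have h6 : r ^ 2 ≤ lam ^ 2 * m := by
      rw [hr, mul_pow]; exact mul_le_mul_of_nonneg_left (rpow_one_sub_sq_le hθ hm1) (sq_nonneg _)
    have h7 : a * (d * r) ≤ d * lam * A + d * lam * m := by
      have := mul_rpow_one_sub_le hθ0 hθ' ha (by linarith : 0 ≤ m)
      calc a * (d * r) = d * lam * (a * m ^ (1 - θ)) := by rw [hr]; ring
        _ ≤ d * lam * (A + m) := by gcongr
        _ = _ := by ring
    have h8 : a * ‖imV w‖ ≤ a * (d * r) := by gcongr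
    have h9 : d * lam * A ≤ δ * A := by gcongr
    have h10 : (c + b) * (d * r) ^ 2 ≤ (c + b) * (d * lam) ^ 2 * m := by
      calc (c + b) * (d * r) ^ 2 = (c + b) * d ^ 2 * r ^ 2 := by ring
        _ ≤ (c + b) * d ^ 2 * (lam ^ 2 * m) := by gcongr
        _ = _ := by ring
    refine mul_le_mul_of_nonneg_left (Real.exp_le_exp.2 ?_) hG
    rw [hE]
    nlinarith [mul_le_mul_of_nonneg_left h3 hc.le, mul_le_mul_of_nonneg_left h4 hc.le,
      mul_le_mul_of_nonneg_left h5 hb]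
  have h2 := prod_abs_pow_le hθ0 hθ' hμ α x
  have h3 : ‖x‖ ^ (1 / θ) ≤ 4 * (‖x₀‖ ^ (1 / θ) + (1 + X ^ 2)) := by
    have : ‖x‖ ≤ ‖x₀‖ + X := by
      have := norm_add_le x₀ (x - x₀); rwa [add_sub_cancel] at this
    refine (Real.rpow_le_rpow (norm_nonneg _) this (by positivity)).trans ?_
    refine (add_rpow_inv_le hθ (norm_nonneg _) (norm_nonneg _)).trans ?_
    gcongr
    exact rpow_inv_le_one_add_sq hθ (norm_nonneg _)
  have h4 : d * (μ * ‖x‖ ^ (1 / θ)) ≤ δ * ‖x₀‖ ^ (1 / θ) + c / 2 + c / 2 * X ^ 2 := by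
    have hp : 0 ≤ ‖x₀‖ ^ (1 / θ) := by positivity
    calc d * (μ * ‖x‖ ^ (1 / θ)) ≤ d * (μ * (4 * (‖x₀‖ ^ (1 / θ) + (1 + X ^ 2)))) := by gcongr
      _ = d * μ * 4 * ‖x₀‖ ^ (1 / θ) + d * μ * 4 * (1 + X ^ 2) := by ring
      _ ≤ δ * ‖x₀‖ ^ (1 / θ) + c / 2 * (1 + X ^ 2) := by
          exact add_le_add
            (mul_le_mul_of_nonneg_right (hμ1.trans (min_le_left _ _)) hp)
            (mul_le_mul_of_nonneg_right (hμ1.trans (min_le_right _ _)) (by positivity))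
      _ = _ := by ring
  have h5 : (μ ^ (-θ)) ^ α.len ≤ C ^ α.len := by gcongr
  have h6 : (lam⁻¹ * Real.exp E) ^ β.len ≤ C ^ β.len := by gcongr
  refine (mul_le_mul h2 h1 (norm_nonneg _) (by positivity)).trans ?_
  clear_value r m X A
  have e3 : Real.exp (E * m) = Real.exp E * Real.exp E ^ β.len := by
    rw [hm, mul_add, mul_one, Real.exp_add, mul_comm E, Real.exp_nat_mul, mul_comm]
  calc _ = (α.fact : ℝ) ^ θ * (β.fact : ℝ) ^ θ * G * (μ ^ (-θ)) ^ α.len * (lam⁻¹) ^ β.len *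
        (Real.exp (d * (μ * ‖x‖ ^ (1 / θ))) *
          (Real.exp (-(c / 2) * X ^ 2 + δ * A) * Real.exp (E * m))) := by
        rw [← Real.exp_add (-(c / 2) * X ^ 2 + δ * A)]; ring
    _ ≤ (α.fact : ℝ) ^ θ * (β.fact : ℝ) ^ θ * G * (μ ^ (-θ)) ^ α.len * (lam⁻¹) ^ β.len *
        (Real.exp (δ * ‖x₀‖ ^ (1 / θ) + c / 2 + c / 2 * X ^ 2) *
          (Real.exp (-(c / 2) * X ^ 2 + δ * A) * Real.exp (E * m))) := by
        gcongr
    _ = (α.fact : ℝ) ^ θ * (β.fact : ℝ) ^ θ * G * (μ ^ (-θ)) ^ α.len *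
        (lam⁻¹ * Real.exp E) ^ β.len * (Real.exp (E + c / 2) *
          Real.exp (δ * (‖x₀‖ ^ (1 / θ) + A))) := by
        rw [e3, ← mul_assoc (Real.exp _) (Real.exp (-(c / 2) * X ^ 2 + δ * A)), ← Real.exp_add,
          Real.exp_add E, mul_pow]
        have : δ * ‖x₀‖ ^ (1 / θ) + c / 2 + c / 2 * X ^ 2 + (-(c / 2) * X ^ 2 + δ * A) =
          c / 2 + δ * (‖x₀‖ ^ (1 / θ) + A) := by ring
        rw [this, Real.exp_add (c / 2)]
        ring
    _ ≤ (α.fact : ℝ) ^ θ * (β.fact : ℝ) ^ θ * G * C ^ α.len *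
        C ^ β.len * (Real.exp (E + c / 2) *
          Real.exp (δ * (‖x₀‖ ^ (1 / θ) + A))) := by
        gcongr
    _ = _ := by rw [pow_add]; ring

end GSEntire

/-! ### Matrices as operators and the bilinear bracket -/

section Matrices

variable {d : ℕ}

/-- A complex matrix as an operator on `ℂ^d`. -/
noncomputable def cop (R : Matrix (Fin d) (Fin d) ℂ) : CSp d →L[ℂ] CSp d :=
  Matrix.toEuclideanCLM (n := Fin d) (𝕜 := ℂ) R

/-- A real matrix as an operator on `ℝ^d`. -/
noncomputable def rop (R : Matrix (Fin d) (Fin d) ℝ) : RSp d →L[ℝ] RSp d :=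
  Matrix.toEuclideanCLM (n := Fin d) (𝕜 := ℝ) R

/-- A real matrix as a complex matrix. -/
noncomputable def rmat (R : Matrix (Fin d) (Fin d) ℝ) : Matrix (Fin d) (Fin d) ℂ :=
  R.map Complex.ofReal

lemma ofLp_cop (R : Matrix (Fin d) (Fin d) ℂ) (z : CSp d) : (cop R z).ofLp = R *ᵥ z.ofLp := rfl

lemma ofLp_rop (R : Matrix (Fin d) (Fin d) ℝ) (z : RSp d) : (rop R z).ofLp = R *ᵥ z.ofLp := rfl

lemma rmat_mul (R R' : Matrix (Fin d) (Fin d) ℝ) : rmat (R * R') = rmat R * rmat R' :=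
  Matrix.map_mul (f := Complex.ofRealHom)

lemma rmat_transpose (R : Matrix (Fin d) (Fin d) ℝ) : rmat Rᵀ = (rmat R)ᵀ := rfl

lemma cop_mul (R R' : Matrix (Fin d) (Fin d) ℂ) (z : CSp d) : cop (R * R') z = cop R (cop R' z) := by
  simp [cop]

lemma rop_mul (R R' : Matrix (Fin d) (Fin d) ℝ) (z : RSp d) : rop (R * R') z = rop R (rop R' z) := by
  simp [rop]

lemma cop_one (z : CSp d) : cop 1 z = z := by simp [cop]

lemma rop_one (z : RSp d) : rop 1 z = z := by simp [rop]

lemma reV_cop_rmat (R : Matrix (Fin d) (Fin d) ℝ) (z : CSp d) :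
    reV (cop (rmat R) z) = rop R (reV z) := by
  ext i
  rw [reV_apply, ofLp_cop, ofLp_rop]
  simp [Matrix.mulVec, dotProduct, rmat]

lemma imV_cop_rmat (R : Matrix (Fin d) (Fin d) ℝ) (z : CSp d) :
    imV (cop (rmat R) z) = rop R (imV z) := by
  ext i
  rw [imV_apply, ofLp_cop, ofLp_rop]
  simp [Matrix.mulVec, dotProduct, rmat]

/-- The bilinear bracket on `ℂ^d`. -/
def cdot (u v : CSp d) : ℂ := u.ofLp ⬝ᵥ v.ofLp

lemma re_cdot (u v : CSp d) :
    (cdot u v).re = inner ℝ (reV u) (reV v) - inner ℝ (imV u) (imV v) := by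
  simp only [cdot, dotProduct, PiLp.inner_apply, Complex.re_sum, Complex.mul_re,
    Finset.sum_sub_distrib]
  simp [mul_comm]

lemma im_cdot (u v : CSp d) :
    (cdot u v).im = inner ℝ (reV u) (imV v) + inner ℝ (imV u) (reV v) := by
  simp only [cdot, dotProduct, PiLp.inner_apply, Complex.im_sum, Complex.mul_im,
    Finset.sum_add_distrib]
  simp [mul_comm]

lemma cdot_comm (u v : CSp d) : cdot u v = cdot v u := dotProduct_comm _ _

lemma cdot_add_left (u u' v : CSp d) : cdot (u + u') v = cdot u v + cdot u' v := by
  simp [cdot, add_dotProduct]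

lemma cdot_add_right (u v v' : CSp d) : cdot u (v + v') = cdot u v + cdot u v' := by
  simp [cdot, dotProduct_add]

lemma cdot_smul_left (c : ℂ) (u v : CSp d) : cdot (c • u) v = c * cdot u v := by
  simp [cdot, smul_dotProduct]

lemma cdot_smul_right (c : ℂ) (u v : CSp d) : cdot u (c • v) = c * cdot u v := by
  simp [cdot, dotProduct_smul]

lemma cdot_cop_left (R : Matrix (Fin d) (Fin d) ℂ) (u v : CSp d) :
    cdot (cop R u) v = cdot u (cop Rᵀ v) := by
  unfold cdot
  rw [ofLp_cop, ofLp_cop, Matrix.dotProduct_mulVec, Matrix.vecMul_transpose]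

lemma norm_cdot_le (u v : CSp d) : ‖cdot u v‖ ≤ ‖u‖ * ‖v‖ := by
  have h : cdot u v = inner ℂ (WithLp.toLp 2 fun i => starRingEnd ℂ (u i) : CSp d) v := by
    simp [cdot, dotProduct, PiLp.inner_apply, mul_comm]
  rw [h]
  refine (norm_inner_le_norm _ _).trans (le_of_eq ?_)
  congr 1
  simp [EuclideanSpace.norm_eq]

lemma contDiff_cdot {n : WithTop ℕ∞} {𝕜 : Type} [NontriviallyNormedField 𝕜] [NormedAlgebra 𝕜 ℂ]
    {E : Type} [NormedAddCommGroup E] [NormedSpace 𝕜 E]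
    {f g : E → CSp d} (hf : ContDiff 𝕜 n f) (hg : ContDiff 𝕜 n g) :
    ContDiff 𝕜 n fun x => cdot (f x) (g x) := by
  have h1 := contDiff_piLp 2 |>.1 hf
  have h2 := contDiff_piLp 2 |>.1 hg
  unfold cdot dotProduct
  exact ContDiff.sum fun i _ => (h1 i).mul (h2 i)

end Matrices

/-! ### Completing the square in the phase; the weight $\Phi$ -/

namespace FBIPhase

variable {d : ℕ} (φ : FBIPhase d)

/-- Positivity of $\operatorname{Im}C$ provides a factor $S$; in the variable $Sy$ all Gaussians
below have the standard quadratic part. -/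
lemma exists_root : ∃ S : Matrix (Fin d) (Fin d) ℝ, Sᵀ * S = φ.C.map Complex.im ∧ IsUnit S.det := by
  open scoped MatrixOrder in
  obtain ⟨S, hS⟩ := CStarAlgebra.nonneg_iff_eq_star_mul_self.mp φ.posC.posSemidef.nonneg
  have hS' : Sᵀ * S = φ.C.map Complex.im := by
    rw [hS, Matrix.star_eq_conjTranspose, Matrix.conjTranspose_eq_transpose_of_trivial]
  refine ⟨S, hS', ?_⟩
  have h := φ.posC.det_pos
  rw [← hS', Matrix.det_mul, Matrix.det_transpose] at h
  exact isUnit_iff_ne_zero.2 fun h0 => by simp [h0] at h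

/-- A real matrix `S` with `Sᵀ S = Im C`. -/
noncomputable def rt : Matrix (Fin d) (Fin d) ℝ := φ.exists_root.choose

lemma rt_transpose_mul : φ.rtᵀ * φ.rt = φ.C.map Complex.im := φ.exists_root.choose_spec.1

lemma isUnit_det_rt : IsUnit φ.rt.det := φ.exists_root.choose_spec.2

/-- The matrix `N = (Sᵀ)⁻¹ B`. -/
noncomputable def nu : Matrix (Fin d) (Fin d) ℂ := rmat (φ.rtᵀ)⁻¹ * φ.B

/-- The real part of `C`. -/
def reC : Matrix (Fin d) (Fin d) ℝ := φ.C.map Complex.re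

lemma C_eq : φ.C = rmat φ.reC + Complex.I • rmat (φ.rtᵀ * φ.rt) := by
  rw [rt_transpose_mul]
  ext i j
  simp [rmat, reC, mul_comm Complex.I, Complex.re_add_im]

lemma B_eq : φ.B = rmat φ.rtᵀ * φ.nu := by
  have h : IsUnit (φ.rtᵀ).det := by rw [Matrix.det_transpose]; exact φ.isUnit_det_rt
  rw [nu, ← mul_assoc, ← rmat_mul, Matrix.mul_nonsing_inv _ h]
  simp [rmat]

lemma reC_symm : φ.reCᵀ = φ.reC := by
  ext i j
  have := congrFun (congrFun φ.symmC j) i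
  simp [reC, ← this]

/-- The phase with complex second argument. -/
noncomputable def valC (z y : CSp d) : ℂ :=
  1 / 2 * cdot (cop φ.A z) z + cdot (cop φ.B z) y + 1 / 2 * cdot (cop φ.C y) y

lemma val_eq (z : CSp d) (y : RSp d) : φ.val z y = φ.valC z (toC y) := rfl

/-- Since $B=S^{\mathsf T}N$, both the mixed term and the term of $\operatorname{Im}C$ depend on $y$
only through $Sy$, so the square can be completed there. -/
lemma valC_eq (z y : CSp d) : φ.valC z y = 1 / 2 * cdot (cop φ.A z) z +
    cdot (cop φ.nu z) (cop (rmat φ.rt) y) + 1 / 2 * cdot (cop (rmat φ.reC) y) y +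
    Complex.I / 2 * cdot (cop (rmat φ.rt) y) (cop (rmat φ.rt) y) := by
  have h1 : cdot (cop φ.B z) y = cdot (cop φ.nu z) (cop (rmat φ.rt) y) := by
    conv_lhs => rw [B_eq, cop_mul, cdot_cop_left, rmat_transpose, Matrix.transpose_transpose]
  have h2 : cop φ.C y = cop (rmat φ.reC) y + Complex.I • cop (rmat (φ.rtᵀ * φ.rt)) y := by
    conv_lhs => rw [C_eq]
    simp [cop]
  have h3 : cdot (cop (rmat (φ.rtᵀ * φ.rt)) y) y =
      cdot (cop (rmat φ.rt) y) (cop (rmat φ.rt) y) := by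
    rw [rmat_mul, cop_mul, cdot_cop_left, rmat_transpose, Matrix.transpose_transpose]
  rw [valC, h1, h2, cdot_add_left, cdot_smul_left, h3]
  ring

/-- An explicit formula for the weight. -/
noncomputable def wt (z : CSp d) : ℝ :=
  -(1 / 2) * (cdot (cop φ.A z) z).im + 1 / 2 * ‖imV (cop φ.nu z)‖ ^ 2

/-- Completion of the square in $\operatorname{Re}y$. The last three terms vanish for real $y$,
which yields the maximum $\Phi$ and the maximizer; for complex $y$ they measure the growth in
$\operatorname{Im}y$. -/
lemma neg_im_valC (z y : CSp d) : -(φ.valC z y).im = φ.wt z -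
    1 / 2 * ‖rop φ.rt (reV y) + imV (cop φ.nu z)‖ ^ 2 -
    inner ℝ (reV (cop φ.nu z)) (rop φ.rt (imV y)) - inner ℝ (rop φ.reC (reV y)) (imV y) +
    1 / 2 * ‖rop φ.rt (imV y)‖ ^ 2 := by
  have h1 : ∀ w : ℂ, ((1 / 2 : ℂ) * w).im = 1 / 2 * w.im := fun w => by simp
  have h2 : ∀ w : ℂ, (Complex.I / 2 * w).im = 1 / 2 * w.re := fun w => by
    simp [Complex.mul_im]
  have h3 : inner ℝ (rop φ.reC (imV y)) (reV y) = inner ℝ (rop φ.reC (reV y)) (imV y) := by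
    have : ∀ u v : RSp d, inner ℝ u v = v.ofLp ⬝ᵥ u.ofLp := fun u v => by
      simp [PiLp.inner_apply, dotProduct]
    rw [this, this, ofLp_rop, ofLp_rop, Matrix.dotProduct_mulVec, ← Matrix.mulVec_transpose,
      reC_symm, dotProduct_comm]
  rw [valC_eq, wt, Complex.add_im, Complex.add_im, Complex.add_im, h1, h1, h2, im_cdot (cop φ.nu z),
    im_cdot _ y, re_cdot, norm_add_sq_real]
  simp only [reV_cop_rmat, imV_cop_rmat, h3, real_inner_self_eq_norm_sq]
  rw [real_inner_comm (imV (cop φ.nu z))]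
  ring

lemma neg_im_val (z : CSp d) (y : RSp d) : -(φ.val z y).im = φ.wt z -
    1 / 2 * ‖rop φ.rt y + imV (cop φ.nu z)‖ ^ 2 := by
  rw [val_eq, neg_im_valC]
  simp

/-- The maximizer of `y ↦ -Im φ(z, y)`. -/
noncomputable def crit (z : CSp d) : RSp d := -rop φ.rt⁻¹ (imV (cop φ.nu z))

lemma rop_rt_inv (y : RSp d) : rop φ.rt (rop φ.rt⁻¹ y) = y := by
  rw [← rop_mul, Matrix.mul_nonsing_inv _ φ.isUnit_det_rt, rop_one]

lemma rop_inv_rt (y : RSp d) : rop φ.rt⁻¹ (rop φ.rt y) = y := by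
  rw [← rop_mul, Matrix.nonsing_inv_mul _ φ.isUnit_det_rt, rop_one]

lemma rop_rt_add (z : CSp d) (y : RSp d) :
    rop φ.rt y + imV (cop φ.nu z) = rop φ.rt (y - φ.crit z) := by
  rw [map_sub, crit, map_neg, rop_rt_inv, sub_neg_eq_add]

lemma weight_eq (z : CSp d) : φ.weight z = φ.wt z := by
  unfold weight
  have hb : ∀ y : RSp d, -(φ.val z y).im ≤ φ.wt z := fun y => by
    rw [neg_im_val]; nlinarith [sq_nonneg ‖rop φ.rt y + imV (cop φ.nu z)‖]
  refine le_antisymm (ciSup_le hb) ?_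
  refine le_ciSup_of_le ⟨φ.wt z, by rintro _ ⟨y, rfl⟩; exact hb y⟩ (φ.crit z) ?_
  rw [neg_im_val, rop_rt_add]
  simp

/-- The kernel with complex second argument. -/
noncomputable def kernelC (z y : CSp d) : ℂ := Complex.exp (Complex.I * φ.valC z y)

lemma kernel_eq (z : CSp d) (y : RSp d) : φ.kernel z y = φ.kernelC z (toC y) := rfl

lemma norm_kernel (z : CSp d) (y : RSp d) : ‖φ.kernel z y‖ =
    Real.exp (φ.weight z - 1 / 2 * ‖rop φ.rt (y - φ.crit z)‖ ^ 2) := by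
  rw [kernel, Complex.norm_exp, weight_eq, ← rop_rt_add, ← neg_im_val]
  simp

lemma contDiff_valC {n : WithTop ℕ∞} {E : Type} [NormedAddCommGroup E] [NormedSpace ℂ E]
    {f g : E → CSp d} (hf : ContDiff ℂ n f) (hg : ContDiff ℂ n g) :
    ContDiff ℂ n fun x => φ.valC (f x) (g x) := by
  unfold valC
  have h1 : ∀ R, ContDiff ℂ n fun x => cop R (f x) := fun R => (cop R).contDiff.comp hf
  have h2 : ∀ R, ContDiff ℂ n fun x => cop R (g x) := fun R => (cop R).contDiff.comp hg
  exact ((contDiff_const.mul (contDiff_cdot (h1 _) hf)).add (contDiff_cdot (h1 _) hg)).add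
    (contDiff_const.mul (contDiff_cdot (h2 _) hg))

lemma contDiff_kernelC {n : WithTop ℕ∞} {E : Type} [NormedAddCommGroup E] [NormedSpace ℂ E]
    {f g : E → CSp d} (hf : ContDiff ℂ n f) (hg : ContDiff ℂ n g) :
    ContDiff ℂ n fun x => φ.kernelC (f x) (g x) :=
  (contDiff_const.mul (φ.contDiff_valC hf hg)).cexp

/-- This is the hypothesis of `gsBound_of_entire` with centre `crit z` and slope $R|z|$. Both are of
size $O(|z|)$, so the resulting loss is $e^{O(\delta)|z|^{1/\theta}}$. -/
lemma norm_kernelC_le : ∃ c > 0, ∃ b ≥ 0, ∃ R ≥ 0, ∀ z y : CSp d, ‖φ.crit z‖ ≤ R * ‖z‖ ∧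
    ‖φ.kernelC z y‖ ≤ Real.exp (φ.weight z) * Real.exp (-c * ‖reV y - φ.crit z‖ ^ 2 +
      R * ‖z‖ * ‖imV y‖ + b * ‖imV y‖ ^ 2) := by
  set s := ‖rop φ.rt‖
  -- The summand 1 keeps `κ` positive also for $d=0$.
  set κ := ‖rop φ.rt⁻¹‖ + 1 with hκ
  set n := ‖cop φ.nu‖
  set q := ‖rop φ.reC‖
  have hκ0 : 0 < κ := by positivity
  have hcrit : ∀ z, ‖φ.crit z‖ ≤ κ * n * ‖z‖ := by
    intro z
    rw [crit, norm_neg]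
    calc _ ≤ ‖rop φ.rt⁻¹‖ * ‖imV (cop φ.nu z)‖ := ContinuousLinearMap.le_opNorm _ _
      _ ≤ κ * (n * ‖z‖) := by
          gcongr
          · rw [hκ]; linarith
          · exact (norm_imV_le _).trans (ContinuousLinearMap.le_opNorm _ _)
      _ = _ := by ring
  refine ⟨1 / (4 * κ ^ 2), by positivity, 1 / 2 * s ^ 2 + q ^ 2 * κ ^ 2, by positivity,
    κ * n + (n * s + q * (κ * n)), by positivity, fun z y => ⟨?_, ?_⟩⟩
  · refine (hcrit z).trans ?_
    gcongr
    exact le_add_of_nonneg_right (by positivity)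
  · rw [kernelC, Complex.norm_exp, ← Real.exp_add]
    refine Real.exp_le_exp.2 ?_
    have e : (Complex.I * φ.valC z y).re = -(φ.valC z y).im := by simp
    rw [e, neg_im_valC, weight_eq, rop_rt_add]
    set X := ‖reV y - φ.crit z‖ with hX
    set Y := ‖imV y‖
    set P := ‖rop φ.rt (reV y - φ.crit z)‖ with hP
    have h1 : X ≤ κ * P := by
      have := ContinuousLinearMap.le_opNorm (rop φ.rt⁻¹) (rop φ.rt (reV y - φ.crit z))
      rw [rop_inv_rt] at this
      refine this.trans ?_
      gcongr
      rw [hκ]; linarith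
    have h2 : X ^ 2 ≤ κ ^ 2 * P ^ 2 := by
      rw [← mul_pow]; exact pow_le_pow_left₀ (norm_nonneg _) h1 2
    have h3 : -inner ℝ (reV (cop φ.nu z)) (rop φ.rt (imV y)) ≤ n * ‖z‖ * (s * Y) := by
      refine (neg_le_abs _).trans ((abs_real_inner_le_norm _ _).trans ?_)
      gcongr
      · exact (norm_reV_le _).trans (ContinuousLinearMap.le_opNorm _ _)
      · exact ContinuousLinearMap.le_opNorm _ _
    have h4 : -inner ℝ (rop φ.reC (reV y)) (imV y) ≤ q * (X + κ * n * ‖z‖) * Y := by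
      refine (neg_le_abs _).trans ((abs_real_inner_le_norm _ _).trans ?_)
      gcongr
      refine (ContinuousLinearMap.le_opNorm _ _).trans ?_
      gcongr
      have := norm_add_le (reV y - φ.crit z) (φ.crit z)
      rw [sub_add_cancel] at this
      linarith [hcrit z]
    have h5 : ‖rop φ.rt (imV y)‖ ^ 2 ≤ (s * Y) ^ 2 := by
      gcongr; exact ContinuousLinearMap.le_opNorm _ _
    -- The mixed term of $\operatorname{Re}C$ is absorbed by half of the Gaussian: $\frac12P^2\ge
    -- 2cX^2$ with $c=1/(4\kappa^2)$, and one $cX^2$ is spent here.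
    have h6 : q * X * Y ≤ 1 / (4 * κ ^ 2) * X ^ 2 + q ^ 2 * κ ^ 2 * Y ^ 2 := by
      have e2 : 1 / (4 * κ ^ 2) * X ^ 2 = (X / (2 * κ)) ^ 2 := by field_simp; ring
      have e3 : q * X * Y = 2 * (X / (2 * κ)) * (q * κ * Y) := by field_simp
      rw [e2, e3]
      nlinarith [sq_nonneg (X / (2 * κ) - q * κ * Y)]
    have h7 : 1 / (4 * κ ^ 2) * X ^ 2 ≤ 1 / 4 * P ^ 2 := by
      rw [one_div_mul_eq_div, div_le_iff₀ (by positivity)]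
      linarith
    have h8 : 0 ≤ κ * n * ‖z‖ * Y := by positivity
    nlinarith

lemma continuous_weight : Continuous φ.weight := by
  have : φ.weight = φ.wt := funext φ.weight_eq
  rw [this]
  unfold wt
  have h1 : Continuous fun z : CSp d => cdot (cop φ.A z) z :=
    (contDiff_cdot (𝕜 := ℂ) (n := 0) (cop φ.A).contDiff contDiff_id).continuous
  fun_prop

/-- $\Phi$ is a real quadratic form by `weight_eq`, so its increment consists of a mixed term and a
square. -/
lemma weight_add_le : ∃ Q ≥ 0, ∀ z w : CSp d,
    φ.weight (z + w) ≤ φ.weight z + Q * (‖z‖ * ‖w‖ + ‖w‖ ^ 2) := by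
  set a := ‖cop φ.A‖
  set n := ‖cop φ.nu‖
  refine ⟨a + n ^ 2, by positivity, fun z w => ?_⟩
  rw [weight_eq, weight_eq, wt, wt, map_add, map_add, map_add, norm_add_sq_real, cdot_add_left,
    cdot_add_right, cdot_add_right]
  simp only [Complex.add_im]
  have h : ∀ u v : CSp d, -(cdot (cop φ.A u) v).im ≤ a * ‖u‖ * ‖v‖ := fun u v => by
    refine (neg_le_abs _).trans ((Complex.abs_im_le_norm _).trans ((norm_cdot_le _ _).trans ?_))
    gcongr
    exact ContinuousLinearMap.le_opNorm _ _
  have hn : ∀ u : CSp d, ‖imV (cop φ.nu u)‖ ≤ n * ‖u‖ := fun u =>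
    (norm_imV_le _).trans (ContinuousLinearMap.le_opNorm _ _)
  have h1 := h z w
  have h2 := h w z
  have h3 := h w w
  have h4 : inner ℝ (imV (cop φ.nu z)) (imV (cop φ.nu w)) ≤ (n * ‖z‖) * (n * ‖w‖) :=
    (real_inner_le_norm _ _).trans (mul_le_mul (hn z) (hn w) (norm_nonneg _) (by positivity))
  have h5 : ‖imV (cop φ.nu w)‖ ^ 2 ≤ (n * ‖w‖) ^ 2 := by gcongr; exact hn w
  have h6 : 0 ≤ a * ‖z‖ * ‖w‖ := by positivity
  have h7 : 0 ≤ a * ‖w‖ * ‖w‖ := by positivity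
  have h8 : 0 ≤ (n * ‖w‖) ^ 2 := by positivity
  nlinarith

end FBIPhase

/-! ### Bounds for the kernel and growth of the FBI transform -/

namespace FBIPhase

variable {d : ℕ} (φ : FBIPhase d) {θ : ℝ}

lemma const_nonneg : 0 ≤ φ.const := by
  have := φ.posC.det_pos
  have := Real.pi_pos
  unfold const
  positivity

/-- The Gaussian kernels are in `S_θ`, with bounds of the growth of `e^Φ`. -/
lemma exists_gsBound_kernel (hθ : 1 / 2 ≤ θ) (hθ' : θ < 1) {δ : ℝ} (hδ : 0 < δ) :
    ∃ C > 0, ∃ K > 0, ∀ z, GSBound θ C (K * Real.exp (δ * ‖z‖ ^ (1 / θ) + φ.weight z))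
      (φ.kernel z) := by
  obtain ⟨c, hc, b, hb, R, hR, h⟩ := φ.norm_kernelC_le
  have hR1 : 0 < (R + 1) ^ (1 / θ) := by positivity
  -- Both $|\mathrm{crit}\,z|$ and $R|z|$ are at most $(R+1)|z|$; the 2 accounts for the two terms.
  set δ' := δ / (2 * (R + 1) ^ (1 / θ)) with hδ'
  have hδ'0 : 0 < δ' := by positivity
  obtain ⟨C, hC, K, hK, H⟩ := gsBound_of_entire (d := d) hθ hθ' hc hb hδ'0
  refine ⟨C, hC, K, hK, fun z => ?_⟩
  have h1 := H (φ.kernelC z) (Real.exp (φ.weight z)) (R * ‖z‖) (φ.crit z) (by positivity)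
    (Real.exp_pos _).le (φ.contDiff_kernelC contDiff_const contDiff_id) fun w => (h z w).2
  have hle : R * ‖z‖ ≤ (R + 1) * ‖z‖ := by gcongr; linarith
  have hq : 0 ≤ 1 / θ := by have : 0 < θ := by linarith
                            positivity
  have e : ((R + 1) * ‖z‖) ^ (1 / θ) = (R + 1) ^ (1 / θ) * ‖z‖ ^ (1 / θ) :=
    Real.mul_rpow (by positivity) (norm_nonneg _)
  have h2 : ‖φ.crit z‖ ^ (1 / θ) ≤ (R + 1) ^ (1 / θ) * ‖z‖ ^ (1 / θ) := by
    rw [← e]; exact Real.rpow_le_rpow (norm_nonneg _) ((h z 0).1.trans hle) hq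
  have h3 : (R * ‖z‖) ^ (1 / θ) ≤ (R + 1) ^ (1 / θ) * ‖z‖ ^ (1 / θ) := by
    rw [← e]; exact Real.rpow_le_rpow (by positivity) hle hq
  intro α β x
  refine (h1 α β x).trans ?_
  have h4 : Real.exp (φ.weight z) *
      Real.exp (δ' * (‖φ.crit z‖ ^ (1 / θ) + (R * ‖z‖) ^ (1 / θ))) ≤
      Real.exp (δ * ‖z‖ ^ (1 / θ) + φ.weight z) := by
    rw [← Real.exp_add, Real.exp_le_exp, add_comm]
    have : δ' * (‖φ.crit z‖ ^ (1 / θ) + (R * ‖z‖) ^ (1 / θ)) ≤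
        δ' * (2 * ((R + 1) ^ (1 / θ) * ‖z‖ ^ (1 / θ))) := by gcongr; linarith
    have e2 : δ' * (2 * ((R + 1) ^ (1 / θ) * ‖z‖ ^ (1 / θ))) = δ * ‖z‖ ^ (1 / θ) := by
      rw [hδ']; field_simp
    linarith
  have := Real.rpow_nonneg (MIdx.fact_pos α).le θ
  have := Real.rpow_nonneg (MIdx.fact_pos β).le θ
  gcongr

lemma contDiff_kernel (z : CSp d) : ContDiff ℝ ∞ (φ.kernel z) :=
  contDiff_comp_toC (φ.contDiff_kernelC contDiff_const contDiff_id)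

lemma kernel_mem (hθ : 1 / 2 ≤ θ) (hθ' : θ < 1) (z : CSp d) : φ.kernel z ∈ GS d θ := by
  obtain ⟨C, hC, K, _, H⟩ := φ.exists_gsBound_kernel hθ hθ' one_pos
  exact ⟨φ.contDiff_kernel z, C, hC, _, H z⟩

/-- The kernel as an element of `S_θ`. -/
noncomputable def ker (hθ : 1 / 2 ≤ θ) (hθ' : θ < 1) (z : CSp d) : GS d θ :=
  ⟨φ.kernel z, φ.kernel_mem hθ hθ' z⟩

lemma fbi_eq (hθ : 1 / 2 ≤ θ) (hθ' : θ < 1) (u : GSDual d θ) (z : CSp d) :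
    φ.fbi u z = φ.const * (u : GS d θ →ₗ[ℂ] ℂ) (φ.ker hθ hθ' z) :=
  dif_pos (φ.kernel_mem hθ hθ' z)

lemma fbi_add (hθ : 1 / 2 ≤ θ) (hθ' : θ < 1) (u v : GSDual d θ) :
    φ.fbi (u + v) = φ.fbi u + φ.fbi v := by
  funext z
  rw [Pi.add_apply, φ.fbi_eq hθ hθ', φ.fbi_eq hθ hθ', φ.fbi_eq hθ hθ', Submodule.coe_add,
    LinearMap.add_apply, mul_add]

lemma fbi_smul (hθ : 1 / 2 ≤ θ) (hθ' : θ < 1) (c : ℂ) (u : GSDual d θ) :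
    φ.fbi (c • u) = c • φ.fbi u := by
  funext z
  rw [Pi.smul_apply, φ.fbi_eq hθ hθ', φ.fbi_eq hθ hθ', Submodule.coe_smul,
    LinearMap.smul_apply, smul_eq_mul, smul_eq_mul, mul_left_comm]

/-- Growth of the FBI transform of ultradistributions, uniform on equicontinuous sets. -/
lemma exists_norm_fbi_le (hθ : 1 / 2 ≤ θ) (hθ' : θ < 1) {δ : ℝ} (hδ : 0 < δ) :
    ∃ C > 0, ∃ K > 0, ∀ (u : GSDual d θ) (G : ℝ),
      (∀ (f : GS d θ) (M : ℝ), GSBound θ C M (f : RSp d → ℂ) →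
        ‖(u : GS d θ →ₗ[ℂ] ℂ) f‖ ≤ G * M) →
      ∀ z, ‖φ.fbi u z‖ ≤ K * G * Real.exp (δ * ‖z‖ ^ (1 / θ) + φ.weight z) := by
  obtain ⟨C, hC, K, hK, H⟩ := φ.exists_gsBound_kernel hθ hθ' hδ
  refine ⟨C, hC, (φ.const + 1) * K, by have := φ.const_nonneg; positivity, fun u G hu z => ?_⟩
  have h1 := hu (φ.ker hθ hθ' z) _ (H z)
  rw [φ.fbi_eq hθ hθ', norm_mul, Complex.norm_real, Real.norm_eq_abs,
    abs_of_nonneg φ.const_nonneg]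
  have h2 := (norm_nonneg _).trans h1
  calc φ.const * _ ≤ (φ.const + 1) * (G * (K * Real.exp (δ * ‖z‖ ^ (1 / θ) + φ.weight z))) :=
        mul_le_mul (by linarith) h1 (norm_nonneg _) (by linarith [φ.const_nonneg])
    _ = _ := by ring

lemma exists_norm_fbi_le' (hθ : 1 / 2 ≤ θ) (hθ' : θ < 1) (u : GSDual d θ) {δ : ℝ} (hδ : 0 < δ) :
    ∃ G ≥ 0, ∀ z, ‖φ.fbi u z‖ ≤ G * Real.exp (δ * ‖z‖ ^ (1 / θ) + φ.weight z) := by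
  obtain ⟨C, hC, K, hK, H⟩ := φ.exists_norm_fbi_le hθ hθ' hδ
  obtain ⟨G, hG⟩ := u.2 C hC
  have h := H u G hG
  have h0 := (norm_nonneg _).trans (h 0)
  exact ⟨K * G, nonneg_of_mul_nonneg_left h0 (Real.exp_pos _), h⟩

/-! ### Holomorphy of the FBI transform -/

lemma cdot_A_comm (z w : CSp d) : cdot (cop φ.A w) z = cdot (cop φ.A z) w := by
  rw [cdot_cop_left, φ.symmA.eq, cdot_comm]

lemma cdot_C_comm (z w : CSp d) : cdot (cop φ.C w) z = cdot (cop φ.C z) w := by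
  rw [cdot_cop_left, φ.symmC.eq, cdot_comm]

lemma valC_add_left (z w y : CSp d) : φ.valC (z + w) y = φ.valC z y +
    (cdot (cop φ.A z) w + cdot (cop φ.B w) y + 1 / 2 * cdot (cop φ.A w) w) := by
  simp only [valC, map_add, cdot_add_left, cdot_add_right]
  rw [φ.cdot_A_comm z w]
  ring

lemma valC_add_right (z w y : CSp d) : φ.valC z (y + w) = φ.valC z y +
    (cdot (cop φ.B z) w + cdot (cop φ.C y) w + 1 / 2 * cdot (cop φ.C w) w) := by
  simp only [valC, map_add, cdot_add_left, cdot_add_right]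
  rw [φ.cdot_C_comm y w]
  ring

/-- The first order remainder of the kernel at `z`. -/
noncomputable def remC (z w y : CSp d) : ℂ :=
  φ.kernelC (z + w) y - φ.kernelC z y -
    Complex.I * (cdot (cop φ.A z) w + cdot (cop φ.B w) y) * φ.kernelC z y

/-- The kernel at $z+w$ is the kernel at $z$ times $e^{iD}$, where $D$ is affine in $y$ and of size
$|w|(1+|y|)$. Taylor's formula gives $|w|^2$ at the price of a factor $e^{P(1+|y|)}$, harmless
against a Gaussian. -/
lemma norm_remC_le (z : CSp d) : ∃ P ≥ 0, ∀ w y : CSp d, ‖w‖ ≤ 1 →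
    ‖φ.remC z w y‖ ≤ ‖φ.kernelC z y‖ * (P * ‖w‖ ^ 2 * Real.exp (P * (1 + ‖y‖))) := by
  set a := ‖cop φ.A‖
  set b := ‖cop φ.B‖
  set P₀ := a * ‖z‖ + a + b with hP₀
  refine ⟨2 * P₀ + 2 + a, by positivity, fun w y hw => ?_⟩
  set D := cdot (cop φ.A z) w + cdot (cop φ.B w) y + 1 / 2 * cdot (cop φ.A w) w with hD
  have e : φ.remC z w y = φ.kernelC z y * ((Complex.exp (Complex.I * D) - 1 - Complex.I * D) +
      Complex.I * (1 / 2 * cdot (cop φ.A w) w)) := by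
    rw [remC, kernelC, valC_add_left, mul_add, Complex.exp_add, ← hD, ← kernelC, hD]
    ring
  have h1 : ‖cdot (cop φ.A z) w‖ ≤ a * ‖z‖ * ‖w‖ :=
    (norm_cdot_le _ _).trans (by gcongr; exact ContinuousLinearMap.le_opNorm _ _)
  have h2 : ‖cdot (cop φ.B w) y‖ ≤ b * ‖w‖ * ‖y‖ :=
    (norm_cdot_le _ _).trans (by gcongr; exact ContinuousLinearMap.le_opNorm _ _)
  have h3 : ‖(1 / 2 : ℂ) * cdot (cop φ.A w) w‖ ≤ a * ‖w‖ * ‖w‖ := by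
    rw [norm_mul]
    have h : ‖cdot (cop φ.A w) w‖ ≤ a * ‖w‖ * ‖w‖ :=
      (norm_cdot_le _ _).trans (by gcongr; exact ContinuousLinearMap.le_opNorm _ _)
    have : ‖(1 / 2 : ℂ)‖ = 1 / 2 := by simp
    rw [this]
    linarith [norm_nonneg (cdot (cop φ.A w) w)]
  have h4 : ‖D‖ ≤ P₀ * ‖w‖ * (1 + ‖y‖) := by
    refine (norm_add_le _ _).trans ((add_le_add (norm_add_le _ _) le_rfl).trans ?_)
    have h5 : a * ‖w‖ * ‖w‖ ≤ a * ‖w‖ * 1 := by gcongr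
    have h6 : 0 ≤ a * ‖z‖ * ‖w‖ * ‖y‖ := by positivity
    have h7 : 0 ≤ a * ‖w‖ * ‖y‖ := by positivity
    have h8 : 0 ≤ b * ‖w‖ := by positivity
    rw [hP₀]
    nlinarith
  set s := P₀ * (1 + ‖y‖) with hs
  have hs0 : 0 ≤ s := by positivity
  have h5 : ‖Complex.I * D‖ ≤ ‖w‖ * s := by
    rw [norm_mul, Complex.norm_I, one_mul, hs]
    exact h4.trans (le_of_eq (by ring))
  have h6 : ‖Complex.exp (Complex.I * D) - 1 - Complex.I * D‖ ≤
      (‖w‖ * s) ^ 2 * Real.exp (‖w‖ * s) := by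
    have := Complex.norm_exp_sub_sum_le_norm_mul_exp (Complex.I * D) 2
    simp only [Finset.sum_range_succ, Finset.sum_range_zero] at this
    simp only [pow_zero, Nat.factorial_zero, Nat.cast_one, div_one, zero_add, pow_one,
      Nat.factorial_one] at this
    rw [← sub_sub] at this
    refine this.trans ?_
    gcongr
  have h7 : ‖w‖ * s ≤ s := mul_le_of_le_one_left hs0 hw
  have h8 : s ^ 2 ≤ 2 * Real.exp s := by
    have := Real.quadratic_le_exp_of_nonneg hs0
    nlinarith
  rw [e, norm_mul]
  refine mul_le_mul_of_nonneg_left ?_ (norm_nonneg _)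
  refine (norm_add_le _ _).trans ?_
  rw [norm_mul Complex.I, Complex.norm_I, one_mul]
  have h9 : Real.exp (2 * s) ≤ Real.exp ((2 * P₀ + 2 + a) * (1 + ‖y‖)) := by
    rw [Real.exp_le_exp, hs]
    have : 0 ≤ (2 + a) * (1 + ‖y‖) := by positivity
    linarith
  have h10 : 1 ≤ Real.exp (2 * s) := Real.one_le_exp (by positivity)
  calc _ ≤ (‖w‖ * s) ^ 2 * Real.exp (‖w‖ * s) + a * ‖w‖ * ‖w‖ := add_le_add h6 h3
    _ ≤ ‖w‖ ^ 2 * (2 * Real.exp s) * Real.exp s + a * ‖w‖ ^ 2 := by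
        rw [mul_pow, mul_assoc a, ← pow_two]
        gcongr
    _ = ‖w‖ ^ 2 * (2 * Real.exp (2 * s) + a) := by
        rw [two_mul s, Real.exp_add]; ring
    _ ≤ ‖w‖ ^ 2 * ((2 * P₀ + 2 + a) * Real.exp (2 * s)) := by
        gcongr
        have : 0 ≤ 2 * P₀ * Real.exp (2 * s) := by positivity
        have : a ≤ a * Real.exp (2 * s) := le_mul_of_one_le_right (by positivity) h10
        nlinarith
    _ ≤ ‖w‖ ^ 2 * ((2 * P₀ + 2 + a) * Real.exp ((2 * P₀ + 2 + a) * (1 + ‖y‖))) := by gcongr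
    _ = _ := by ring

lemma exists_gsBound_remC (hθ : 1 / 2 ≤ θ) (hθ' : θ < 1) (z : CSp d) : ∃ C > 0, ∃ K > 0,
    ∀ w : CSp d, ‖w‖ ≤ 1 → GSBound θ C (K * ‖w‖ ^ 2) fun y => φ.remC z w (toC y) := by
  obtain ⟨c, hc, b, hb, R, hR, h⟩ := φ.norm_kernelC_le
  obtain ⟨P, hP, hrem⟩ := φ.norm_remC_le z
  -- The factor $e^{P|y|}$ is absorbed through $P|y|\le P^2/c+\frac c4|y|^2$. This halves the
  -- Gaussian rate and adds $\frac c4$ to the coefficient of $|\operatorname{Im}y|^2$.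
  obtain ⟨C, hC, K, hK, H⟩ := gsBound_of_entire (d := d) (c := c / 2) (b := b + c / 4) (δ := 1)
    hθ hθ' (by positivity) (by positivity) one_pos
  set G := Real.exp (φ.weight z) * (P * Real.exp (P + P ^ 2 / c + c / 2 * ‖φ.crit z‖ ^ 2)) with hG
  set T := Real.exp (1 * (‖φ.crit z‖ ^ (1 / θ) + (R * ‖z‖) ^ (1 / θ))) with hT
  refine ⟨C, hC, K * (G * T) + 1, by positivity, fun w hw => ?_⟩
  have hent : ContDiff ℂ ∞ (φ.remC z w) := by
    unfold remC
    have h1 := φ.contDiff_kernelC (n := ∞) (E := CSp d) (f := fun _ => z + w) contDiff_const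
      contDiff_id
    have h2 := φ.contDiff_kernelC (n := ∞) (E := CSp d) (f := fun _ => z) contDiff_const contDiff_id
    have h3 : ContDiff ℂ ∞ fun y : CSp d => cdot (cop φ.B w) y :=
      contDiff_cdot contDiff_const contDiff_id
    exact (h1.sub h2).sub ((contDiff_const.mul (contDiff_const.add h3)).mul h2)
  have h1 := H (φ.remC z w) (‖w‖ ^ 2 * G) (R * ‖z‖) (φ.crit z) (by positivity) (by positivity) hent ?_
  · intro α β x
    refine (h1 α β x).trans ?_
    have := Real.rpow_nonneg (MIdx.fact_pos α).le θ
    have := Real.rpow_nonneg (MIdx.fact_pos β).le θ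
    refine mul_le_mul_of_nonneg_right ?_ (by positivity)
    rw [← hT]
    nlinarith [sq_nonneg ‖w‖]
  · intro y
    refine (hrem w y hw).trans ?_
    have h2 := (h z y).2
    set X := ‖reV y - φ.crit z‖ with hX
    have h3 : P * ‖y‖ ≤ P ^ 2 / c + c / 4 * ‖y‖ ^ 2 := by
      have : P ^ 2 / c + c / 4 * ‖y‖ ^ 2 - P * ‖y‖ = (P - c / 2 * ‖y‖) ^ 2 / c := by
        field_simp; ring
      have h0 : 0 ≤ (P - c / 2 * ‖y‖) ^ 2 / c := by positivity
      linarith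
    have h4 : ‖y‖ ^ 2 ≤ 2 * X ^ 2 + 2 * ‖φ.crit z‖ ^ 2 + ‖imV y‖ ^ 2 := by
      rw [norm_sq_eq_reV_add_imV]
      have := norm_add_le (reV y - φ.crit z) (φ.crit z)
      rw [sub_add_cancel] at this
      nlinarith [sq_nonneg (X - ‖φ.crit z‖), norm_nonneg (reV y)]
    calc _ ≤ Real.exp (φ.weight z) * Real.exp (-c * X ^ 2 + R * ‖z‖ * ‖imV y‖ + b * ‖imV y‖ ^ 2) *
          (P * ‖w‖ ^ 2 * Real.exp (P + P ^ 2 / c + c / 4 * (2 * X ^ 2 + 2 * ‖φ.crit z‖ ^ 2 +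
            ‖imV y‖ ^ 2))) := by
          have h5 : P * (1 + ‖y‖) ≤ P + P ^ 2 / c + c / 4 * (2 * X ^ 2 + 2 * ‖φ.crit z‖ ^ 2 +
            ‖imV y‖ ^ 2) := by
            have := mul_le_mul_of_nonneg_left h4 (by positivity : 0 ≤ c / 4)
            linarith
          gcongr
      _ = ‖w‖ ^ 2 * (Real.exp (φ.weight z) * P) *
          (Real.exp (-c * X ^ 2 + R * ‖z‖ * ‖imV y‖ + b * ‖imV y‖ ^ 2) *
            Real.exp (P + P ^ 2 / c + c / 4 * (2 * X ^ 2 + 2 * ‖φ.crit z‖ ^ 2 +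
            ‖imV y‖ ^ 2))) := by ring
      _ = ‖w‖ ^ 2 * (Real.exp (φ.weight z) * P) *
          (Real.exp (P + P ^ 2 / c + c / 2 * ‖φ.crit z‖ ^ 2) *
            Real.exp (-(c / 2) * X ^ 2 + R * ‖z‖ * ‖imV y‖ + (b + c / 4) * ‖imV y‖ ^ 2)) := by
          rw [← Real.exp_add, ← Real.exp_add]
          ring_nf
      _ = _ := by rw [hG]; ring

/-- The derivative of the FBI transform. -/
noncomputable def fbiDeriv (u : GSDual d θ) (z : CSp d) : CSp d →L[ℂ] ℂ :=
  ∑ k, ((Complex.I * (cop φ.A z k * φ.fbi u z)) • (EuclideanSpace.proj k : CSp d →L[ℂ] ℂ) +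
    (Complex.I * φ.fbi (GSDual.mulX k u) z) •
      (EuclideanSpace.proj k : CSp d →L[ℂ] ℂ).comp (cop φ.B))

/-- An ultradistribution is bounded on the seminorm of any fixed scale $C$, and in one such seminorm
the first-order remainder of the kernel is $O(|w|^2)$ by `exists_gsBound_remC`. So the derivative
may be taken inside the duality bracket. -/
lemma hasFDerivAt_fbi (hθ : 1 / 2 ≤ θ) (hθ' : θ < 1) (u : GSDual d θ) (z : CSp d) :
    HasFDerivAt (φ.fbi u) (φ.fbiDeriv u z) z := by
  obtain ⟨C, hC, K, hK, H⟩ := φ.exists_gsBound_remC hθ hθ' z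
  obtain ⟨G, hG⟩ := u.2 C hC
  rw [hasFDerivAt_iff_isLittleO_nhds_zero]
  have hO : (fun w : CSp d => φ.fbi u (z + w) - φ.fbi u z - φ.fbiDeriv u z w) =O[𝓝 0]
      fun w => ‖w‖ ^ 2 := by
    refine Asymptotics.IsBigO.of_bound (φ.const * (G * K)) ?_
    filter_upwards [Metric.ball_mem_nhds (0 : CSp d) one_pos] with w hw
    have hw1 : ‖w‖ ≤ 1 := (mem_ball_zero_iff.1 hw).le
    set r : GS d θ := φ.ker hθ hθ' (z + w) - φ.ker hθ hθ' z -
      ((Complex.I * cdot (cop φ.A z) w) • φ.ker hθ hθ' z +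
        ∑ k, (Complex.I * cop φ.B w k) • GS.mulX k (φ.ker hθ hθ' z)) with hr
    have hrv : (r : RSp d → ℂ) = fun y => φ.remC z w (toC y) := by
      funext y
      have h1 : (r : RSp d → ℂ) y = φ.kernel (z + w) y - φ.kernel z y -
          (Complex.I * cdot (cop φ.A z) w * φ.kernel z y +
            ∑ k, Complex.I * cop φ.B w k * ((y k : ℂ) * φ.kernel z y)) := by
        rw [hr]
        simp only [Submodule.coe_sub, Submodule.coe_add, Submodule.coe_smul, Submodule.coe_sum,
          Pi.sub_apply, Pi.add_apply, Finset.sum_apply, Pi.smul_apply, smul_eq_mul]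
        rfl
      have h2 : ∑ k, Complex.I * cop φ.B w k * ((y k : ℂ) * φ.kernel z y) =
          Complex.I * cdot (cop φ.B w) (toC y) * φ.kernel z y := by
        rw [cdot, dotProduct, Finset.mul_sum, Finset.sum_mul]
        refine Finset.sum_congr rfl fun k _ => ?_
        rw [toC_apply]; ring
      rw [h1, h2, remC, kernel_eq, kernel_eq]
      ring
    have hu : φ.fbi u (z + w) - φ.fbi u z - φ.fbiDeriv u z w =
        φ.const * (u : GS d θ →ₗ[ℂ] ℂ) r := by
      have h3 : ∀ k, φ.fbi (GSDual.mulX k u) z =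
          φ.const * (u : GS d θ →ₗ[ℂ] ℂ) (GS.mulX k (φ.ker hθ hθ' z)) := fun k =>
        φ.fbi_eq hθ hθ' _ z
      rw [hr, map_sub, map_sub, map_add, map_sum, fbiDeriv]
      simp only [_root_.sum_apply, _root_.add_apply,
        _root_.smul_apply, ContinuousLinearMap.comp_apply, map_smul, h3,
        φ.fbi_eq hθ hθ' u, smul_eq_mul, PiLp.proj_apply, Finset.sum_add_distrib]
      have h4 : ∑ k, Complex.I * (cop φ.A z k * (φ.const * (u : GS d θ →ₗ[ℂ] ℂ) (φ.ker hθ hθ' z))) *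
          w k = φ.const * (Complex.I * cdot (cop φ.A z) w *
            (u : GS d θ →ₗ[ℂ] ℂ) (φ.ker hθ hθ' z)) := by
        rw [cdot, dotProduct, Finset.mul_sum, Finset.sum_mul, Finset.mul_sum]
        exact Finset.sum_congr rfl fun k _ => by ring
      have h5 : ∑ k, Complex.I * (φ.const *
          (u : GS d θ →ₗ[ℂ] ℂ) (GS.mulX k (φ.ker hθ hθ' z))) * cop φ.B w k =
          φ.const * ∑ k, Complex.I * cop φ.B w k *
            (u : GS d θ →ₗ[ℂ] ℂ) (GS.mulX k (φ.ker hθ hθ' z)) := by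
        rw [Finset.mul_sum]
        exact Finset.sum_congr rfl fun k _ => by ring
      rw [h4, h5]
      ring
    rw [hu, norm_mul, Complex.norm_real, Real.norm_eq_abs, abs_of_nonneg φ.const_nonneg,
      Real.norm_eq_abs, abs_of_nonneg (sq_nonneg _), mul_assoc]
    refine mul_le_mul_of_nonneg_left ?_ φ.const_nonneg
    rw [mul_assoc]
    refine hG r _ ?_
    rw [hrv]
    exact H w hw1
  exact hO.trans_isLittleO (Asymptotics.isLittleO_norm_pow_id one_lt_two)

/-- The derivative is built from transforms of `u` and of the ultradistributions $x_ku$, hence the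
induction over all `u` simultaneously. -/
lemma contDiff_fbi (hθ : 1 / 2 ≤ θ) (hθ' : θ < 1) (u : GSDual d θ) : ContDiff ℂ ∞ (φ.fbi u) := by
  rw [contDiff_infty]
  intro n
  induction n generalizing u with
  | zero =>
    exact contDiff_zero.2 (continuous_iff_continuousAt.2 fun z =>
      (φ.hasFDerivAt_fbi hθ hθ' u z).continuousAt)
  | succ n ih =>
    rw [Nat.cast_succ, contDiff_succ_iff_fderiv]
    refine ⟨fun z => (φ.hasFDerivAt_fbi hθ hθ' u z).differentiableAt, by simp, ?_⟩
    have e : fderiv ℂ (φ.fbi u) = φ.fbiDeriv u :=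
      funext fun z => (φ.hasFDerivAt_fbi hθ hθ' u z).fderiv
    rw [e]
    unfold fbiDeriv
    refine ContDiff.sum fun k _ => ContDiff.add ?_ ?_
    · refine ContDiff.smul (contDiff_const.mul (ContDiff.mul ?_ (ih u))) contDiff_const
      exact ((EuclideanSpace.proj k : CSp d →L[ℂ] ℂ).comp (cop φ.A)).contDiff
    · exact ContDiff.smul (contDiff_const.mul (ih _)) contDiff_const

lemma pderiv_fbi (hθ : 1 / 2 ≤ θ) (hθ' : θ < 1) (u : GSDual d θ) (l : Fin d) (z : CSp d) :
    pderiv ℂ l (φ.fbi u) z = Complex.I * (cop φ.A z l * φ.fbi u z) +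
      Complex.I * ∑ k, φ.B k l * φ.fbi (GSDual.mulX k u) z := by
  have h : ∀ k, cop φ.B (EuclideanSpace.single l (1 : ℂ)) k = φ.B k l := fun k => by
    rw [ofLp_cop]; simp
  rw [pderiv, (φ.hasFDerivAt_fbi hθ hθ' u z).fderiv, fbiDeriv]
  simp only [_root_.sum_apply, _root_.add_apply,
    _root_.smul_apply, ContinuousLinearMap.comp_apply, PiLp.proj_apply, h,
    smul_eq_mul, Finset.sum_add_distrib, Finset.mul_sum]
  congr 1
  · rw [Finset.sum_eq_single l] <;> simp +contextual
  · exact Finset.sum_congr rfl fun k _ => by ring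

/-- `pderiv_fbi` is a linear system for the transforms of $x_ku$, solved by the inverse of $B$. -/
lemma fbi_mulX (hθ : 1 / 2 ≤ θ) (hθ' : θ < 1) (u : GSDual d θ) (k : Fin d) (z : CSp d) :
    φ.fbi (GSDual.mulX k u) z =
      ∑ l, φ.B⁻¹ l k * (-Complex.I * pderiv ℂ l (φ.fbi u) z - cop φ.A z l * φ.fbi u z) := by
  have h1 : ∀ l, -Complex.I * pderiv ℂ l (φ.fbi u) z - cop φ.A z l * φ.fbi u z =
      ∑ m, φ.B m l * φ.fbi (GSDual.mulX m u) z := by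
    intro l
    rw [φ.pderiv_fbi hθ hθ']
    linear_combination (-(cop φ.A z l * φ.fbi u z +
      ∑ m, φ.B m l * φ.fbi (GSDual.mulX m u) z)) * Complex.I_mul_I
  simp only [h1, Finset.mul_sum]
  rw [Finset.sum_comm]
  have h2 : ∀ m, ∑ l, φ.B⁻¹ l k * (φ.B m l * φ.fbi (GSDual.mulX m u) z) =
      (φ.B * φ.B⁻¹) m k * φ.fbi (GSDual.mulX m u) z := by
    intro m
    rw [Matrix.mul_apply, Finset.sum_mul]
    exact Finset.sum_congr rfl fun l _ => by ring
  simp only [h2]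
  rw [Matrix.mul_nonsing_inv _ (isUnit_iff_ne_zero.2 φ.detB), Finset.sum_eq_single k] <;>
    simp +contextual

lemma pderiv_kernel (z : CSp d) (j : Fin d) (y : RSp d) : pderiv ℝ j (φ.kernel z) y =
    Complex.I * ((cop φ.B z) j + ∑ l, φ.C j l * (y l : ℂ)) * φ.kernel z y := by
  have hF : ContDiff ℂ ∞ (φ.kernelC z) := φ.contDiff_kernelC contDiff_const contDiff_id
  have h0 : pderiv ℝ j (φ.kernel z) y = pderiv ℂ j (φ.kernelC z) (toC y) :=
    congrFun (pderiv_comp_toC j hF) y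
  have h1 := hasDerivAt_line j hF (toC y) 0
  rw [zero_smul, add_zero] at h1
  set e : CSp d := EuclideanSpace.single j 1 with he
  have h2 : (fun t : ℂ => φ.kernelC z (toC y + t • e)) = fun t => Complex.exp (Complex.I *
      (φ.valC z (toC y) + (t * (cdot (cop φ.B z) e + cdot (cop φ.C (toC y)) e) +
        t ^ 2 * (1 / 2 * cdot (cop φ.C e) e)))) := by
    funext t
    rw [kernelC, valC_add_right]
    simp only [map_smul, cdot_smul_left, cdot_smul_right]
    ring_nf
  have h3 : HasDerivAt (fun t : ℂ => Complex.exp (Complex.I *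
      (φ.valC z (toC y) + (t * (cdot (cop φ.B z) e + cdot (cop φ.C (toC y)) e) +
        t ^ 2 * (1 / 2 * cdot (cop φ.C e) e)))))
      (φ.kernelC z (toC y) * (Complex.I * (cdot (cop φ.B z) e + cdot (cop φ.C (toC y)) e))) 0 := by
    have h4 : HasDerivAt (fun t : ℂ => Complex.I *
        (φ.valC z (toC y) + (t * (cdot (cop φ.B z) e + cdot (cop φ.C (toC y)) e) +
          t ^ 2 * (1 / 2 * cdot (cop φ.C e) e))))
        (Complex.I * (cdot (cop φ.B z) e + cdot (cop φ.C (toC y)) e)) 0 := by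
      have := (((hasDerivAt_id (0 : ℂ)).mul_const (cdot (cop φ.B z) e + cdot (cop φ.C (toC y)) e)).add
        (((hasDerivAt_id (0 : ℂ)).pow 2).mul_const (1 / 2 * cdot (cop φ.C e) e))).const_add
          (φ.valC z (toC y)) |>.const_mul Complex.I
      simpa using this
    have := h4.cexp
    simpa [kernelC] using this
  rw [h2] at h1
  rw [h0, h1.unique h3, kernel_eq]
  have h5 : ∀ w : CSp d, cdot w e = w j := fun w => by simp [cdot, he]
  rw [h5, h5, ofLp_cop φ.C]
  simp only [Matrix.mulVec, dotProduct, toC_apply]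
  ring

/-- The derivative is moved to the kernel, where it produces $i\varphi'_y=i(Bz+Cy)$; the factors
$y_l$ are returned to `u`. -/
lemma fbi_deriv (hθ : 1 / 2 ≤ θ) (hθ' : θ < 1) (u : GSDual d θ) (j : Fin d) (z : CSp d) :
    φ.fbi (GSDual.deriv j u) z = -Complex.I * (cop φ.B z j * φ.fbi u z +
      ∑ l, φ.C j l * φ.fbi (GSDual.mulX l u) z) := by
  have h1 : φ.fbi (GSDual.deriv j u) z =
      φ.const * (u : GS d θ →ₗ[ℂ] ℂ) (-GS.deriv j (φ.ker hθ hθ' z)) := φ.fbi_eq hθ hθ' _ z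
  have h3 : ∀ k, φ.fbi (GSDual.mulX k u) z =
      φ.const * (u : GS d θ →ₗ[ℂ] ℂ) (GS.mulX k (φ.ker hθ hθ' z)) := fun k =>
    φ.fbi_eq hθ hθ' _ z
  have h2 : GS.deriv j (φ.ker hθ hθ' z) = (Complex.I * cop φ.B z j) • φ.ker hθ hθ' z +
      ∑ l, (Complex.I * φ.C j l) • GS.mulX l (φ.ker hθ hθ' z) := by
    refine Subtype.ext (funext fun y => ?_)
    refine (φ.pderiv_kernel z j y).trans ?_
    simp only [Submodule.coe_add, Submodule.coe_smul, Submodule.coe_sum,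
      Pi.add_apply, Finset.sum_apply, Pi.smul_apply, smul_eq_mul]
    have e : ∀ l, ((GS.mulX l (φ.ker hθ hθ' z) : GS d θ) : RSp d → ℂ) y =
      (y l : ℂ) * φ.kernel z y := fun l => rfl
    have e' : ((φ.ker hθ hθ' z : GS d θ) : RSp d → ℂ) y = φ.kernel z y := rfl
    simp only [e, e']
    rw [mul_add, add_mul, Finset.mul_sum, Finset.sum_mul]
    congr 1
    exact Finset.sum_congr rfl fun l _ => by ring
  rw [h1, map_neg, h2, map_add, map_sum, φ.fbi_eq hθ hθ']
  simp only [map_smul, h3, smul_eq_mul]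
  rw [mul_add, Finset.mul_sum, mul_neg, mul_add, neg_add, Finset.mul_sum, ← Finset.sum_neg_distrib]
  congr 1
  · ring
  · exact Finset.sum_congr rfl fun l _ => by ring

end FBIPhase

/-! ### Iterating operators of order one on $\mathcal S_\theta$ -/

section ShiftBound

variable {d : ℕ} {θ : ℝ}

lemma MIdx.fact_mul_fact_le (α β : MIdx d) : α.fact * β.fact ≤ (α.len + β.len).factorial := by
  have h : ∀ γ : MIdx d, γ.fact ∣ γ.len.factorial := fun γ =>
    Nat.prod_factorial_dvd_factorial_sum Finset.univ γ
  exact Nat.le_of_dvd (Nat.factorial_pos _)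
    ((mul_dvd_mul (h α) (h β)).trans (Nat.factorial_mul_factorial_dvd_factorial_add _ _))

/-- A variant of `GSBound` adapted to compositions of `k` operators of order one. -/
def ShiftBound (θ C : ℝ) (k : ℕ) (X : ℝ) (f : RSp d → ℂ) : Prop :=
  ∀ (α β : MIdx d) (x : RSp d), |∏ i, x i ^ α i| * ‖mderiv ℝ β f x‖ ≤
    X * (C ^ (α.len + β.len + k) * ((α.len + β.len + k).factorial : ℝ) ^ θ)

lemma GSBound.shiftBound {C M : ℝ} {f : RSp d → ℂ} (hθ : 0 ≤ θ) (hC : 0 < C)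
    (h : GSBound θ C M f) : ShiftBound θ C 0 M f := by
  intro α β x
  refine (h α β x).trans ?_
  have := h.nonneg
  rw [mul_assoc (C ^ _), ← Real.mul_rpow (MIdx.fact_pos α).le (MIdx.fact_pos β).le, add_zero]
  gcongr
  exact_mod_cast MIdx.fact_mul_fact_le α β

lemma ShiftBound.nonneg {C X : ℝ} {k : ℕ} {f : RSp d → ℂ} (hC : 0 < C)
    (h : ShiftBound θ C k X f) : 0 ≤ X := by
  have h0 := h 0 0 0
  have h1 := (mul_nonneg (abs_nonneg _) (norm_nonneg _)).trans h0
  exact nonneg_of_mul_nonneg_left h1 (by positivity)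

lemma ShiftBound.norm_le {C X : ℝ} {k : ℕ} {f : RSp d → ℂ} (h : ShiftBound θ C k X f) (x : RSp d) :
    ‖f x‖ ≤ X * (C ^ k * (k.factorial : ℝ) ^ θ) := by
  have h0 := h 0 0 x
  simpa [MIdx.len, mderiv_zero_idx] using h0

lemma ShiftBound.add {C X Y : ℝ} {k : ℕ} {f g : RSp d → ℂ} (hf : ContDiff ℝ ∞ f)
    (hg : ContDiff ℝ ∞ g) (h : ShiftBound θ C k X f) (h' : ShiftBound θ C k Y g) :
    ShiftBound θ C k (X + Y) (f + g) := by
  intro α β x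
  rw [mderiv_add β hf hg, add_mul, Pi.add_apply]
  refine le_trans ?_ (add_le_add (h α β x) (h' α β x))
  rw [← mul_add]
  gcongr
  exact norm_add_le _ _

lemma ShiftBound.smul {C X : ℝ} {k : ℕ} {f : RSp d → ℂ} (hf : ContDiff ℝ ∞ f)
    (h : ShiftBound θ C k X f) (c : ℂ) : ShiftBound θ C k (‖c‖ * X) (c • f) := by
  intro α β x
  rw [mderiv_smul β c hf, Pi.smul_apply, norm_smul, mul_left_comm, mul_assoc]
  exact mul_le_mul_of_nonneg_left (h α β x) (norm_nonneg c)

lemma ShiftBound.sum {C : ℝ} {k : ℕ} {ι : Type*} (s : Finset ι) {X : ι → ℝ} {f : ι → RSp d → ℂ}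
    (hf : ∀ i, ContDiff ℝ ∞ (f i)) (h : ∀ i, ShiftBound θ C k (X i) (f i)) :
    ShiftBound θ C k (∑ i ∈ s, X i) (∑ i ∈ s, f i) ∧ ContDiff ℝ ∞ (∑ i ∈ s, f i) := by
  classical
  induction s using Finset.induction_on with
  | empty =>
    have h0 : ContDiff ℝ ∞ (0 : RSp d → ℂ) :=
      (contDiff_const : ContDiff ℝ ∞ fun _ : RSp d => (0 : ℂ))
    refine ⟨fun α β x => ?_, h0⟩
    have := mderiv_smul β 0 h0
    simp only [zero_smul] at this
    simp [this]
  | insert i s hi ih =>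
    rw [Finset.sum_insert hi, Finset.sum_insert hi]
    exact ⟨(h i).add (hf i) ih.2 ih.1, (hf i).add ih.2⟩

lemma ShiftBound.pderiv {C X : ℝ} {k : ℕ} {f : RSp d → ℂ} (hf : ContDiff ℝ ∞ f)
    (h : ShiftBound θ C k X f) (j : Fin d) : ShiftBound θ C (k + 1) X (pderiv ℝ j f) := by
  intro α β x
  rw [mderiv_pderiv β j hf]
  have e : α.len + MIdx.len (β + Pi.single j 1) + k = α.len + β.len + (k + 1) := by
    rw [MIdx.len_add_single]; ring
  have := h α (β + Pi.single j 1) x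
  rwa [e] at this

/-- The commutator of $\partial_j$ with $x_j$ lowers the total order by two and produces a factor at
most $n+2$. Since $\theta\ge\frac12$, this factor is at most $2((n+2)(n+1))^\theta$. -/
lemma natCast_mul_factorial_rpow_le (hθ : 1 / 2 ≤ θ) {m n : ℕ} (hmn : m ≤ n + 2) :
    (m : ℝ) * (n.factorial : ℝ) ^ θ ≤ 2 * ((n + 2).factorial : ℝ) ^ θ := by
  have hθ0 : 0 ≤ θ := by linarith
  have h1 : ((n + 2).factorial : ℝ) = ((n + 2 : ℝ) * (n + 1)) * n.factorial := by
    rw [Nat.factorial_succ, Nat.factorial_succ]; push_cast; ring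
  have h2 : (m : ℝ) ≤ n + 2 := by exact_mod_cast hmn
  have h3 : ((n : ℝ) + 2) ≤ 2 * ((n + 2 : ℝ) * (n + 1)) ^ θ := by
    have h4 : ((n : ℝ) + 2) / 2 ≤ (((n : ℝ) + 2) / 2) ^ (2 * θ) := by
      conv_lhs => rw [← Real.rpow_one (((n : ℝ) + 2) / 2)]
      refine Real.rpow_le_rpow_of_exponent_le ?_ (by linarith)
      have := n.cast_nonneg (α := ℝ)
      linarith
    rw [Real.rpow_mul (by positivity), Real.rpow_two] at h4
    have h5 : ((((n : ℝ) + 2) / 2) ^ 2) ^ θ ≤ ((n + 2 : ℝ) * (n + 1)) ^ θ := by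
      refine Real.rpow_le_rpow (by positivity) ?_ hθ0
      have := n.cast_nonneg (α := ℝ)
      nlinarith
    linarith
  rw [h1, Real.mul_rpow (by positivity) (by positivity), ← mul_assoc]
  gcongr
  exact h2.trans h3

/-- The scale `C` is unchanged and the bound grows by a fixed factor, so $n$ applications cost only
a power of a constant. Iterating `GSBound.mul_coord` would enlarge the scale at every step. The 3 is
1 for the main term and 2 for the commutator. -/
lemma ShiftBound.mul_coord {C X : ℝ} {k : ℕ} {f : RSp d → ℂ} (hθ : 1 / 2 ≤ θ)
    (hf : ContDiff ℝ ∞ f) (hC : 1 ≤ C) (h : ShiftBound θ C k X f) (j : Fin d) :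
    ShiftBound θ C (k + 1) (3 * X) (fun x : RSp d => (x j : ℂ) * f x) := by
  intro α β x
  have hX := h.nonneg (by linarith)
  have key1 : |∏ i, x i ^ α i| * ‖(x j : ℂ) * mderiv ℝ β f x‖ ≤
      X * (C ^ (α.len + β.len + (k + 1)) * ((α.len + β.len + (k + 1)).factorial : ℝ) ^ θ) := by
    have h0 := h (α + Pi.single j 1) β x
    have e : MIdx.len (α + Pi.single j 1) + β.len + k = α.len + β.len + (k + 1) := by
      rw [MIdx.len_add_single]; ring
    rw [MIdx.prod_pow_add_single, abs_mul, e] at h0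
    rw [norm_mul, Complex.norm_real, Real.norm_eq_abs, ← mul_assoc]
    exact h0
  have hb : 0 ≤ X * (C ^ (α.len + β.len + (k + 1)) *
      ((α.len + β.len + (k + 1)).factorial : ℝ) ^ θ) := by positivity
  rcases Nat.eq_zero_or_pos (β j) with hj | hj
  · rw [mderiv_mul_coord_zero β j hj hf]
    linarith
  · obtain ⟨γ, rfl⟩ : ∃ γ : MIdx d, β = γ + Pi.single j 1 := by
      refine ⟨β - Pi.single j 1, ?_⟩
      funext i
      by_cases hi : i = j
      · subst hi; simp; omega
      · simp [hi]
    have key2 : |∏ i, x i ^ α i| * ‖((γ j : ℂ) + 1) * mderiv ℝ γ f x‖ ≤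
        2 * (X * (C ^ (α.len + MIdx.len (γ + Pi.single j 1) + (k + 1)) *
          ((α.len + MIdx.len (γ + Pi.single j 1) + (k + 1)).factorial : ℝ) ^ θ)) := by
      have hn : ‖(γ j : ℂ) + 1‖ = ((γ j + 1 : ℕ) : ℝ) := by
        have : (γ j : ℂ) + 1 = ((γ j + 1 : ℕ) : ℂ) := by push_cast; rfl
        rw [this, Complex.norm_natCast]
      have e : α.len + MIdx.len (γ + Pi.single j 1) + (k + 1) = α.len + γ.len + k + 2 := by
        rw [MIdx.len_add_single]; ring
      rw [norm_mul, hn, mul_left_comm, e]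
      refine (mul_le_mul_of_nonneg_left (h α γ x) (Nat.cast_nonneg _)).trans ?_
      have h1 := natCast_mul_factorial_rpow_le hθ (m := γ j + 1) (n := α.len + γ.len + k) (by
        have := MIdx.le_len γ j; omega)
      have h2 : C ^ (α.len + γ.len + k) ≤ C ^ (α.len + γ.len + k + 2) :=
        pow_le_pow_right₀ hC (by omega)
      calc _ = X * (C ^ (α.len + γ.len + k) * (((γ j + 1 : ℕ) : ℝ) *
            ((α.len + γ.len + k).factorial : ℝ) ^ θ)) := by ring
        _ ≤ X * (C ^ (α.len + γ.len + k + 2) * (2 *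
            ((α.len + γ.len + k + 2).factorial : ℝ) ^ θ)) := by gcongr
        _ = _ := by ring
    rw [mderiv_mul_coord_succ γ j hf]
    refine (mul_le_mul_of_nonneg_left (norm_add_le _ _) (abs_nonneg _)).trans ?_
    rw [mul_add]
    linarith

end ShiftBound

/-! ### The embedding $\mathcal S_\theta\subset\mathcal S'_\theta$ as a morphism -/

section ToDual

variable {d : ℕ} {θ : ℝ}

lemma GSDual.mulX_toDual (j : Fin d) (f : GS d θ) :
    GSDual.mulX j (GS.toDual f) = GS.toDual (GS.mulX j f) := by
  refine Subtype.ext (LinearMap.ext fun g => ?_)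
  change ∫ x : RSp d, (f : RSp d → ℂ) x * ((x j : ℂ) * (g : RSp d → ℂ) x) =
    ∫ x : RSp d, ((x j : ℂ) * (f : RSp d → ℂ) x) * (g : RSp d → ℂ) x
  exact integral_congr_ae (Eventually.of_forall fun x => by ring)

lemma GSDual.deriv_toDual (j : Fin d) (f : GS d θ) :
    GSDual.deriv j (GS.toDual f) = GS.toDual (GS.deriv j f) := by
  refine Subtype.ext (LinearMap.ext fun g => ?_)
  have h1 : ((GSDual.deriv j (GS.toDual f) : GSDual d θ) : GS d θ →ₗ[ℂ] ℂ) g =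
      -∫ x : RSp d, (f : RSp d → ℂ) x * pderiv ℝ j (g : RSp d → ℂ) x :=
    map_neg ((GS.toDual f : GSDual d θ) : GS d θ →ₗ[ℂ] ℂ) (GS.deriv j g)
  rw [h1]
  change _ = ∫ x : RSp d, pderiv ℝ j (f : RSp d → ℂ) x * (g : RSp d → ℂ) x
  have h2 := integral_mul_fderiv_eq_neg_fderiv_mul_of_integrable (𝕜 := ℂ) (μ := volume)
    (v := (EuclideanSpace.single j 1 : RSp d)) (f := (f : RSp d → ℂ)) (g := (g : RSp d → ℂ))
    (GS.integrable_mul (GS.deriv j f) g) (GS.integrable_mul f (GS.deriv j g))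
    (GS.integrable_mul f g) (fun x _ => f.2.1.differentiable (by simp) x)
    (fun x _ => g.2.1.differentiable (by simp) x)
  have h3 : ∫ x : RSp d, (f : RSp d → ℂ) x * pderiv ℝ j (g : RSp d → ℂ) x =
    -∫ x : RSp d, pderiv ℝ j (f : RSp d → ℂ) x * (g : RSp d → ℂ) x := h2
  rw [h3, neg_neg]

lemma GS.toDual_add (f g : GS d θ) : GS.toDual (f + g) = GS.toDual f + GS.toDual g := by
  refine Subtype.ext (LinearMap.ext fun k => ?_)
  have h1 := ((GS.toDual k : GSDual d θ) : GS d θ →ₗ[ℂ] ℂ).map_add f g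
  -- The pairing is symmetric, so additivity in the first argument is borrowed from the second.
  have h2 : ∀ f : GS d θ, ((GS.toDual k : GSDual d θ) : GS d θ →ₗ[ℂ] ℂ) f =
      ((GS.toDual f : GSDual d θ) : GS d θ →ₗ[ℂ] ℂ) k := fun f =>
    integral_congr_ae (Eventually.of_forall fun x => mul_comm _ _)
  rw [h2, h2, h2] at h1
  exact h1

lemma GS.toDual_smul (c : ℂ) (f : GS d θ) : GS.toDual (c • f) = c • GS.toDual f := by
  refine Subtype.ext (LinearMap.ext fun k => ?_)
  have h1 := ((GS.toDual k : GSDual d θ) : GS d θ →ₗ[ℂ] ℂ).map_smul c f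
  have h2 : ∀ f : GS d θ, ((GS.toDual k : GSDual d θ) : GS d θ →ₗ[ℂ] ℂ) f =
      ((GS.toDual f : GSDual d θ) : GS d θ →ₗ[ℂ] ℂ) k := fun f =>
    integral_congr_ae (Eventually.of_forall fun x => mul_comm _ _)
  rw [h2, h2] at h1
  exact h1

/-- The embedding `S_θ ⊂ S'_θ` as a linear map. -/
noncomputable def GS.toDualL : GS d θ →ₗ[ℂ] GSDual d θ where
  toFun := GS.toDual
  map_add' := GS.toDual_add
  map_smul' := GS.toDual_smul

end ToDual

/-! ### Decay of the FBI transform on $\mathcal S_\theta$ -/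

namespace FBIPhase

variable {d : ℕ} (φ : FBIPhase d) {θ : ℝ}

lemma fbi_toDual (hθ : 1 / 2 ≤ θ) (hθ' : θ < 1) (f : GS d θ) (z : CSp d) :
    φ.fbi (GS.toDual f) z = φ.fbiFun f z := φ.fbi_eq hθ hθ' _ z

/-- The operator which the FBI transform turns into multiplication by `(Bz)_j`. -/
noncomputable def lift (j : Fin d) : GS d θ →ₗ[ℂ] GS d θ :=
  Complex.I • GS.deriv j + ∑ l, (-φ.C j l) • GS.mulX l

/-- By `fbi_deriv`, $i\partial_j$ becomes $(Bz)_j$ plus the terms with $C_{jl}x_l$, and the sum in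
`lift` cancels these terms. -/
lemma fbi_toDual_lift (hθ : 1 / 2 ≤ θ) (hθ' : θ < 1) (j : Fin d) (f : GS d θ) (z : CSp d) :
    φ.fbi (GS.toDual (φ.lift j f)) z = cop φ.B z j * φ.fbi (GS.toDual f) z := by
  have e : GS.toDual (φ.lift j f) = Complex.I • GSDual.deriv j (GS.toDual f) +
      ∑ l, (-φ.C j l) • GSDual.mulX l (GS.toDual f) := by
    change GS.toDualL (φ.lift j f) = _
    simp only [lift, LinearMap.add_apply, LinearMap.sum_apply, LinearMap.smul_apply, map_add,
      map_sum, map_smul, GSDual.mulX_toDual, GSDual.deriv_toDual]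
    rfl
  have hs : ∀ (s : Finset (Fin d)) (w : Fin d → GSDual d θ),
      φ.fbi (∑ l ∈ s, w l) = ∑ l ∈ s, φ.fbi (w l) := by
    intro s w
    exact map_sum (AddMonoidHom.mk' (fun u : GSDual d θ => φ.fbi u) (φ.fbi_add hθ hθ')) w s
  rw [e, φ.fbi_add hθ hθ', hs, φ.fbi_smul hθ hθ', Pi.add_apply, Finset.sum_apply, Pi.smul_apply,
    φ.fbi_deriv hθ hθ']
  simp only [φ.fbi_smul hθ hθ', Pi.smul_apply, smul_eq_mul, neg_mul, Finset.sum_neg_distrib]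
  linear_combination (-(cop φ.B z j * φ.fbi (GS.toDual f) z +
    ∑ l, φ.C j l * φ.fbi (GSDual.mulX l (GS.toDual f)) z)) * Complex.I_mul_I

lemma shiftBound_lift (hθ : 1 / 2 ≤ θ) {C X : ℝ} {k : ℕ} (hC : 1 ≤ C) (j : Fin d) (f : GS d θ)
    (h : ShiftBound θ C k X (f : RSp d → ℂ)) :
    ShiftBound θ C (k + 1) ((1 + 3 * ∑ l, ‖φ.C j l‖) * X) (φ.lift j f : RSp d → ℂ) := by
  have hsm : ∀ l, ContDiff ℝ ∞ ((-φ.C j l) • ((GS.mulX l f : GS d θ) : RSp d → ℂ)) := fun l =>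
    (GS.mulX l f).2.1.const_smul (-φ.C j l)
  have h1 := (h.pderiv f.2.1 j).smul (GS.deriv j f).2.1 Complex.I
  have h2 := ShiftBound.sum Finset.univ hsm fun l =>
    (h.mul_coord hθ f.2.1 hC l).smul (GS.mulX l f).2.1 (-φ.C j l)
  have h3 := h1.add ((GS.deriv j f).2.1.const_smul Complex.I) h2.2 h2.1
  have e : (φ.lift j f : RSp d → ℂ) = Complex.I • pderiv ℝ j (f : RSp d → ℂ) +
      ∑ l, (-φ.C j l) • ((GS.mulX l f : GS d θ) : RSp d → ℂ) := by
    simp only [lift, LinearMap.add_apply, LinearMap.sum_apply, LinearMap.smul_apply,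
      Submodule.coe_add, Submodule.coe_sum, Submodule.coe_smul]
    rfl
  have e2 : (1 + 3 * ∑ l, ‖φ.C j l‖) * X = ‖Complex.I‖ * X + ∑ i, ‖-φ.C j i‖ * (3 * X) := ?_
  · rw [e, e2]
    exact h3
  rw [Complex.norm_I, add_mul, one_mul, Finset.mul_sum, Finset.sum_mul]
  congr 1
  exact Finset.sum_congr rfl fun l _ => by rw [norm_neg]; ring

/-- The modulus of the kernel is $e^{\Phi(z)}$ times a translate of a fixed Gaussian, whose integral
does not depend on $z$. -/
lemma exists_norm_fbi_toDual_le_sup (hθ : 1 / 2 ≤ θ) (hθ' : θ < 1) : ∃ K > 0,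
    ∀ (f : GS d θ) (M : ℝ), (∀ x, ‖(f : RSp d → ℂ) x‖ ≤ M) →
      ∀ z, ‖φ.fbi (GS.toDual f) z‖ ≤ K * M * Real.exp (φ.weight z) := by
  set J : ℝ := ∫ y : RSp d, Real.exp (-(1 / 2 * ‖rop φ.rt y‖ ^ 2)) with hJ
  have hJ0 : 0 ≤ J := integral_nonneg fun _ => (Real.exp_pos _).le
  refine ⟨φ.const * J + 1, by have := φ.const_nonneg; positivity, fun f M hM z => ?_⟩
  have hM0 : 0 ≤ M := (norm_nonneg _).trans (hM 0)
  have hk : ∫ y : RSp d, ‖φ.kernel z y‖ = Real.exp (φ.weight z) * J := by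
    rw [hJ, ← integral_const_mul, ← integral_sub_right_eq_self
      (fun y => Real.exp (φ.weight z) * Real.exp (-(1 / 2 * ‖rop φ.rt y‖ ^ 2))) (φ.crit z)]
    refine integral_congr_ae (Eventually.of_forall fun y => ?_)
    simp only
    rw [norm_kernel, sub_eq_add_neg, Real.exp_add]
  rw [φ.fbi_toDual hθ hθ', fbiFun, norm_mul, Complex.norm_real, Real.norm_eq_abs,
    abs_of_nonneg φ.const_nonneg]
  have h1 : ‖∫ y : RSp d, (f : RSp d → ℂ) y * φ.kernel z y‖ ≤ M * (Real.exp (φ.weight z) * J) := by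
    rw [← hk, ← integral_const_mul]
    refine norm_integral_le_of_norm_le
      ((GS.integrable (φ.ker hθ hθ' z)).norm.const_mul M) (Eventually.of_forall fun y => ?_)
    rw [norm_mul]
    exact mul_le_mul_of_nonneg_right (hM y) (norm_nonneg _)
  calc _ ≤ φ.const * (M * (Real.exp (φ.weight z) * J)) :=
        mul_le_mul_of_nonneg_left h1 φ.const_nonneg
    _ = φ.const * J * (M * Real.exp (φ.weight z)) := by ring
    _ ≤ (φ.const * J + 1) * (M * Real.exp (φ.weight z)) := by gcongr; linarith
    _ = _ := by ring

lemma exists_norm_le_coord_B : ∃ κ > 0, ∀ z : CSp d, z = 0 ∨ ∃ j, ‖z‖ ≤ κ * ‖cop φ.B z j‖ := by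
  refine ⟨‖cop φ.B⁻¹‖ * d + 1, by positivity, fun z => ?_⟩
  rcases Nat.eq_zero_or_pos d with hd | hd
  · subst hd
    exact Or.inl (Subsingleton.elim _ _)
  · right
    have : Nonempty (Fin d) := ⟨⟨0, hd⟩⟩
    obtain ⟨j, hj⟩ := Finite.exists_max fun j => ‖cop φ.B z j‖
    refine ⟨j, ?_⟩
    have h1 := norm_le_of_coord_le hj
    have h2 : z = cop φ.B⁻¹ (cop φ.B z) := by
      rw [← cop_mul, Matrix.nonsing_inv_mul _ (isUnit_iff_ne_zero.2 φ.detB), cop_one]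
    calc ‖z‖ = ‖cop φ.B⁻¹ (cop φ.B z)‖ := by rw [← h2]
      _ ≤ ‖cop φ.B⁻¹‖ * (d * ‖cop φ.B z j‖) := by
          refine (ContinuousLinearMap.le_opNorm _ _).trans ?_
          gcongr
      _ ≤ _ := by nlinarith [norm_nonneg (cop φ.B z j)]

/-- Decay of the FBI transform of test functions. -/
lemma exists_norm_fbi_toDual_le (hθ : 1 / 2 ≤ θ) (hθ' : θ < 1) {C : ℝ} (hC : 0 < C) :
    ∃ δ > 0, ∃ K > 0, ∀ (f : GS d θ) (M : ℝ), GSBound θ C M (f : RSp d → ℂ) →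
      ∀ z, ‖φ.fbi (GS.toDual f) z‖ ≤
        K * M * Real.exp (-δ * ‖z‖ ^ (1 / θ) + φ.weight z) := by
  have hθ0 : 0 < θ := by linarith
  obtain ⟨K, hK, hsup⟩ := φ.exists_norm_fbi_toDual_le_sup hθ hθ'
  obtain ⟨κ, hκ, hB⟩ := φ.exists_norm_le_coord_B
  -- `ShiftBound.mul_coord` needs a scale at least 1.
  set C₁ := max C 1 with hC₁
  have hC₁1 : 1 ≤ C₁ := le_max_right _ _
  set L := 1 + 3 * ∑ j, ∑ l, ‖φ.C j l‖ with hL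
  have hL1 : 1 ≤ L := by rw [hL]; linarith [Finset.sum_nonneg (fun j (_ : j ∈ Finset.univ) =>
    Finset.sum_nonneg fun l (_ : l ∈ Finset.univ) => norm_nonneg (φ.C j l))]
  have hLj : ∀ j, 1 + 3 * ∑ l, ‖φ.C j l‖ ≤ L := fun j => by
    have := Finset.single_le_sum (f := fun j => ∑ l, ‖φ.C j l‖)
      (fun j _ => Finset.sum_nonneg fun l _ => norm_nonneg _) (Finset.mem_univ j)
    rw [hL]; linarith
  set R := κ * (L * C₁) with hR
  have hR0 : 0 < R := by positivity
  refine ⟨θ / 2 * (1 / R) ^ (1 / θ), by positivity, 2 * K, by positivity, fun f M h z => ?_⟩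
  have hM := h.nonneg
  have hb := h.mono hC (le_max_left C 1)
  have key : ∀ j (n : ℕ), ShiftBound θ C₁ n (L ^ n * M) (((φ.lift j)^[n] f : GS d θ) : RSp d → ℂ) := by
    intro j n
    induction n with
    | zero => simpa using hb.shiftBound hθ0.le (by linarith)
    | succ n ih =>
      rw [Function.iterate_succ_apply']
      intro α β x
      refine (φ.shiftBound_lift hθ hC₁1 j _ ih α β x).trans ?_
      rw [pow_succ', mul_assoc L]
      have := hLj j
      gcongr
  have hT : ∀ j (n : ℕ), φ.fbi (GS.toDual ((φ.lift j)^[n] f)) z =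
      cop φ.B z j ^ n * φ.fbi (GS.toDual f) z := by
    intro j n
    induction n with
    | zero => simp
    | succ n ih =>
      rw [Function.iterate_succ_apply', φ.fbi_toDual_lift hθ hθ', ih]; ring
  -- Applying `lift j` $n$ times multiplies the transform by $(Bz)_j^n$, while the supremum of the
  -- function grows by at most $(LC_1)^nn!^\theta$. These moment bounds for all $n$ yield
  -- exponential decay in $|(Bz)_j|^{1/\theta}$.
  have hmom : ∀ j (n : ℕ), ‖cop φ.B z j‖ ^ n * ‖φ.fbi (GS.toDual f) z‖ ≤
      K * M * Real.exp (φ.weight z) * (L * C₁) ^ n * (n.factorial : ℝ) ^ θ := by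
    intro j n
    have := hsup ((φ.lift j)^[n] f) _ (fun x => (key j n).norm_le x) z
    rw [hT, norm_mul, norm_pow] at this
    refine this.trans (le_of_eq ?_)
    rw [mul_pow]; ring
  rcases hB z with rfl | ⟨j, hj⟩
  · have h0 := hsup f M h.norm_le 0
    rw [norm_zero, Real.zero_rpow (by positivity), mul_zero, zero_add]
    refine h0.trans ?_
    have : 0 ≤ K * M * Real.exp (φ.weight 0) := by positivity
    linarith
  · have h1 := le_exp_of_forall_pow_le hθ0 hθ' (norm_nonneg (cop φ.B z j)) (norm_nonneg _)
      (by positivity) (by positivity : 0 < L * C₁) (hmom j)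
    refine h1.trans ?_
    have h2 : ‖z‖ / R ≤ ‖cop φ.B z j‖ / (L * C₁) := by
      rw [div_le_div_iff₀ hR0 (by positivity), hR]
      have := mul_le_mul_of_nonneg_right hj (by positivity : 0 ≤ L * C₁)
      linarith
    have h3 : (1 / R) ^ (1 / θ) * ‖z‖ ^ (1 / θ) ≤ (‖cop φ.B z j‖ / (L * C₁)) ^ (1 / θ) := by
      rw [← Real.mul_rpow (by positivity) (norm_nonneg _), one_div_mul_eq_div]
      exact Real.rpow_le_rpow (by positivity) h2 (by positivity)
    have h4 : Real.exp (-(θ / 2 * (‖cop φ.B z j‖ / (L * C₁)) ^ (1 / θ))) ≤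
        Real.exp (-(θ / 2 * (1 / R) ^ (1 / θ)) * ‖z‖ ^ (1 / θ)) := by
      rw [Real.exp_le_exp]
      have := mul_le_mul_of_nonneg_left h3 (by positivity : 0 ≤ θ / 2)
      linarith
    calc _ ≤ 2 * (K * M * Real.exp (φ.weight z)) *
          Real.exp (-(θ / 2 * (1 / R) ^ (1 / θ)) * ‖z‖ ^ (1 / θ)) := by gcongr
      _ = _ := by rw [Real.exp_add]; ring

end FBIPhase

/-! ### Integrability, linear substitutions and Gaussian means -/

section Integrals

variable {d : ℕ} {θ : ℝ}

lemma integrable_exp_neg_rpow (hθ : 0 < θ) (hθ' : θ < 1) {a : ℝ} (ha : 0 < a) :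
    Integrable fun z : CSp d => Real.exp (-a * ‖z‖ ^ (1 / θ)) := by
  -- One more than the real dimension of $\mathbb C^d$, so that $(1+|z|)^{-n}$ is integrable.
  -- Because $1/\theta>1$, the exponential is below a multiple of $e^{-a(1+|z|)}$ and hence of this
  -- power.
  set n : ℕ := 2 * d + 1 with hn
  have hint : Integrable fun z : CSp d =>
      (Real.exp (2 * a) * n.factorial / a ^ n) * (1 + ‖z‖) ^ (-(n : ℝ)) := by
    refine (integrable_one_add_norm ?_).const_mul _
    rw [← Module.finrank_mul_finrank ℝ ℂ (CSp d)]
    simp [hn]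
  refine hint.mono' ?_ (Eventually.of_forall fun z => ?_)
  · refine Continuous.aestronglyMeasurable ?_
    exact Real.continuous_exp.comp (continuous_const.mul
      (continuous_norm.rpow_const fun _ => Or.inr (by positivity)))
  · have h1 : ‖z‖ ≤ 1 + ‖z‖ ^ (1 / θ) := by
      have := mul_rpow_one_sub_le hθ hθ' (norm_nonneg z) zero_le_one
      rw [Real.one_rpow, mul_one] at this
      linarith
    have hp : 0 < 1 + ‖z‖ := by positivity
    have h2 := Real.pow_div_factorial_le_exp (a * (1 + ‖z‖)) (by positivity) n
    rw [Real.norm_eq_abs, abs_of_pos (Real.exp_pos _), Real.rpow_neg hp.le, Real.rpow_natCast]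
    rw [div_le_iff₀ (by positivity), mul_pow] at h2
    have h3 : Real.exp (-a * ‖z‖ ^ (1 / θ)) ≤ Real.exp (2 * a) * Real.exp (-(a * (1 + ‖z‖))) := by
      rw [← Real.exp_add, Real.exp_le_exp]
      nlinarith
    refine h3.trans ?_
    rw [Real.exp_neg, mul_div_assoc, mul_assoc]
    refine mul_le_mul_of_nonneg_left ?_ (Real.exp_pos _).le
    rw [← div_eq_mul_inv, div_div, inv_le_iff_one_le_mul₀ (Real.exp_pos _), div_mul_eq_mul_div,
      one_le_div (by positivity)]
    linarith

lemma integral_comp_linearMap {E : Type*} [NormedAddCommGroup E] [NormedSpace ℝ E]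
    [FiniteDimensional ℝ E] [MeasurableSpace E] [BorelSpace E] (μ : Measure E)
    [μ.IsAddHaarMeasure] (L : E →ₗ[ℝ] E) (hL : LinearMap.det L ≠ 0) (g : E → ℂ) :
    ∫ x, g (L x) ∂μ = ((|(LinearMap.det L)⁻¹| : ℝ) : ℂ) * ∫ x, g x ∂μ ∧
      (Integrable (fun x => g (L x)) μ ↔ Integrable g μ) := by
  set e := (LinearEquiv.ofIsUnitDet (f := L) (v := Module.finBasis ℝ E)
    (v' := Module.finBasis ℝ E) (by
      rw [LinearMap.det_toMatrix]; exact isUnit_iff_ne_zero.2 hL)).toContinuousLinearEquiv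
  have he : ∀ x, e x = L x := fun x => rfl
  have hm : MeasurableEmbedding (e : E → E) := e.toHomeomorph.measurableEmbedding
  have hmap := Measure.map_linearMap_addHaar_eq_smul_addHaar μ hL
  have h0 : ENNReal.ofReal |(LinearMap.det L)⁻¹| ≠ 0 := by
    simpa using hL
  constructor
  · have := hm.integral_map (μ := μ) g
    have e2 : Measure.map (e : E → E) μ = Measure.map L μ := rfl
    rw [e2, hmap, integral_smul_measure, ENNReal.toReal_ofReal (abs_nonneg _)] at this
    rw [← Complex.real_smul]
    exact this.symm
  · have := hm.integrable_map_iff (μ := μ) (g := g)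
    have e2 : Measure.map (e : E → E) μ = Measure.map L μ := rfl
    rw [e2, hmap, integrable_smul_measure h0 ENNReal.ofReal_ne_top] at this
    exact this.symm

lemma det_rop (R : Matrix (Fin d) (Fin d) ℝ) :
    LinearMap.det (rop R : RSp d →ₗ[ℝ] RSp d) = R.det := by
  rw [rop, Matrix.coe_toEuclideanCLM_eq_toEuclideanLin]
  exact LinearMap.det_toLpLin _ _

lemma det_cop (R : Matrix (Fin d) (Fin d) ℂ) :
    LinearMap.det ((cop R : CSp d →ₗ[ℂ] CSp d).restrictScalars ℝ) = ‖R.det‖ ^ 2 := by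
  rw [LinearMap.det_restrictScalars, Algebra.norm_complex_apply, cop,
    Matrix.coe_toEuclideanCLM_eq_toEuclideanLin, Complex.sq_norm]
  congr 1
  exact LinearMap.det_toLpLin _ _

lemma integral_comp_rop (R : Matrix (Fin d) (Fin d) ℝ) (hR : R.det ≠ 0) (g : RSp d → ℂ) :
    ∫ y, g (rop R y) = ((|R.det| : ℝ) : ℂ)⁻¹ * ∫ y, g y := by
  have h := (integral_comp_linearMap volume (rop R : RSp d →ₗ[ℝ] RSp d)
    (by rwa [det_rop]) g).1
  rw [det_rop, abs_inv] at h
  push_cast at h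
  exact h

lemma integral_comp_cop (R : Matrix (Fin d) (Fin d) ℂ) (hR : R.det ≠ 0) (g : CSp d → ℂ) :
    ∫ z, g (cop R z) = ((‖R.det‖ ^ 2)⁻¹ : ℂ) * ∫ z, g z ∧
      (Integrable (fun z => g (cop R z)) ↔ Integrable g) := by
  have hR' : ‖R.det‖ ^ 2 ≠ 0 := by simpa using hR
  have h := integral_comp_linearMap volume ((cop R : CSp d →ₗ[ℂ] CSp d).restrictScalars ℝ)
    (by rwa [det_cop]) g
  rw [det_cop, abs_inv, abs_of_nonneg (sq_nonneg _)] at h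
  push_cast at h
  exact h

lemma integral_cexp_neg_sq_add (c : CSp d) :
    ∫ y : RSp d, Complex.exp (-cdot (toC y) (toC y) + cdot c (toC y)) =
      (Real.pi : ℂ) ^ ((d : ℂ) / 2) * Complex.exp (cdot c c / 4) := by
  have h := GaussianFourier.integral_cexp_neg_mul_sum_add (b := 1) (by simp) fun i => c i
  rw [Fintype.card_fin, div_one, mul_one] at h
  have h2 := (PiLp.volume_preserving_ofLp (Fin d)).integral_comp
    (MeasurableEquiv.toLp 2 (Fin d → ℝ)).symm.measurableEmbedding
    fun v : Fin d → ℝ => Complex.exp (-1 * ∑ i, (v i : ℂ) ^ 2 + ∑ i, c i * v i)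
  rw [h] at h2
  have e1 : ∑ i, c i ^ 2 = cdot c c := by simp [cdot, dotProduct, pow_two]
  rw [e1] at h2
  rw [← h2]
  refine integral_congr_ae (Eventually.of_forall fun y => ?_)
  simp [cdot, dotProduct, pow_two]

lemma integral_exp_neg_half_norm_sq :
    ∫ τ : CSp d, (Real.exp (-(1 / 2) * ‖τ‖ ^ 2) : ℂ) = (2 * Real.pi : ℂ) ^ d := by
  rw [integral_complex_ofReal, GaussianFourier.integral_rexp_neg_mul_sq_norm (by norm_num),
    ← Module.finrank_mul_finrank ℝ ℂ (CSp d)]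
  simp only [Complex.finrank_real_complex, finrank_euclideanSpace, Fintype.card_fin]
  push_cast
  have : (Real.pi / (1 / 2) : ℝ) ^ ((2 * (d : ℝ)) / 2) = (2 * Real.pi) ^ d := by
    rw [mul_div_cancel_left₀ _ (two_ne_zero), Real.rpow_natCast]
    ring_nf
  rw [this]
  push_cast
  rfl

/-- Rotation by `e^{is}` as a real isometry of `ℂ^d`. -/
noncomputable def rotate (s : ℝ) : CSp d ≃ₗᵢ[ℝ] CSp d :=
  { (LinearEquiv.smulOfUnit (Units.mk0 (Complex.exp (s * Complex.I)) (Complex.exp_ne_zero _)) :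
      CSp d ≃ₗ[ℂ] CSp d).restrictScalars ℝ with
    norm_map' := fun x => by
      change ‖Complex.exp (s * Complex.I) • x‖ = ‖x‖
      rw [norm_smul, Complex.norm_exp_ofReal_mul_I, one_mul] }

lemma rotate_apply (s : ℝ) (x : CSp d) : rotate s x = Complex.exp (s * Complex.I) • x := rfl

/-- The mean value property of entire functions with respect to a Gaussian measure. -/
lemma integral_mul_gaussian {G : CSp d → ℂ} (hG : Differentiable ℂ G)
    (hi : Integrable fun τ : CSp d => G τ * (Real.exp (-(1 / 2) * ‖τ‖ ^ 2) : ℂ)) :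
    ∫ τ : CSp d, G τ * (Real.exp (-(1 / 2) * ‖τ‖ ^ 2) : ℂ) = (2 * Real.pi : ℂ) ^ d * G 0 := by
  -- The integral is averaged over the rotations $\tau\mapsto e^{is}\tau$, which preserve Lebesgue
  -- measure and the Gaussian. After Fubini the inner integral is the mean of $w\mapsto G(w\tau)$
  -- over the unit circle, that is $G(0)$.
  set H : CSp d → ℂ := fun τ => G τ * (Real.exp (-(1 / 2) * ‖τ‖ ^ 2) : ℂ) with hH
  set ρ : Measure ℝ := volume.restrict (Set.Ioc 0 (2 * Real.pi)) with hρ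
  have hsk : MeasurePreserving (fun p : ℝ × CSp d => (p.1, rotate p.1 p.2))
      (ρ.prod volume) (ρ.prod volume) := by
    refine (MeasurePreserving.id ρ).skew_product (g := fun s τ => rotate s τ) ?_
      (Eventually.of_forall fun s => (LinearIsometryEquiv.measurePreserving (rotate s)).map_eq)
    refine Continuous.measurable ?_
    simp only [Function.uncurry_def, rotate_apply]
    fun_prop
  have hint : Integrable (fun p : ℝ × CSp d => H (rotate p.1 p.2)) (ρ.prod volume) :=
    hsk.integrable_comp_of_integrable (hi.comp_snd ρ)
  have hswap := integral_integral_swap (f := fun s τ => H (rotate s τ)) hint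
  have h1 : ∀ s : ℝ, ∫ τ, H (rotate s τ) = ∫ τ, H τ := fun s =>
    (LinearIsometryEquiv.measurePreserving (rotate s)).integral_comp
      (rotate s).toHomeomorph.measurableEmbedding H
  have h2 : ∀ τ : CSp d, ∫ s, H (rotate s τ) ∂ρ =
      (2 * Real.pi : ℂ) * (G 0 * (Real.exp (-(1 / 2) * ‖τ‖ ^ 2) : ℂ)) := by
    intro τ
    have hd : Differentiable ℂ fun w : ℂ => G (w • τ) := hG.comp (differentiable_id.smul_const τ)
    have h3 := (DiffContOnCl.circleAverage (c := 0) (R := 1) hd.diffContOnCl)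
    rw [Real.circleAverage_def, zero_smul, inv_smul_eq_iff₀ (by positivity)] at h3
    rw [intervalIntegral.integral_of_le (by positivity)] at h3
    have h4 : ∀ s : ℝ, H (rotate s τ) = G (circleMap 0 1 s • τ) *
        (Real.exp (-(1 / 2) * ‖τ‖ ^ 2) : ℂ) := by
      intro s
      simp only [hH, LinearIsometryEquiv.norm_map]
      rw [rotate_apply]
      simp [circleMap]
    simp only [h4]
    rw [integral_mul_const, h3, Complex.real_smul]
    push_cast
    ring
  simp only [h1, h2] at hswap
  rw [integral_const_mul, integral_const_mul, integral_exp_neg_half_norm_sq, integral_const] at hswap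
  have h5 : (ρ.real Set.univ) = 2 * Real.pi := by
    rw [hρ, measureReal_restrict_apply_univ, Real.volume_real_Ioc_of_le (by positivity)]; ring
  rw [h5, Complex.real_smul] at hswap
  push_cast at hswap
  have hpi : (2 * Real.pi : ℂ) ≠ 0 := by simp [Real.pi_ne_zero]
  have := mul_left_cancel₀ hpi hswap
  rw [this]; ring

end Integrals

/-! ### Complex conjugation on $\mathcal S_\theta$ -/

section Conj

variable {d : ℕ} {θ : ℝ}

lemma mderiv_conj (β : MIdx d) (f : RSp d → ℂ) :
    mderiv ℝ β (fun x => starRingEnd ℂ (f x)) = fun x => starRingEnd ℂ (mderiv ℝ β f x) := by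
  have h1 : ∀ (i : Fin d) (g : RSp d → ℂ),
      pderiv ℝ i (fun x => starRingEnd ℂ (g x)) = fun x => starRingEnd ℂ (pderiv ℝ i g x) := by
    intro i g
    funext x
    have := Complex.conjCLE.comp_fderiv (f := g) (x := x)
    have e : (fun x => starRingEnd ℂ (g x)) = Complex.conjCLE ∘ g := rfl
    rw [pderiv, e, this]
    rfl
  unfold mderiv
  induction List.finRange d with
  | nil => rfl
  | cons i l ih =>
    rw [List.foldr_cons, List.foldr_cons, ih]
    generalize l.foldr (fun i f => (pderiv ℝ i)^[β i] f) f = g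
    induction β i with
    | zero => rfl
    | succ n ihn => rw [Function.iterate_succ_apply', ihn, Function.iterate_succ_apply', h1]

lemma GSBound.conj {C M : ℝ} {f : RSp d → ℂ} (h : GSBound θ C M f) :
    GSBound θ C M fun x => starRingEnd ℂ (f x) := by
  intro α β x
  rw [mderiv_conj, RCLike.norm_conj]
  exact h α β x

/-- Complex conjugation on `S_θ`. -/
noncomputable def GS.conj (f : GS d θ) : GS d θ :=
  ⟨fun x => starRingEnd ℂ ((f : RSp d → ℂ) x), by
    obtain ⟨hf, C, hC, M, h⟩ := f.2
    exact ⟨Complex.conjCLE.contDiff.comp hf, C, hC, M, h.conj⟩⟩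

end Conj

/-! ### The adjoint $T_\varphi^*$ -/

namespace FBIPhase

variable {d : ℕ} (φ : FBIPhase d) {θ : ℝ}

/-- Continuous functions on `ℂ^d` of the growth of FBI transforms of ultradistributions. -/
def Growth (θ : ℝ) : Submodule ℂ (CSp d → ℂ) where
  carrier := {U | Continuous U ∧ ∀ ε > 0, ∃ G, ∀ z,
    ‖U z‖ ≤ G * Real.exp (ε * ‖z‖ ^ (1 / θ) + φ.weight z)}
  add_mem' := by
    rintro U V ⟨hU, hU'⟩ ⟨hV, hV'⟩
    refine ⟨hU.add hV, fun ε hε => ?_⟩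
    obtain ⟨G, hG⟩ := hU' ε hε
    obtain ⟨H, hH⟩ := hV' ε hε
    refine ⟨G + H, fun z => ?_⟩
    rw [add_mul]
    exact (norm_add_le _ _).trans (add_le_add (hG z) (hH z))
  zero_mem' := ⟨continuous_const, fun ε _ => ⟨0, fun z => by simp⟩⟩
  smul_mem' := by
    rintro c U ⟨hU, hU'⟩
    refine ⟨hU.const_smul c, fun ε hε => ?_⟩
    obtain ⟨G, hG⟩ := hU' ε hε
    refine ⟨‖c‖ * G, fun z => ?_⟩
    rw [Pi.smul_apply, norm_smul, mul_assoc]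
    exact mul_le_mul_of_nonneg_left (hG z) (norm_nonneg _)

lemma fbiFun_conj (hθ : 1 / 2 ≤ θ) (hθ' : θ < 1) (f : GS d θ) (z : CSp d) :
    φ.fbiFun (fun y => starRingEnd ℂ ((f : RSp d → ℂ) y)) z = φ.fbi (GS.toDual (GS.conj f)) z :=
  (φ.fbi_toDual hθ hθ' (GS.conj f) z).symm

/-- The two factors $e^\Phi$ cancel $e^{-2\Phi}$. The transform of $\bar f$ decays at a rate
depending only on the scale of `f`; half of that rate is spent on the growth of `U`. The estimate is
pointwise in $z$, with `K` independent of `f` and `U`. -/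
lemma exists_norm_adjIntegrand_le (hθ : 1 / 2 ≤ θ) (hθ' : θ < 1) {C : ℝ} (hC : 0 < C) :
    ∃ δ > 0, ∃ K > 0, ∀ (f : GS d θ) (M : ℝ), GSBound θ C M (f : RSp d → ℂ) →
      ∀ (U : CSp d → ℂ) (G : ℝ) (z : CSp d),
        ‖U z‖ ≤ G * Real.exp (δ * ‖z‖ ^ (1 / θ) + φ.weight z) →
        ‖φ.adjIntegrand U f z‖ ≤ G * (K * M) * Real.exp (-δ * ‖z‖ ^ (1 / θ)) := by
  obtain ⟨δ, hδ, K, hK, H⟩ := φ.exists_norm_fbi_toDual_le hθ hθ' hC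
  refine ⟨δ / 2, by positivity, K, hK, fun f M h U G z hU => ?_⟩
  have h1 := H (GS.conj f) M h.conj z
  rw [adjIntegrand, φ.fbiFun_conj hθ hθ', norm_mul, norm_mul, RCLike.norm_conj,
    Complex.norm_real, Real.norm_eq_abs, abs_of_pos (Real.exp_pos _)]
  have hU0 := (norm_nonneg _).trans hU
  calc _ ≤ (G * Real.exp (δ / 2 * ‖z‖ ^ (1 / θ) + φ.weight z)) *
        (K * M * Real.exp (-δ * ‖z‖ ^ (1 / θ) + φ.weight z)) * Real.exp (-2 * φ.weight z) := by
        gcongr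
    _ = G * (K * M) * (Real.exp (δ / 2 * ‖z‖ ^ (1 / θ) + φ.weight z) *
        Real.exp (-δ * ‖z‖ ^ (1 / θ) + φ.weight z) * Real.exp (-2 * φ.weight z)) := by ring
    _ = _ := by
        rw [← Real.exp_add, ← Real.exp_add]
        ring_nf

lemma continuous_fbi (hθ : 1 / 2 ≤ θ) (hθ' : θ < 1) (u : GSDual d θ) : Continuous (φ.fbi u) :=
  (φ.contDiff_fbi hθ hθ' u).continuous

lemma continuous_adjIntegrand (hθ : 1 / 2 ≤ θ) (hθ' : θ < 1) {U : CSp d → ℂ} (hU : Continuous U)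
    (f : GS d θ) : Continuous (φ.adjIntegrand U f) := by
  unfold adjIntegrand
  refine (hU.mul (Complex.continuous_conj.comp ?_)).mul ?_
  · have : φ.fbiFun (fun y => starRingEnd ℂ ((f : RSp d → ℂ) y)) =
        φ.fbi (GS.toDual (GS.conj f)) := funext (φ.fbiFun_conj hθ hθ' f)
    rw [this]
    exact φ.continuous_fbi hθ hθ' _
  · exact Complex.continuous_ofReal.comp (Real.continuous_exp.comp
      (continuous_const.mul φ.continuous_weight))

lemma integrable_adjIntegrand (hθ : 1 / 2 ≤ θ) (hθ' : θ < 1) {U : CSp d → ℂ}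
    (hU : U ∈ φ.Growth θ) (f : GS d θ) : Integrable (φ.adjIntegrand U f) := by
  obtain ⟨hf, C, hC, M, h⟩ := f.2
  obtain ⟨δ, hδ, K, hK, H⟩ := φ.exists_norm_adjIntegrand_le hθ hθ' hC
  obtain ⟨G, hG⟩ := hU.2 δ hδ
  exact ((integrable_exp_neg_rpow (by linarith) hθ' hδ).const_mul (G * (K * M))).mono'
    (φ.continuous_adjIntegrand hθ hθ' hU.1 f).aestronglyMeasurable
    (Eventually.of_forall fun z => H f M h U G z (hG z))

lemma exists_norm_integral_adjIntegrand_le (hθ : 1 / 2 ≤ θ) (hθ' : θ < 1) {C : ℝ} (hC : 0 < C) :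
    ∃ δ > 0, ∃ K > 0, ∀ (f : GS d θ) (M : ℝ), GSBound θ C M (f : RSp d → ℂ) →
      ∀ (U : CSp d → ℂ) (G : ℝ),
        (∀ z, ‖U z‖ ≤ G * Real.exp (δ * ‖z‖ ^ (1 / θ) + φ.weight z)) →
        ∫ z, ‖φ.adjIntegrand U f z‖ ≤ G * (K * M) := by
  obtain ⟨δ, hδ, K, hK, H⟩ := φ.exists_norm_adjIntegrand_le hθ hθ' hC
  have hint := integrable_exp_neg_rpow (d := d) (by linarith) hθ' hδ
  set J := ∫ z : CSp d, Real.exp (-δ * ‖z‖ ^ (1 / θ)) with hJ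
  have hJ0 : 0 ≤ J := integral_nonneg fun _ => (Real.exp_pos _).le
  refine ⟨δ, hδ, K * J + 1, by positivity, fun f M h U G hU => ?_⟩
  have hM := h.nonneg
  have hG : 0 ≤ G := nonneg_of_mul_nonneg_left ((norm_nonneg _).trans (hU 0)) (Real.exp_pos _)
  have h1 : ∫ z, ‖φ.adjIntegrand U f z‖ ≤ G * (K * M) * J := by
    rw [hJ, ← integral_const_mul]
    refine integral_mono_of_nonneg (Eventually.of_forall fun _ => norm_nonneg _)
      (hint.const_mul _) (Eventually.of_forall fun z => H f M h U G z (hU z))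
  refine h1.trans ?_
  have : 0 ≤ G * M := by positivity
  nlinarith

lemma fbiFun_conj_add (hθ : 1 / 2 ≤ θ) (hθ' : θ < 1) (f g : GS d θ) (z : CSp d) :
    φ.fbi (GS.toDual (GS.conj (f + g))) z =
      φ.fbi (GS.toDual (GS.conj f)) z + φ.fbi (GS.toDual (GS.conj g)) z := by
  have : GS.conj (f + g) = GS.conj f + GS.conj g :=
    Subtype.ext (funext fun x => map_add (starRingEnd ℂ) _ _)
  rw [this, GS.toDual_add, φ.fbi_add hθ hθ', Pi.add_apply]

lemma fbiFun_conj_smul (hθ : 1 / 2 ≤ θ) (hθ' : θ < 1) (c : ℂ) (f : GS d θ) (z : CSp d) :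
    φ.fbi (GS.toDual (GS.conj (c • f))) z =
      starRingEnd ℂ c * φ.fbi (GS.toDual (GS.conj f)) z := by
  have : GS.conj (c • f) = starRingEnd ℂ c • GS.conj f :=
    Subtype.ext (funext fun x => map_mul (starRingEnd ℂ) _ _)
  rw [this, GS.toDual_smul, φ.fbi_smul hθ hθ', Pi.smul_apply, smul_eq_mul]

/-- The adjoint `T_φ^*` as a linear map into ultradistributions. -/
noncomputable def adj (hθ : 1 / 2 ≤ θ) (hθ' : θ < 1) : φ.Growth θ →ₗ[ℂ] GSDual d θ where
  toFun U := ⟨{ toFun := fun f => ∫ z, φ.adjIntegrand U f z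
                map_add' := fun f g => by
                  rw [← integral_add (φ.integrable_adjIntegrand hθ hθ' U.2 f)
                    (φ.integrable_adjIntegrand hθ hθ' U.2 g)]
                  refine integral_congr_ae (Eventually.of_forall fun z => ?_)
                  simp only [adjIntegrand, φ.fbiFun_conj hθ hθ', φ.fbiFun_conj_add hθ hθ', map_add]
                  ring
                map_smul' := fun c f => by
                  rw [RingHom.id_apply, smul_eq_mul, ← integral_const_mul]
                  refine integral_congr_ae (Eventually.of_forall fun z => ?_)
                  simp only [adjIntegrand, φ.fbiFun_conj hθ hθ', φ.fbiFun_conj_smul hθ hθ', map_mul,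
                    Complex.conj_conj]
                  ring }, by
    intro C hC
    obtain ⟨δ, hδ, K, hK, H⟩ := φ.exists_norm_integral_adjIntegrand_le hθ hθ' hC
    obtain ⟨G, hG⟩ := U.2.2 δ hδ
    refine ⟨G * K, fun f M h => ?_⟩
    rw [mul_assoc]
    exact (norm_integral_le_integral_norm _).trans (H f M h U G hG)⟩
  map_add' U V := by
    refine Subtype.ext (LinearMap.ext fun f => ?_)
    change ∫ z, φ.adjIntegrand (U + V : CSp d → ℂ) f z =
      (∫ z, φ.adjIntegrand U f z) + ∫ z, φ.adjIntegrand V f z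
    rw [← integral_add (φ.integrable_adjIntegrand hθ hθ' U.2 f)
      (φ.integrable_adjIntegrand hθ hθ' V.2 f)]
    refine integral_congr_ae (Eventually.of_forall fun z => ?_)
    simp only [adjIntegrand, Pi.add_apply]
    ring
  map_smul' c U := by
    refine Subtype.ext (LinearMap.ext fun f => ?_)
    change ∫ z, φ.adjIntegrand (c • U : CSp d → ℂ) f z = c * ∫ z, φ.adjIntegrand U f z
    rw [← integral_const_mul]
    refine integral_congr_ae (Eventually.of_forall fun z => ?_)
    simp only [adjIntegrand, Pi.smul_apply, smul_eq_mul]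
    ring

lemma isAdjoint_adj (hθ : 1 / 2 ≤ θ) (hθ' : θ < 1) (U : φ.Growth θ) :
    φ.IsAdjoint U (φ.adj hθ hθ' U) :=
  fun f => ⟨φ.integrable_adjIntegrand hθ hθ' U.2 f, rfl⟩

/-! ### The reproducing property -/

lemma det_rt_ne_zero : φ.rt.det ≠ 0 := φ.isUnit_det_rt.ne_zero

lemma norm_det_nu : ‖φ.nu.det‖ = ‖φ.B.det‖ / |φ.rt.det| := by
  have h : (rmat φ.rtᵀ).det = (φ.rt.det : ℂ) := by
    rw [rmat_transpose, Matrix.det_transpose]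
    exact (RingHom.map_det Complex.ofRealHom φ.rt).symm
  have hB : φ.B.det = (φ.rt.det : ℂ) * φ.nu.det := by
    conv_lhs => rw [B_eq, Matrix.det_mul, h]
  rw [hB, norm_mul, Complex.norm_real, Real.norm_eq_abs,
    mul_div_cancel_left₀ _ (abs_ne_zero.2 φ.det_rt_ne_zero)]

lemma det_nu_ne_zero : φ.nu.det ≠ 0 := by
  rw [← norm_ne_zero_iff, norm_det_nu]
  exact div_ne_zero (norm_ne_zero_iff.2 φ.detB) (abs_ne_zero.2 φ.det_rt_ne_zero)

/-- The normalization of $c_\varphi$: the second factor is the Gaussian integral in $y$ after the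
substitution $Sy$, and the third is the Gaussian integral over $\mathbb C^d$ after the substitution
$\tau=Nt$. -/
lemma const_sq : φ.const ^ 2 * (|φ.rt.det|⁻¹ * Real.pi ^ ((d : ℝ) / 2)) *
    ((‖φ.nu.det‖ ^ 2)⁻¹ * (2 * Real.pi) ^ d) = 1 := by
  have hM : (φ.C.map Complex.im).det = |φ.rt.det| ^ 2 := by
    rw [← rt_transpose_mul, Matrix.det_mul, Matrix.det_transpose, sq_abs, pow_two]
  have hs : 0 < |φ.rt.det| := abs_pos.2 φ.det_rt_ne_zero
  have hb : 0 < ‖φ.B.det‖ := norm_pos_iff.2 φ.detB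
  have hpi := Real.pi_pos
  rw [const, hM, norm_det_nu]
  set s := |φ.rt.det|
  set b := ‖φ.B.det‖
  have e1 : ((2 : ℝ) ^ (-(d : ℝ) / 2)) ^ 2 = (2 ^ d)⁻¹ := by
    rw [← Real.rpow_natCast, ← Real.rpow_mul (by norm_num), ← Real.rpow_natCast, ← Real.rpow_neg
      (by norm_num)]
    congr 1; push_cast; ring
  have e2 : (Real.pi ^ (-3 * (d : ℝ) / 4)) ^ 2 * Real.pi ^ ((d : ℝ) / 2) = (Real.pi ^ d)⁻¹ := by
    rw [← Real.rpow_natCast, ← Real.rpow_mul hpi.le, ← Real.rpow_add hpi, ← Real.rpow_natCast,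
      ← Real.rpow_neg hpi.le]
    congr 1; push_cast; ring
  have e3 : ((s ^ 2) ^ (-(1 : ℝ) / 4)) ^ 2 = s⁻¹ := by
    rw [← Real.rpow_natCast, ← Real.rpow_natCast, ← Real.rpow_mul hs.le, ← Real.rpow_mul hs.le,
      ← Real.rpow_neg_one]
    congr 1; push_cast; ring
  rw [mul_pow, mul_pow, mul_pow, e1, e3]
  calc _ = (2 ^ d)⁻¹ * ((Real.pi ^ (-3 * (d : ℝ) / 4)) ^ 2 * Real.pi ^ ((d : ℝ) / 2)) * s⁻¹ * b ^ 2 *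
      s⁻¹ * (((b / s) ^ 2)⁻¹ * (2 ^ d * Real.pi ^ d)) := by rw [mul_pow]; ring
    _ = 1 := by rw [e2]; field_simp

/-- The entrywise complex conjugate of a vector. -/
noncomputable def conjV (w : CSp d) : CSp d := WithLp.toLp 2 fun i => starRingEnd ℂ (w i)

lemma conj_cdot (u v : CSp d) : starRingEnd ℂ (cdot u v) = cdot (conjV u) (conjV v) := by
  simp [cdot, dotProduct, conjV]

lemma conjV_toC (y : RSp d) : conjV (toC y) = toC y := by
  ext i; simp [conjV]

lemma cop_rmat_toC (R : Matrix (Fin d) (Fin d) ℝ) (y : RSp d) :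
    cop (rmat R) (toC y) = toC (rop R y) := by
  ext i
  simp [ofLp_cop, ofLp_rop, Matrix.mulVec, dotProduct, rmat]

lemma conjV_add (u v : CSp d) : conjV (u + v) = conjV u + conjV v := by
  ext i; simp [conjV]

/-- The contributions of $\operatorname{Re}C$ cancel in the product, and what remains is a standard
Gaussian in $Sy$ with a linear term. -/
lemma kernel_mul_conj (z w : CSp d) (y : RSp d) :
    φ.kernel z y * starRingEnd ℂ (φ.kernel w y) =
      Complex.exp (Complex.I / 2 * (cdot (cop φ.A z) z - starRingEnd ℂ (cdot (cop φ.A w) w))) *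
      Complex.exp (-cdot (toC (rop φ.rt y)) (toC (rop φ.rt y)) +
        cdot (Complex.I • (cop φ.nu z - conjV (cop φ.nu w))) (toC (rop φ.rt y))) := by
  rw [kernel, kernel, ← Complex.exp_conj, ← Complex.exp_add, ← Complex.exp_add, val_eq, val_eq,
    valC_eq, valC_eq]
  congr 1
  simp only [map_add, map_mul, conj_cdot, conjV_toC, map_div₀, Complex.conj_I,
    map_one, map_ofNat, cop_rmat_toC, cdot_smul_left]
  have : cdot (cop φ.nu z - conjV (cop φ.nu w)) (toC (rop φ.rt y)) =
      cdot (cop φ.nu z) (toC (rop φ.rt y)) - cdot (conjV (cop φ.nu w)) (toC (rop φ.rt y)) := by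
    simp [cdot, sub_dotProduct]
  rw [this]
  linear_combination (cdot (toC (rop φ.rt y)) (toC (rop φ.rt y))) * Complex.I_mul_I

/-- The reproducing kernel, multiplied by the weight. -/
noncomputable def repro (z w : CSp d) : ℂ :=
  Complex.exp (Complex.I / 2 * (cdot (cop φ.A z) z - starRingEnd ℂ (cdot (cop φ.A w) w)) -
    1 / 4 * cdot (cop φ.nu z - conjV (cop φ.nu w)) (cop φ.nu z - conjV (cop φ.nu w)) -
    2 * φ.weight w)

/-- Evaluation of the $y$-integral in $T_\varphi T_\varphi^*$, which makes this composition an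
integral operator with explicit kernel. -/
lemma conj_fbiFun_conj_kernel (z w : CSp d) :
    starRingEnd ℂ (φ.fbiFun (fun y => starRingEnd ℂ (φ.kernel z y)) w) *
      (Real.exp (-2 * φ.weight w) : ℂ) =
      (φ.const * (|φ.rt.det|⁻¹ * Real.pi ^ ((d : ℝ) / 2)) : ℝ) * φ.repro z w := by
  have h1 : starRingEnd ℂ (φ.fbiFun (fun y => starRingEnd ℂ (φ.kernel z y)) w) =
      φ.const * ∫ y : RSp d, φ.kernel z y * starRingEnd ℂ (φ.kernel w y) := by
    rw [fbiFun, map_mul, Complex.conj_ofReal, ← integral_conj]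
    simp only [map_mul, Complex.conj_conj]
  have h2 := integral_comp_rop φ.rt φ.det_rt_ne_zero fun x =>
    Complex.exp (-cdot (toC x) (toC x) +
      cdot (Complex.I • (cop φ.nu z - conjV (cop φ.nu w))) (toC x))
  rw [integral_cexp_neg_sq_add] at h2
  simp only [h1, kernel_mul_conj]
  rw [integral_const_mul, h2, repro]
  have h3 : ((Real.pi ^ ((d : ℝ) / 2) : ℝ) : ℂ) = (Real.pi : ℂ) ^ ((d : ℂ) / 2) := by
    rw [Complex.ofReal_cpow Real.pi_pos.le]; push_cast; rfl
  rw [Complex.ofReal_mul, Complex.ofReal_mul, h3, cdot_smul_left, cdot_smul_right,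
    Complex.ofReal_inv, sub_eq_add_neg (_ - _) (2 * (φ.weight w : ℂ)), Complex.exp_add,
    sub_eq_add_neg _ (1 / 4 * _), Complex.exp_add]
  have h4 : ∀ q : ℂ, Complex.I * (Complex.I * q) / 4 = -(1 / 4 * q) := fun q => by
    linear_combination q / 4 * Complex.I_mul_I
  rw [h4]
  push_cast
  ring_nf

/-- The entire factor in the reproducing formula. -/
noncomputable def reproFactor (U : CSp d → ℂ) (z τ : CSp d) : ℂ :=
  U (z + cop φ.nu⁻¹ τ) * Complex.exp (-Complex.I * (cdot (cop φ.A z) (cop φ.nu⁻¹ τ) +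
    1 / 2 * cdot (cop φ.A (cop φ.nu⁻¹ τ)) (cop φ.nu⁻¹ τ)) +
    1 / 2 * cdot (cop φ.nu z - conjV (cop φ.nu z)) τ + 1 / 4 * cdot τ τ)

lemma nu_nu_inv (τ : CSp d) : cop φ.nu (cop φ.nu⁻¹ τ) = τ := by
  rw [← cop_mul, Matrix.mul_nonsing_inv _ (isUnit_iff_ne_zero.2 φ.det_nu_ne_zero), cop_one]

lemma nu_inv_nu (τ : CSp d) : cop φ.nu⁻¹ (cop φ.nu τ) = τ := by
  rw [← cop_mul, Matrix.nonsing_inv_mul _ (isUnit_iff_ne_zero.2 φ.det_nu_ne_zero), cop_one]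

/-- It expresses the non-holomorphic part of $\Phi$ by $v$ and $\bar v$, so that exponents can be
compared as polynomials. -/
lemma norm_sq_imV (v : CSp d) :
    ((‖imV v‖ ^ 2 : ℝ) : ℂ) = -(1 / 4) * cdot (v - conjV v) (v - conjV v) := by
  have h : v - conjV v = (2 * Complex.I) • toC (imV v) := by
    ext i
    simp [conjV, Complex.sub_conj, mul_comm, mul_assoc]
  have h2 : cdot (toC (imV v)) (toC (imV v)) = ((‖imV v‖ ^ 2 : ℝ) : ℂ) := by
    rw [EuclideanSpace.norm_sq_eq]
    simp [cdot, dotProduct, pow_two, ← Complex.ofReal_mul]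
  rw [h, cdot_smul_left, cdot_smul_right, h2]
  linear_combination ((‖imV v‖ ^ 2 : ℝ) : ℂ) * Complex.I_mul_I

lemma cdot_conjV (τ : CSp d) : cdot τ (conjV τ) = ((‖τ‖ ^ 2 : ℝ) : ℂ) := by
  rw [EuclideanSpace.norm_sq_eq]
  simp [cdot, dotProduct, conjV, Complex.mul_conj, Complex.normSq_eq_norm_sq]

/-- With $w=z+N^{-1}\tau$ all terms of the exponent containing $\bar\tau$ cancel except
$-\frac12\tau\cdot\bar\tau$. The rest is holomorphic in $\tau$ whenever `U` is. -/
lemma mul_repro_eq (U : CSp d → ℂ) (z τ : CSp d) :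
    U (z + cop φ.nu⁻¹ τ) * φ.repro z (z + cop φ.nu⁻¹ τ) =
      φ.reproFactor U z τ * (Real.exp (-(1 / 2) * ‖τ‖ ^ 2) : ℂ) := by
  set t := cop φ.nu⁻¹ τ with ht
  rw [reproFactor, repro, mul_assoc, Complex.ofReal_exp, ← Complex.exp_add, ← ht]
  congr 2
  have hnu : cop φ.nu (z + t) = cop φ.nu z + τ := by rw [map_add, ht, nu_nu_inv]
  have hw : (2 * φ.weight (z + t) : ℂ) = -((cdot (cop φ.A (z + t)) (z + t)).im : ℂ) +
      ((‖imV (cop φ.nu z + τ)‖ ^ 2 : ℝ) : ℂ) := by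
    rw [weight_eq, wt, hnu]; push_cast; ring
  have him : ((cdot (cop φ.A (z + t)) (z + t)).im : ℂ) =
      -Complex.I / 2 * (cdot (cop φ.A (z + t)) (z + t) -
        starRingEnd ℂ (cdot (cop φ.A (z + t)) (z + t))) := by
    rw [Complex.sub_conj]
    push_cast
    linear_combination ((cdot (cop φ.A (z + t)) (z + t)).im : ℂ) * Complex.I_mul_I
  have hA : cdot (cop φ.A (z + t)) (z + t) = cdot (cop φ.A z) z + 2 * cdot (cop φ.A z) t +
      cdot (cop φ.A t) t := by
    rw [map_add, cdot_add_left, cdot_add_right, cdot_add_right, φ.cdot_A_comm z t]; ring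
  have hτ : ((-(1 / 2) * ‖τ‖ ^ 2 : ℝ) : ℂ) = -(1 / 2) * cdot τ (conjV τ) := by
    rw [cdot_conjV]; push_cast; ring
  rw [hw, him, hnu, norm_sq_imV, hτ]
  set a' := starRingEnd ℂ (cdot (cop φ.A (z + t)) (z + t))
  rw [hA]
  set p := cop φ.nu z - conjV (cop φ.nu z) with hp
  have e1 : cop φ.nu z - conjV (cop φ.nu z + τ) = p + (-1 : ℂ) • conjV τ := by
    rw [conjV_add, hp, neg_one_smul]; abel
  have e2 : cop φ.nu z + τ - conjV (cop φ.nu z + τ) = p + τ + (-1 : ℂ) • conjV τ := by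
    rw [conjV_add, hp, neg_one_smul]; abel
  rw [e1, e2]
  simp only [cdot_add_left, cdot_add_right, cdot_smul_left, cdot_smul_right]
  rw [cdot_comm (conjV τ) τ, cdot_comm (conjV τ) p, cdot_comm τ p]
  ring

/-- `T_φ T_φ^* U = U` for entire functions. -/
lemma fbi_adj (hθ : 1 / 2 ≤ θ) (hθ' : θ < 1) (U : φ.Growth θ)
    (hU : Differentiable ℂ (U : CSp d → ℂ)) : φ.fbi (φ.adj hθ hθ' U) = U := by
  funext z
  set κ : ℂ := ((φ.const * (|φ.rt.det|⁻¹ * Real.pi ^ ((d : ℝ) / 2)) : ℝ) : ℂ) with hκ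
  have hconst : φ.const ≠ 0 := by
    intro h0
    have := φ.const_sq
    rw [h0] at this
    simp at this
  have hκ0 : κ ≠ 0 := by
    rw [hκ, Complex.ofReal_ne_zero]
    have := Real.pi_pos
    have := abs_pos.2 φ.det_rt_ne_zero
    positivity
  have h1 : φ.adjIntegrand U (φ.ker hθ hθ' z) =
      fun w => κ * ((U : CSp d → ℂ) w * φ.repro z w) := by
    funext w
    have := φ.conj_fbiFun_conj_kernel z w
    rw [adjIntegrand, mul_assoc]
    change _ * (starRingEnd ℂ (φ.fbiFun (fun y => starRingEnd ℂ (φ.kernel z y)) w) *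
      (Real.exp (-2 * φ.weight w) : ℂ)) = _
    rw [this]; ring
  have hint := φ.integrable_adjIntegrand hθ hθ' U.2 (φ.ker hθ hθ' z)
  rw [h1, integrable_const_mul_iff (isUnit_iff_ne_zero.2 hκ0)] at hint
  set H : CSp d → ℂ := fun w => (U : CSp d → ℂ) w * φ.repro z w with hH
  have hshift : Integrable fun t => H (z + t) := hint.comp_add_left z
  have hcv := integral_comp_cop φ.nu φ.det_nu_ne_zero fun τ =>
    φ.reproFactor U z τ * (Real.exp (-(1 / 2) * ‖τ‖ ^ 2) : ℂ)
  have e1 : ∀ t, φ.reproFactor U z (cop φ.nu t) *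
      (Real.exp (-(1 / 2) * ‖cop φ.nu t‖ ^ 2) : ℂ) = H (z + t) := by
    intro t
    rw [← mul_repro_eq, nu_inv_nu]
  simp only [e1] at hcv
  have hdiff : Differentiable ℂ (φ.reproFactor U z) := by
    have hl : Differentiable ℂ fun τ : CSp d => cop φ.nu⁻¹ τ := (cop φ.nu⁻¹).differentiable
    have hq : ∀ {f g : CSp d → CSp d}, ContDiff ℂ 1 f → ContDiff ℂ 1 g →
        Differentiable ℂ fun τ => cdot (f τ) (g τ) := fun hf hg =>
      (contDiff_cdot hf hg).differentiable (by simp)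
    have hc : ContDiff ℂ 1 fun τ : CSp d => cop φ.nu⁻¹ τ := (cop φ.nu⁻¹).contDiff
    unfold reproFactor
    refine (hU.comp (hl.const_add z)).mul (Differentiable.cexp ?_)
    refine (((hq contDiff_const hc).add
      ((hq ((cop φ.A).contDiff.comp hc) hc).const_mul (1 / 2))).const_mul (-Complex.I)).add
      ((hq contDiff_const contDiff_id).const_mul (1 / 2)) |>.add
      ((hq contDiff_id contDiff_id).const_mul (1 / 4))
  -- In the variable $\tau$ the integrand is an entire function times the Gaussian, so its integral
  -- is determined by the value at $\tau=0$, namely $U(z)$. The constants cancel by `const_sq`.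
  have hmean := integral_mul_gaussian hdiff (hcv.2.1 hshift)
  have h0 : φ.reproFactor U z 0 = (U : CSp d → ℂ) z := by
    simp [reproFactor, cdot]
  rw [h0] at hmean
  rw [hmean] at hcv
  have hsum : ∫ w, φ.adjIntegrand U (φ.ker hθ hθ' z) w =
      κ * (((‖φ.nu.det‖ ^ 2)⁻¹ : ℂ) * ((2 * Real.pi : ℂ) ^ d * (U : CSp d → ℂ) z)) := by
    rw [h1, integral_const_mul, ← hcv.1, ← integral_add_left_eq_self H z]
  rw [φ.fbi_eq hθ hθ']
  change φ.const * ∫ w, φ.adjIntegrand U (φ.ker hθ hθ' z) w = _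
  rw [hsum, hκ]
  have hc := congrArg (fun x : ℝ => (x : ℂ)) φ.const_sq
  push_cast at hc ⊢
  linear_combination (U : CSp d → ℂ) z * hc

end FBIPhase

lemma mderiv_single_complex {d : ℕ} (j : Fin d) (F : CSp d → ℂ) :
    mderiv ℂ (Pi.single j 1 : MIdx d) F = pderiv ℂ j F := by
  have key : ∀ l : List (Fin d), l.Nodup →
      l.foldr (fun i f => (pderiv ℂ i)^[(Pi.single j 1 : MIdx d) i] f) F =
        if j ∈ l then pderiv ℂ j F else F := by
    intro l hl
    induction l with
    | nil => simp
    | cons i l ih =>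
      rw [List.nodup_cons] at hl
      rw [List.foldr_cons, ih hl.2]
      by_cases hij : j = i
      · subst hij
        simp [hl.1]
      · simp [hij, Ne.symm hij]
  unfold mderiv
  rw [key _ (List.nodup_finRange d), if_pos (List.mem_finRange j)]

/-! ### Cauchy estimates relative to the weight $e^\Phi$ -/

namespace FBIPhase

variable {d : ℕ} (φ : FBIPhase d) {θ : ℝ}

lemma max_pow_mul_exp_le {lam E : ℝ} (hl : 0 < lam) (n : ℕ) :
    (lam⁻¹) ^ n * Real.exp (E * ((n : ℝ) + 1)) ≤ (max 1 lam⁻¹ * Real.exp E) ^ (n + 1) := by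
  have h1 : Real.exp (E * ((n : ℝ) + 1)) = Real.exp E ^ (n + 1) := by
    rw [mul_comm, ← Real.exp_nat_mul]; push_cast; rfl
  rw [h1, mul_pow]
  refine mul_le_mul_of_nonneg_right ?_ (by positivity)
  calc (lam⁻¹) ^ n ≤ (max 1 lam⁻¹) ^ n := pow_le_pow_left₀ (by positivity) (le_max_right _ _) _
    _ ≤ _ := pow_le_pow_right₀ (le_max_left _ _) (Nat.le_succ n)

/-- The weight on polydiscs of radius `λ m^{1-θ}`. -/
lemma exists_weight_polydisc_le (hθ : 1 / 2 ≤ θ) (hθ' : θ < 1) : ∃ Q > 0,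
    ∀ (lam m : ℝ) (z w : CSp d), 0 < lam → 1 ≤ m → ‖w‖ ≤ d * (lam * m ^ (1 - θ)) →
      φ.weight (z + w) ≤ φ.weight z + Q * lam * ‖z‖ ^ (1 / θ) + (Q * lam + Q * lam ^ 2) * m := by
  obtain ⟨Q, hQ, H⟩ := φ.weight_add_le
  have hθ0 : 0 < θ := by linarith
  refine ⟨Q * d + Q * d ^ 2 + 1, by positivity, fun lam m z w hl hm hw => ?_⟩
  have h1 := mul_rpow_one_sub_le hθ0 hθ' (norm_nonneg z) (by linarith : 0 ≤ m)
  have h2 := rpow_one_sub_sq_le hθ hm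
  set p := m ^ (1 - θ) with hp
  have hp0 : 0 ≤ p := by positivity
  set s := ‖z‖ ^ (1 / θ) with hs
  have hs0 : 0 ≤ s := by positivity
  have h3 : ‖z‖ * ‖w‖ ≤ d * lam * (s + m) := by
    calc ‖z‖ * ‖w‖ ≤ ‖z‖ * (d * (lam * p)) := by gcongr
      _ = d * lam * (‖z‖ * p) := by ring
      _ ≤ _ := by gcongr
  have h4 : ‖w‖ ^ 2 ≤ d ^ 2 * lam ^ 2 * m := by
    calc ‖w‖ ^ 2 ≤ (d * (lam * p)) ^ 2 := by gcongr
      _ = d ^ 2 * lam ^ 2 * p ^ 2 := by ring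
      _ ≤ _ := by gcongr
  have h5 := H z w
  have h6 : Q * (‖z‖ * ‖w‖ + ‖w‖ ^ 2) ≤ Q * (d * lam * (s + m) + d ^ 2 * lam ^ 2 * m) := by gcongr
  have h7 : 0 ≤ Q * d ^ 2 * lam * s := by positivity
  have h8 : 0 ≤ Q * d ^ 2 * lam * m := by positivity
  have h9 : 0 ≤ Q * d * lam ^ 2 * m := by positivity
  have h10 : 0 ≤ lam * s + lam * m + lam ^ 2 * m := by positivity
  nlinarith

lemma rpow_inv_polydisc_le (hθ : 1 / 2 ≤ θ) {lam m : ℝ} (z w : CSp d)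
    (hl : 0 < lam) (hm : 1 ≤ m) (hw : ‖w‖ ≤ d * (lam * m ^ (1 - θ))) :
    ‖z + w‖ ^ (1 / θ) ≤ 4 * (‖z‖ ^ (1 / θ) + (d * lam) ^ (1 / θ) * m) := by
  have hθ0 : 0 < θ := by linarith
  refine (Real.rpow_le_rpow (norm_nonneg _) (norm_add_le _ _) (by positivity)).trans ?_
  refine (add_rpow_inv_le hθ (norm_nonneg _) (norm_nonneg _)).trans ?_
  have h1 : ‖w‖ ^ (1 / θ) ≤ (d * lam) ^ (1 / θ) * m := by
    calc ‖w‖ ^ (1 / θ) ≤ (d * lam * m ^ (1 - θ)) ^ (1 / θ) := by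
          refine Real.rpow_le_rpow (norm_nonneg _) (hw.trans (le_of_eq (by ring))) (by positivity)
      _ = (d * lam) ^ (1 / θ) * (m ^ (1 - θ)) ^ (1 / θ) :=
          Real.mul_rpow (by positivity) (by positivity)
      _ ≤ _ := by
          gcongr
          exact rpow_one_sub_rpow_inv_le hθ hm
  linarith

/-- Derivatives of entire functions of the growth of FBI transforms. -/
lemma exists_norm_mderiv_le (hθ : 1 / 2 ≤ θ) (hθ' : θ < 1) {ε : ℝ} (hε : 0 < ε) :
    ∃ κ > 0, ∃ K > 0, ∀ (F : CSp d → ℂ) (G : ℝ), ContDiff ℂ ∞ F →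
      (∀ z, ‖F z‖ ≤ G * Real.exp (κ * ‖z‖ ^ (1 / θ) + φ.weight z)) →
      ∀ (α : MIdx d) z, ‖mderiv ℂ α F z‖ ≤ G * ((α.fact : ℝ) ^ θ * K ^ (α.len + 1)) *
        Real.exp (ε * ‖z‖ ^ (1 / θ) + φ.weight z) := by
  obtain ⟨Q, hQ, H⟩ := φ.exists_weight_polydisc_le hθ hθ'
  -- The increment of $\Phi$ then uses $\frac\varepsilon2|z|^{1/\theta}$; the growth rate
  -- $\frac\varepsilon8$ of `F`, multiplied by the constant 4 of `rpow_inv_polydisc_le`, uses the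
  -- other half. `E` collects the multiples of $m$.
  set lam := ε / (2 * Q) with hlam
  have hl : 0 < lam := by positivity
  set E := ε / 2 * (d * lam) ^ (1 / θ) + (Q * lam + Q * lam ^ 2) with hE
  refine ⟨ε / 8, by positivity, max 1 lam⁻¹ * Real.exp E, by positivity, ?_⟩
  intro F G hF hFG α z
  have hG : 0 ≤ G := nonneg_of_mul_nonneg_left ((norm_nonneg _).trans (hFG 0)) (Real.exp_pos _)
  set m : ℝ := (α.len : ℝ) + 1 with hm
  have hm1 : 1 ≤ m := by rw [hm]; linarith [(α.len).cast_nonneg (α := ℝ)]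
  set s := ‖z‖ ^ (1 / θ) with hs
  have h1 : ‖mderiv ℂ α F z‖ ≤ (α.fact : ℝ) ^ θ * (lam⁻¹) ^ α.len *
      (G * Real.exp (ε * s + φ.weight z + E * m)) := by
    refine norm_mderiv_le_of_radius hθ' hl α hF z fun w hw => (hFG _).trans ?_
    have hw' := norm_le_of_coord_le hw
    have h2 := H lam m z w hl hm1 hw'
    have h3 := rpow_inv_polydisc_le hθ z w hl hm1 hw'
    refine mul_le_mul_of_nonneg_left (Real.exp_le_exp.2 ?_) hG
    have h4 : ε / 8 * ‖z + w‖ ^ (1 / θ) ≤ ε / 8 * (4 * (s + (d * lam) ^ (1 / θ) * m)) := by gcongr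
    have h5 : Q * lam = ε / 2 := by rw [hlam]; field_simp
    rw [hE]
    rw [h5] at h2 ⊢
    linarith
  refine h1.trans ?_
  have h2 := max_pow_mul_exp_le (E := E) hl α.len
  have h3 : 0 ≤ (α.fact : ℝ) ^ θ := by positivity
  calc _ = (G * (α.fact : ℝ) ^ θ * Real.exp (ε * s + φ.weight z)) *
        ((lam⁻¹) ^ α.len * Real.exp (E * m)) := by rw [Real.exp_add _ (E * m)]; ring
    _ ≤ (G * (α.fact : ℝ) ^ θ * Real.exp (ε * s + φ.weight z)) *
        (max 1 lam⁻¹ * Real.exp E) ^ (α.len + 1) := by gcongr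
    _ = _ := by ring

/-- Derivatives of entire functions which decay near a point. -/
lemma exists_norm_mderiv_le_of_decay (hθ : 1 / 2 ≤ θ) (hθ' : θ < 1) {ε c : ℝ} (hε : 0 < ε)
    (hc : 0 < c) (hc' : c ≤ 1 / 2) :
    ∃ ε' > 0, ∃ K > 0, ∀ (F : CSp d → ℂ) (G : ℝ), ContDiff ℂ ∞ F →
      (∀ z, ‖F z‖ ≤ G * Real.exp (1 * ‖z‖ ^ (1 / θ) + φ.weight z)) → ∀ z,
      (∀ w, ‖w‖ ≤ c * ‖z‖ →
        ‖F (z + w)‖ ≤ G * Real.exp (-ε * ‖z + w‖ ^ (1 / θ) + φ.weight (z + w))) →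
      ∀ α : MIdx d, ‖mderiv ℂ α F z‖ ≤ G * ((α.fact : ℝ) ^ θ * K ^ (α.len + 1)) *
        Real.exp (-ε' * ‖z‖ ^ (1 / θ) + φ.weight z) := by
  have hθ0 : 0 < θ := by linarith
  obtain ⟨Q, hQ, H⟩ := φ.exists_weight_polydisc_le hθ hθ'
  set lam := ε / (8 * Q) with hlam
  have hl : 0 < lam := by positivity
  have hQl : Q * lam = ε / 8 := by rw [hlam]; field_simp
  set η := (d * lam / c) ^ (1 / θ) with hη
  have hη0 : 0 ≤ η := by positivity
  set E₁ := ε / 8 + Q * lam ^ 2 with hE₁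
  -- When the polydisc is large, $4|z|^{1/\theta}$ comes from the growth of `F` and
  -- $\frac\varepsilon8|z|^{1/\theta}$ from $\Phi$; another $\frac\varepsilon8|z|^{1/\theta}$ is
  -- needed to create the claimed decay. This total is at most $(4+\frac\varepsilon4)\eta m$.
  set E := (4 + ε / 4) * η + 4 * (d * lam) ^ (1 / θ) + E₁ with hE
  refine ⟨ε / 8, by positivity, max 1 lam⁻¹ * Real.exp E, by positivity, ?_⟩
  intro F G hF hFG z hz α
  have hG : 0 ≤ G := nonneg_of_mul_nonneg_left ((norm_nonneg _).trans (hFG 0)) (Real.exp_pos _)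
  set m : ℝ := (α.len : ℝ) + 1 with hm
  have hm1 : 1 ≤ m := by rw [hm]; linarith [(α.len).cast_nonneg (α := ℝ)]
  set s := ‖z‖ ^ (1 / θ) with hs
  have hs0 : 0 ≤ s := by positivity
  have h1 : ‖mderiv ℂ α F z‖ ≤ (α.fact : ℝ) ^ θ * (lam⁻¹) ^ α.len *
      (G * Real.exp (-(ε / 8) * s + φ.weight z + E * m)) := by
    refine norm_mderiv_le_of_radius hθ' hl α hF z fun w hw => ?_
    have hw' := norm_le_of_coord_le hw
    have h2 := H lam m z w hl hm1 hw'
    rw [hQl] at h2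
    -- Either the polydisc stays in the region of decay, where $|z+w|\ge|z|/2$ keeps a quarter of
    -- the rate and the increment of $\Phi$ uses half of that quarter, or its size exceeds $c|z|$.
    by_cases hcase : d * (lam * m ^ (1 - θ)) ≤ c * ‖z‖
    · refine (hz w (hw'.trans hcase)).trans ?_
      refine mul_le_mul_of_nonneg_left (Real.exp_le_exp.2 ?_) hG
      have h3 : ‖z‖ / 2 ≤ ‖z + w‖ := by
        have h4 := norm_sub_le (z + w) w
        rw [add_sub_cancel_right] at h4
        have : c * ‖z‖ ≤ 1 / 2 * ‖z‖ := by gcongr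
        linarith [hw'.trans hcase]
      have h4 : s / 4 ≤ ‖z + w‖ ^ (1 / θ) := by
        have h7 : (1 / 4 : ℝ) ≤ (1 / 2 : ℝ) ^ (1 / θ) := by
          have : (1 / 4 : ℝ) = (1 / 2 : ℝ) ^ (2 : ℝ) := by norm_num
          rw [this]
          refine Real.rpow_le_rpow_of_exponent_ge (by norm_num) (by norm_num) ?_
          rw [div_le_iff₀ hθ0]; linarith
        calc s / 4 = 1 / 4 * s := by ring
          _ ≤ (1 / 2 : ℝ) ^ (1 / θ) * s := by gcongr
          _ = (1 / 2 * ‖z‖) ^ (1 / θ) := by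
            rw [hs, ← Real.mul_rpow (by norm_num) (norm_nonneg _)]
          _ ≤ _ := by
            refine Real.rpow_le_rpow (by positivity) ?_ (by positivity)
            linarith
      have h5 : ε * (s / 4) ≤ ε * ‖z + w‖ ^ (1 / θ) := by gcongr
      have h6 : E₁ * m ≤ E * m := by
        refine mul_le_mul_of_nonneg_right ?_ (by linarith)
        rw [hE]
        have : 0 ≤ (d * lam) ^ (1 / θ) := by positivity
        have : 0 ≤ (4 + ε / 4) * η := by positivity
        linarith
      rw [hE₁] at h6
      linarith
    · push Not at hcase
      refine (hFG _).trans ?_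
      refine mul_le_mul_of_nonneg_left (Real.exp_le_exp.2 ?_) hG
      have h3 := rpow_inv_polydisc_le hθ z w hl hm1 hw'
      have h4 : s ≤ η * m := by
        -- Here $|z|$ is controlled by the order of the derivative, so factors exponential in
        -- $|z|^{1/\theta}$ are at most geometric in $m$.
        have h5 : ‖z‖ ≤ d * lam / c * m ^ (1 - θ) := by
          rw [div_mul_eq_mul_div, le_div_iff₀ hc]; linarith
        calc s ≤ (d * lam / c * m ^ (1 - θ)) ^ (1 / θ) :=
              Real.rpow_le_rpow (norm_nonneg _) h5 (by positivity)
          _ = η * (m ^ (1 - θ)) ^ (1 / θ) := Real.mul_rpow (by positivity) (by positivity)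
          _ ≤ _ := by gcongr; exact rpow_one_sub_rpow_inv_le hθ hm1
      have h5 : (4 + ε / 4) * s ≤ (4 + ε / 4) * (η * m) := by gcongr
      rw [hE, hE₁]
      linarith
  refine h1.trans ?_
  have h2 := max_pow_mul_exp_le (E := E) hl α.len
  have h3 : 0 ≤ (α.fact : ℝ) ^ θ := by positivity
  calc _ = (G * (α.fact : ℝ) ^ θ * Real.exp (-(ε / 8) * s + φ.weight z)) *
        ((lam⁻¹) ^ α.len * Real.exp (E * m)) := by rw [Real.exp_add _ (E * m)]; ring
    _ ≤ (G * (α.fact : ℝ) ^ θ * Real.exp (-(ε / 8) * s + φ.weight z)) *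
        (max 1 lam⁻¹ * Real.exp E) ^ (α.len + 1) := by gcongr
    _ = _ := by ring

/-- Families of coefficients `h_α` of super-exponentially small size. -/
def CoeffBound (θ : ℝ) (h : MIdx d → CSp d → ℂ) : Prop :=
  ∀ ε > 0, ∃ D > 0, ∀ (α : MIdx d) z,
    ‖h α z‖ ≤ D * ε ^ α.len / (α.fact : ℝ) ^ θ * Real.exp (ε * ‖z‖ ^ (1 / θ))

/-- The weight $\alpha!^{-\theta}$ in the coefficients cancels the loss in Cauchy's estimates.
Taking their parameter at most $1/(2K)$ turns $K^{|\alpha|}$ into $2^{-|\alpha|}$, which is summable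
over $\alpha$. -/
lemma CoeffBound.exists_mul_le {h : MIdx d → CSp d → ℂ} (hh : CoeffBound θ h)
    {K ε : ℝ} (hK : 0 < K) (hε : 0 < ε) : ∃ K' > 0, ∀ (α : MIdx d) (z : CSp d) (x : ℂ) (G B : ℝ),
      ‖x‖ ≤ G * ((α.fact : ℝ) ^ θ * K ^ (α.len + 1)) * Real.exp (B * ‖z‖ ^ (1 / θ) + φ.weight z) →
      ‖h α z * x‖ ≤ G * K' * (1 / 2) ^ α.len *
        Real.exp ((B + ε) * ‖z‖ ^ (1 / θ) + φ.weight z) := by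
  set δ := min ε (1 / (2 * K)) with hδ
  have hδ0 : 0 < δ := lt_min hε (by positivity)
  have hδK : δ * K ≤ 1 / 2 := by
    calc δ * K ≤ 1 / (2 * K) * K := by gcongr; exact min_le_right _ _
      _ = 1 / 2 := by field_simp
  obtain ⟨D, hD, H⟩ := hh δ hδ0
  refine ⟨D * K, by positivity, fun α z x G B hx => ?_⟩
  have hF : 0 < (α.fact : ℝ) ^ θ := Real.rpow_pos_of_pos (MIdx.fact_pos α) _
  set s := ‖z‖ ^ (1 / θ)
  have hs0 : 0 ≤ s := by positivity
  have hG : 0 ≤ G := by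
    have := (norm_nonneg _).trans hx
    rw [mul_assoc] at this
    exact nonneg_of_mul_nonneg_left this (by positivity)
  have h1 : Real.exp (δ * s) ≤ Real.exp (ε * s) := by
    rw [Real.exp_le_exp]; gcongr; exact min_le_left _ _
  rw [norm_mul]
  calc ‖h α z‖ * ‖x‖ ≤ (D * δ ^ α.len / (α.fact : ℝ) ^ θ * Real.exp (ε * s)) *
        (G * ((α.fact : ℝ) ^ θ * K ^ (α.len + 1)) * Real.exp (B * s + φ.weight z)) := by
        refine mul_le_mul ((H α z).trans ?_) hx (norm_nonneg _) (by positivity)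
        gcongr
    _ = G * (D * K) * (δ * K) ^ α.len * Real.exp ((B + ε) * s + φ.weight z) := by
        have : (B + ε) * s + φ.weight z = ε * s + (B * s + φ.weight z) := by ring
        rw [this, Real.exp_add (ε * s), mul_pow]
        field_simp
        ring
    _ ≤ _ := by gcongr

lemma CoeffBound.exists_norm_le (hθ : 1 / 2 ≤ θ) (hθ' : θ < 1) {h : MIdx d → CSp d → ℂ}
    (hh : CoeffBound θ h) {ε : ℝ} (hε : 0 < ε) :
    ∃ κ > 0, ∃ K > 0, ∀ (F : CSp d → ℂ) (G : ℝ), ContDiff ℂ ∞ F →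
      (∀ z, ‖F z‖ ≤ G * Real.exp (κ * ‖z‖ ^ (1 / θ) + φ.weight z)) →
      ∀ (α : MIdx d) z, ‖h α z * mderiv ℂ α F z‖ ≤ G * K * (1 / 2) ^ α.len *
        Real.exp (ε * ‖z‖ ^ (1 / θ) + φ.weight z) := by
  obtain ⟨κ, hκ, K, hK, H⟩ := φ.exists_norm_mderiv_le hθ hθ' (half_pos hε)
  obtain ⟨K', hK', H'⟩ := hh.exists_mul_le φ hK (half_pos hε)
  refine ⟨κ, hκ, K', hK', fun F G hF hFG α z => ?_⟩
  have := H' α z _ _ _ (H F G hF hFG α z)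
  rwa [add_halves] at this

lemma CoeffBound.exists_norm_le_of_decay (hθ : 1 / 2 ≤ θ) (hθ' : θ < 1) {h : MIdx d → CSp d → ℂ}
    (hh : CoeffBound θ h) {ε c : ℝ} (hε : 0 < ε) (hc : 0 < c) (hc' : c ≤ 1 / 2) :
    ∃ ε' > 0, ∃ K > 0, ∀ (F : CSp d → ℂ) (G : ℝ), ContDiff ℂ ∞ F →
      (∀ z, ‖F z‖ ≤ G * Real.exp (1 * ‖z‖ ^ (1 / θ) + φ.weight z)) → ∀ z,
      (∀ w, ‖w‖ ≤ c * ‖z‖ →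
        ‖F (z + w)‖ ≤ G * Real.exp (-ε * ‖z + w‖ ^ (1 / θ) + φ.weight (z + w))) →
      ∀ α : MIdx d, ‖h α z * mderiv ℂ α F z‖ ≤ G * K * (1 / 2) ^ α.len *
        Real.exp (-ε' * ‖z‖ ^ (1 / θ) + φ.weight z) := by
  obtain ⟨ε', hε', K, hK, H⟩ := φ.exists_norm_mderiv_le_of_decay hθ hθ' hε hc hc'
  obtain ⟨K', hK', H'⟩ := hh.exists_mul_le φ hK (half_pos hε')
  refine ⟨ε' / 2, by positivity, K', hK', fun F G hF hFG z hz α => ?_⟩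
  have := H' α z _ _ _ (H F G hF hFG z hz α)
  have e : -ε' + ε' / 2 = -(ε' / 2) := by ring
  rwa [e] at this

/-! ### Conic neighbourhoods -/

/-- `L'` is the cone over a ball of half the radius of one contained in `L`. Points are scaled into
that ball, where a relative displacement by `c` moves them by at most $\rho/2$. -/
lemma IsConicNhd.exists_shrink {L : Set (CSp d)} {z₀ : CSp d} (h : IsConicNhd L z₀) :
    ∃ L', IsConicNhd L' z₀ ∧ ∃ c > 0, c ≤ 1 / 2 ∧ ∀ z ∈ L', ∀ w, ‖w‖ ≤ c * ‖z‖ → z + w ∈ L := by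
  obtain ⟨hL, hz₀, h0, hcone⟩ := h
  obtain ⟨ρ, hρ, hball⟩ := Metric.isOpen_iff.1 hL z₀ hz₀
  set L' : Set (CSp d) := {z | ∃ t : ℝ, 0 < t ∧ t • z ∈ Metric.ball z₀ (ρ / 2)} with hL'
  have hopen : IsOpen L' := by
    have : L' = ⋃ t : Set.Ioi (0 : ℝ), (fun z : CSp d => (t : ℝ) • z) ⁻¹' Metric.ball z₀ (ρ / 2) := by
      ext z; simp [hL']
    rw [this]
    exact isOpen_iUnion fun t => Metric.isOpen_ball.preimage (continuous_const_smul _)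
  refine ⟨L', ⟨hopen, ⟨1, one_pos, by simpa using half_pos hρ⟩, ?_, ?_⟩,
    min (1 / 2) (ρ / 2 / (‖z₀‖ + ρ)), by positivity, min_le_left _ _, ?_⟩
  · rintro ⟨t, ht, hmem⟩
    rw [smul_zero] at hmem
    exact h0 (hball (Metric.ball_subset_ball (by linarith) hmem))
  · rintro z ⟨t, ht, hmem⟩ r hr
    refine ⟨t / r, by positivity, ?_⟩
    rwa [smul_smul, div_mul_cancel₀ _ hr.ne']
  · rintro z ⟨t, ht, hmem⟩ w hw
    have h1 : t • (z + w) ∈ L := by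
      refine hball ?_
      rw [mem_ball_iff_norm] at hmem ⊢
      have h2 : ‖t • z‖ ≤ ‖z₀‖ + ρ := by
        have := norm_add_le (t • z - z₀) z₀
        rw [sub_add_cancel] at this
        linarith
      have h3 : ‖t • w‖ ≤ ρ / 2 := by
        rw [norm_smul, Real.norm_of_nonneg ht.le]
        rw [norm_smul, Real.norm_of_nonneg ht.le] at h2
        calc t * ‖w‖ ≤ t * (ρ / 2 / (‖z₀‖ + ρ) * ‖z‖) := by
              gcongr
              refine hw.trans ?_
              gcongr
              exact min_le_right _ _
          _ = ρ / 2 / (‖z₀‖ + ρ) * (t * ‖z‖) := by ring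
          _ ≤ ρ / 2 / (‖z₀‖ + ρ) * (‖z₀‖ + ρ) := by gcongr
          _ = ρ / 2 := by
            have : ‖z₀‖ + ρ ≠ 0 := by positivity
            field_simp
      have e : t • (z + w) - z₀ = (t • z - z₀) + t • w := by rw [smul_add]; abel
      rw [e]
      exact (norm_add_le _ _).trans_lt (by linarith)
    have := hcone _ h1 t⁻¹ (by positivity)
    rwa [smul_smul, inv_mul_cancel₀ ht.ne', one_smul] at this

lemma IsConicNhd.inter {L L' : Set (CSp d)} {z₀ : CSp d} (h : IsConicNhd L z₀)
    (h' : IsConicNhd L' z₀) : IsConicNhd (L ∩ L') z₀ :=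
  ⟨h.1.inter h'.1, ⟨h.2.1, h'.2.1⟩, fun h0 => h.2.2.1 h0.1,
    fun z hz t ht => ⟨h.2.2.2 z hz.1 t ht, h'.2.2.2 z hz.2 t ht⟩⟩

/-- Microlocal decay of `T_φ u` near `z₀`. -/
def DecaysNear (u : GSDual d θ) (z₀ : CSp d) : Prop :=
  ∃ L, IsConicNhd L z₀ ∧ ∃ ε > 0, ∃ K > 0, φ.DecaysOn u L K ε

lemma DecaysNear.of_le {u v w : GSDual d θ} {z₀ : CSp d} {a b : ℝ}
    (hv : φ.DecaysNear v z₀) (hw : φ.DecaysNear w z₀)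
    (h : ∀ z, ‖φ.fbi u z‖ ≤ a * ‖φ.fbi v z‖ + b * ‖φ.fbi w z‖) (ha : 0 ≤ a) (hb : 0 ≤ b) :
    φ.DecaysNear u z₀ := by
  obtain ⟨L, hL, ε, hε, K, hK, H⟩ := hv
  obtain ⟨L', hL', ε', hε', K', hK', H'⟩ := hw
  refine ⟨L ∩ L', hL.inter hL', min ε ε', lt_min hε hε', a * K + b * K' + 1, by positivity,
    fun z hz => (h z).trans ?_⟩
  set s := ‖z‖ ^ (1 / θ)
  have hs : 0 ≤ s := by positivity
  have h1 : Real.exp (-ε * s + φ.weight z) ≤ Real.exp (-min ε ε' * s + φ.weight z) := by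
    rw [Real.exp_le_exp]
    have := mul_le_mul_of_nonneg_right (min_le_left ε ε') hs
    linarith
  have h2 : Real.exp (-ε' * s + φ.weight z) ≤ Real.exp (-min ε ε' * s + φ.weight z) := by
    rw [Real.exp_le_exp]
    have := mul_le_mul_of_nonneg_right (min_le_right ε ε') hs
    linarith
  set X := Real.exp (-min ε ε' * s + φ.weight z)
  have hX : 0 < X := Real.exp_pos _
  calc _ ≤ a * (K * X) + b * (K' * X) := by
        refine add_le_add (mul_le_mul_of_nonneg_left ((H z hz.1).trans ?_) ha)
          (mul_le_mul_of_nonneg_left ((H' z hz.2).trans ?_) hb)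
        · exact mul_le_mul_of_nonneg_left h1 hK.le
        · exact mul_le_mul_of_nonneg_left h2 hK'.le
    _ ≤ _ := by linarith

end FBIPhase

/-! ### Integrals of Gelfand–Shilov functions depending on a parameter -/

section Param

variable {d : ℕ} {θ : ℝ} {X : Type*} [MeasurableSpace X] {μ : Measure X} {m : X → ℝ}

/-- Families of smooth functions whose derivatives are dominated by multiples of `m`. -/
structure DomFamily (μ : Measure X) (m : X → ℝ) (F : X → RSp d → ℂ) : Prop where
  smooth : ∀ x, ContDiff ℝ ∞ (F x)
  meas : ∀ y, AEStronglyMeasurable (fun x => F x y) μ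
  bound : ∀ β, ∃ c, ∀ x y, ‖mderiv ℝ β (F x) y‖ ≤ c * m x

lemma fderiv_eq_sum_pderiv (f : RSp d → ℂ) (y v : RSp d) :
    fderiv ℝ f y v = ∑ j, (v j : ℂ) * pderiv ℝ j f y := by
  have hv : v = ∑ j, v j • EuclideanSpace.single j (1 : ℝ) := by
    ext i
    simp [Finset.sum_apply, Pi.single_apply]
  conv_lhs => rw [hv]
  simp [pderiv]

/-- Coordinates, as maps into the complex-valued forms. -/
noncomputable def coordForm (j : Fin d) (c : ℂ) : RSp d →L[ℝ] ℂ :=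
  (EuclideanSpace.proj j : RSp d →L[ℝ] ℝ).smulRight c

lemma fderiv_eq_sum_coordForm (f : RSp d → ℂ) (y : RSp d) :
    fderiv ℝ f y = ∑ j, coordForm j (pderiv ℝ j f y) := by
  ext v
  rw [fderiv_eq_sum_pderiv]
  simp [coordForm]

lemma norm_coordForm_le (j : Fin d) (c : ℂ) : ‖coordForm j c‖ ≤ ‖c‖ := by
  refine ContinuousLinearMap.opNorm_le_bound _ (norm_nonneg _) fun v => ?_
  rw [coordForm, ContinuousLinearMap.smulRight_apply, norm_smul, mul_comm]
  exact mul_le_mul_of_nonneg_left (PiLp.norm_apply_le v j) (norm_nonneg _)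

lemma continuous_coordForm (j : Fin d) : Continuous (coordForm (d := d) j) :=
  (ContinuousLinearMap.smulRightL ℝ (RSp d) ℂ (EuclideanSpace.proj j)).continuous

namespace DomFamily

variable {F : X → RSp d → ℂ}

lemma pderiv (h : DomFamily μ m F) (j : Fin d) : DomFamily μ m fun x => pderiv ℝ j (F x) where
  smooth x := contDiff_pderiv j (h.smooth x)
  meas y := by
    -- Measurability in the parameter survives differentiation because the derivative is a pointwise
    -- limit of difference quotients.
    have hlim : ∀ x, Tendsto (fun n : ℕ => ((n : ℝ) + 1) •
        (F x (y + ((n : ℝ) + 1)⁻¹ • EuclideanSpace.single j 1) - F x y)) atTop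
        (𝓝 (_root_.pderiv ℝ j (F x) y)) := by
      intro x
      have hd : HasFDerivAt (F x) (fderiv ℝ (F x) y) y :=
        ((h.smooth x).differentiable (by simp) y).hasFDerivAt
      have hc : Tendsto (fun n : ℕ => ‖((n : ℝ) + 1)‖) atTop atTop :=
        tendsto_norm_atTop_atTop.comp
          (tendsto_atTop_add_const_right _ _ tendsto_natCast_atTop_atTop)
      exact hd.lim _ hc
    refine aestronglyMeasurable_of_tendsto_ae atTop (fun n => ?_)
      (Eventually.of_forall fun x => hlim x)
    exact ((h.meas _).sub (h.meas _)).const_smul ((n : ℝ) + 1)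
  bound β := by
    obtain ⟨c, hc⟩ := h.bound (β + Pi.single j 1)
    refine ⟨c, fun x y => ?_⟩
    rw [mderiv_pderiv β j (h.smooth x)]
    exact hc x y

lemma integrable (h : DomFamily μ m F) (hm : Integrable m μ) (y : RSp d) :
    Integrable (fun x => F x y) μ := by
  obtain ⟨c, hc⟩ := h.bound 0
  refine (hm.const_mul c).mono' (h.meas y) (Eventually.of_forall fun x => ?_)
  have := hc x y
  rwa [mderiv_zero_idx] at this

lemma aestronglyMeasurable_fderiv (h : DomFamily μ m F) (y : RSp d) :
    AEStronglyMeasurable (fun x => fderiv ℝ (F x) y) μ := by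
  simp only [fderiv_eq_sum_coordForm]
  refine Finset.aestronglyMeasurable_fun_sum _ fun j _ => ?_
  exact (continuous_coordForm j).comp_aestronglyMeasurable ((h.pderiv j).meas y)

lemma exists_norm_fderiv_le (h : DomFamily μ m F) :
    ∃ c, ∀ x y, ‖fderiv ℝ (F x) y‖ ≤ c * m x := by
  have hb : ∀ j, ∃ c, ∀ x y, ‖_root_.pderiv ℝ j (F x) y‖ ≤ c * m x := by
    intro j
    obtain ⟨c, hc⟩ := (h.pderiv j).bound 0
    refine ⟨c, fun x y => ?_⟩
    have := hc x y
    rwa [mderiv_zero_idx] at this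
  choose c hc using hb
  refine ⟨∑ j, c j, fun x y => ?_⟩
  rw [fderiv_eq_sum_coordForm, Finset.sum_mul]
  refine (norm_sum_le _ _).trans (Finset.sum_le_sum fun j _ => ?_)
  exact (norm_coordForm_le _ _).trans (hc j x y)

lemma hasFDerivAt (h : DomFamily μ m F) (hm : Integrable m μ) (y : RSp d) :
    HasFDerivAt (fun y => ∫ x, F x y ∂μ) (∫ x, fderiv ℝ (F x) y ∂μ) y := by
  obtain ⟨c, hc⟩ := h.exists_norm_fderiv_le
  exact hasFDerivAt_integral_of_dominated_of_fderiv_le (bound := fun x => c * m x)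
    (s := Set.univ) Filter.univ_mem (Eventually.of_forall fun y => h.meas y)
    (h.integrable hm y) (h.aestronglyMeasurable_fderiv y)
    (Eventually.of_forall fun x y _ => hc x y) (hm.const_mul _)
    (Eventually.of_forall fun x y _ => ((h.smooth x).differentiable (by simp) y).hasFDerivAt)

lemma integrable_fderiv (h : DomFamily μ m F) (hm : Integrable m μ) (y : RSp d) :
    Integrable (fun x => fderiv ℝ (F x) y) μ := by
  obtain ⟨c, hc⟩ := h.exists_norm_fderiv_le
  exact (hm.const_mul c).mono' (h.aestronglyMeasurable_fderiv y)
    (Eventually.of_forall fun x => hc x y)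

lemma pderiv_integral (h : DomFamily μ m F) (hm : Integrable m μ) (j : Fin d) :
    _root_.pderiv ℝ j (fun y => ∫ x, F x y ∂μ) = fun y => ∫ x, _root_.pderiv ℝ j (F x) y ∂μ := by
  ext y
  unfold _root_.pderiv
  rw [(h.hasFDerivAt hm y).fderiv, ContinuousLinearMap.integral_apply (h.integrable_fderiv hm y)]

/-- Differentiation under the integral sign gives the integral of another `DomFamily` with the same
majorant, so the argument repeats. -/
lemma contDiff_integral (h : DomFamily μ m F) (hm : Integrable m μ) :
    ContDiff ℝ ∞ (fun y => ∫ x, F x y ∂μ) := by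
  rw [contDiff_infty]
  intro n
  induction n generalizing F with
  | zero =>
    have hd : Differentiable ℝ (fun y => ∫ x, F x y ∂μ) :=
      fun y => (h.hasFDerivAt hm y).differentiableAt
    exact contDiff_zero.2 hd.continuous
  | succ n ih =>
    push_cast
    rw [contDiff_succ_iff_fderiv_apply]
    refine ⟨fun y => (h.hasFDerivAt hm y).differentiableAt, by simp, fun v => ?_⟩
    simp only [fderiv_eq_sum_pderiv]
    refine ContDiff.sum fun j _ => contDiff_const.mul ?_
    rw [h.pderiv_integral hm j]
    exact ih (h.pderiv j)

lemma iterate_pderiv (h : DomFamily μ m F) (hm : Integrable m μ) (j : Fin d) (n : ℕ) :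
    DomFamily μ m (fun x => (_root_.pderiv ℝ j)^[n] (F x)) ∧
    (_root_.pderiv ℝ j)^[n] (fun y => ∫ x, F x y ∂μ) =
      fun y => ∫ x, (_root_.pderiv ℝ j)^[n] (F x) y ∂μ := by
  induction n with
  | zero => exact ⟨h, rfl⟩
  | succ n ih =>
    simp only [Function.iterate_succ_apply', ih.2]
    exact ⟨ih.1.pderiv j, ih.1.pderiv_integral hm j⟩

lemma mderiv_integral (h : DomFamily μ m F) (hm : Integrable m μ) (β : MIdx d) :
    mderiv ℝ β (fun y => ∫ x, F x y ∂μ) = fun y => ∫ x, mderiv ℝ β (F x) y ∂μ := by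
  unfold mderiv
  suffices H : ∀ l : List (Fin d),
      DomFamily μ m (fun x => l.foldr (fun i f => (_root_.pderiv ℝ i)^[β i] f) (F x)) ∧
      l.foldr (fun i f => (_root_.pderiv ℝ i)^[β i] f) (fun y => ∫ x, F x y ∂μ) =
        fun y => ∫ x, l.foldr (fun i f => (_root_.pderiv ℝ i)^[β i] f) (F x) y ∂μ from
    (H _).2
  intro l
  induction l with
  | nil => exact ⟨h, rfl⟩
  | cons i l ih =>
    simp only [List.foldr_cons, ih.2]
    exact ih.1.iterate_pderiv hm i (β i)

end DomFamily

lemma DomFamily.of_gsBound {C : ℝ} {F : X → RSp d → ℂ} (hs : ∀ x, ContDiff ℝ ∞ (F x))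
    (hm : ∀ y, AEStronglyMeasurable (fun x => F x y) μ) (hF : ∀ x, GSBound θ C (m x) (F x)) :
    DomFamily μ m F where
  smooth := hs
  meas := hm
  bound β := by
    refine ⟨C ^ β.len * (β.fact : ℝ) ^ θ, fun x y => ?_⟩
    have := hF x 0 β y
    simp only [Pi.zero_apply, pow_zero, Finset.prod_const_one, abs_one, one_mul] at this
    refine this.trans (le_of_eq ?_)
    simp [MIdx.len, MIdx.fact]
    ring

/-- For fixed $\alpha,\beta,y$ the seminorm bound is the triangle inequality for integrals; the
scale `C` is not enlarged. -/
lemma GSBound.integral {C : ℝ} {F : X → RSp d → ℂ} (hs : ∀ x, ContDiff ℝ ∞ (F x))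
    (hmeas : ∀ y, AEStronglyMeasurable (fun x => F x y) μ) (hm : Integrable m μ)
    (hF : ∀ x, GSBound θ C (m x) (F x)) :
    ContDiff ℝ ∞ (fun y => ∫ x, F x y ∂μ) ∧
      GSBound θ C (∫ x, m x ∂μ) (fun y => ∫ x, F x y ∂μ) := by
  have h := DomFamily.of_gsBound hs hmeas hF
  refine ⟨h.contDiff_integral hm, fun α β y => ?_⟩
  rw [h.mderiv_integral hm β, ← integral_mul_const]
  refine (le_of_eq ?_).trans (norm_integral_le_of_norm_le
    (f := fun x => ((|∏ i, y i ^ α i| : ℝ) : ℂ) * mderiv ℝ β (F x) y)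
    (hm.mul_const (C ^ (α.len + β.len) * (α.fact : ℝ) ^ θ * (β.fact : ℝ) ^ θ))
    (Eventually.of_forall fun x => ?_))
  · rw [integral_const_mul, norm_mul, Complex.norm_real, Real.norm_eq_abs, abs_abs]
  · rw [norm_mul, Complex.norm_real, Real.norm_eq_abs, abs_abs]
    exact hF x α β y

end Param

/-! ### Uniform boundedness -/

section UniformBound

variable {d : ℕ} {θ C : ℝ}

lemma integrable_norm_lp_one (a : lp (fun _ : ℕ => ℂ) 1) :
    Integrable (fun k => ‖a k‖) (Measure.count : Measure ℕ) := by
  have hsum : Summable fun k => ‖a k‖ := by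
    simpa using (lp.memℓp a).summable (by simp)
  exact integrable_count_iff.2 (by simpa using hsum)

lemma GSBound.integrable_smul_seq {f : ℕ → RSp d → ℂ} (hs : ∀ k, ContDiff ℝ ∞ (f k))
    (hf : ∀ k, GSBound θ C 1 (f k)) (a : lp (fun _ : ℕ => ℂ) 1) (y : RSp d) :
    Integrable (fun k => a k * f k y) (Measure.count : Measure ℕ) :=
  (DomFamily.of_gsBound (θ := θ) (C := C) (m := fun k => ‖a k‖) (F := fun k y => a k * f k y)
    (fun k => contDiff_const.mul (hs k))
    (fun y => (measurable_of_countable _).aestronglyMeasurable)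
    (fun k => by rw [← mul_one ‖a k‖]; exact (hf k).smul (hs k) (a k))).integrable
    (integrable_norm_lp_one a) y

/-- A series is an integral for the counting measure, so the results on parameter integrals apply.
The bound by the $\ell^1$ norm makes `GS.sumMap` continuous at the scale `C`. -/
lemma GSBound.integral_smul_seq {f : ℕ → RSp d → ℂ} (hs : ∀ k, ContDiff ℝ ∞ (f k))
    (hf : ∀ k, GSBound θ C 1 (f k)) (a : lp (fun _ : ℕ => ℂ) 1) :
    ContDiff ℝ ∞ (fun y => ∫ k, a k * f k y ∂Measure.count) ∧
      GSBound θ C ‖a‖ (fun y => ∫ k, a k * f k y ∂Measure.count) := by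
  have hint := integrable_norm_lp_one a
  have h := GSBound.integral (μ := (Measure.count : Measure ℕ)) (m := fun k => ‖a k‖)
    (F := fun k y => a k * f k y) (θ := θ) (C := C) (fun k => contDiff_const.mul (hs k))
    (fun y => (measurable_of_countable _).aestronglyMeasurable) hint
    (fun k => by rw [← mul_one ‖a k‖]; exact (hf k).smul (hs k) (a k))
  refine ⟨h.1, ?_⟩
  have e : ‖a‖ = ∫ k, ‖a k‖ ∂(Measure.count : Measure ℕ) := by
    rw [lp.norm_eq_tsum_rpow (by simp), integral_countable hint]
    simp
  rw [e]
  exact h.2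

/-- The map `a ↦ Σ a_k f_k` from `ℓ¹` to `S_θ`. -/
noncomputable def GS.sumMap (f : ℕ → GS d θ) (hC : 0 < C) (hf : ∀ k, GSBound θ C 1 (f k : RSp d → ℂ)) :
    lp (fun _ : ℕ => ℂ) 1 →ₗ[ℂ] GS d θ where
  toFun a := ⟨fun y => ∫ k, a k * (f k : RSp d → ℂ) y ∂Measure.count,
    (GSBound.integral_smul_seq (fun k => (f k).2.1) hf a).1, C, hC, ‖a‖,
    (GSBound.integral_smul_seq (fun k => (f k).2.1) hf a).2⟩
  map_add' a b := by
    ext y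
    have ha := GSBound.integrable_smul_seq (fun k => (f k).2.1) hf a y
    have hb := GSBound.integrable_smul_seq (fun k => (f k).2.1) hf b y
    simp [add_mul, integral_add ha hb]
  map_smul' c a := by
    ext y
    simp [mul_assoc, integral_const_mul]

/-- The uniform boundedness principle in `S'_θ`. -/
theorem GSDual.exists_forall_norm_le (hC : 0 < C) {w : ℕ → GSDual d θ}
    (hw : ∀ f : GS d θ, ∃ K, ∀ n, ‖(w n : GS d θ →ₗ[ℂ] ℂ) f‖ ≤ K) :
    ∃ G, ∀ n (f : GS d θ) M, GSBound θ C M (f : RSp d → ℂ) →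
      ‖(w n : GS d θ →ₗ[ℂ] ℂ) f‖ ≤ G * M := by
  by_contra! hcon
  have key : ∀ k : ℕ, ∃ n, ∃ f : GS d θ, GSBound θ C 1 (f : RSp d → ℂ) ∧
      (k : ℝ) < ‖(w n : GS d θ →ₗ[ℂ] ℂ) f‖ := by
    intro k
    obtain ⟨n, f, M, hf, hlt⟩ := hcon k
    -- If $M=0$, the bound of the single functional `w n` forces its value at `f` to vanish,
    -- contrary to the choice of `f`. Hence `f` can be normalized.
    have hM : 0 < M := by
      refine hf.nonneg.lt_of_ne fun h0 => ?_
      obtain ⟨K, hK⟩ := (w n).2 C hC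
      have := hK f M hf
      rw [← h0, mul_zero] at this hlt
      linarith
    refine ⟨n, ((M⁻¹ : ℝ) : ℂ) • f, ?_, ?_⟩
    · have := hf.smul f.2.1 ((M⁻¹ : ℝ) : ℂ)
      rw [Complex.norm_real, Real.norm_of_nonneg (inv_nonneg.2 hM.le), inv_mul_cancel₀ hM.ne'] at this
      exact this
    · rw [map_smul, norm_smul, Complex.norm_real, Real.norm_of_nonneg (inv_nonneg.2 hM.le),
        inv_mul_eq_div, lt_div_iff₀ hM]
      exact hlt
  choose n f hf hlt using key
  have hex : ∀ j, ∃ K, ∀ (f : GS d θ) (M : ℝ), GSBound θ C M (f : RSp d → ℂ) →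
      ‖(w j : GS d θ →ₗ[ℂ] ℂ) f‖ ≤ K * M := fun j => (w j).2 C hC
  choose K hK using hex
  -- The functionals are pulled back to the Banach space $\ell^1$ along $a\mapsto\sum a_kf_k$, where
  -- Banach–Steinhaus applies. Testing on unit vectors contradicts the choice of the `f k`.
  set Ψ : ℕ → (lp (fun _ : ℕ => ℂ) 1 →L[ℂ] ℂ) := fun j =>
    LinearMap.mkContinuous ((w j : GS d θ →ₗ[ℂ] ℂ) ∘ₗ GS.sumMap f hC hf) (K j) fun a =>
      hK j _ _ (GSBound.integral_smul_seq (fun k => (f k).2.1) hf a).2 with hΨ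
  obtain ⟨K', hK'⟩ := banach_steinhaus (g := Ψ) fun a => hw (GS.sumMap f hC hf a)
  obtain ⟨k, hk⟩ := exists_nat_gt K'
  have h1 : Ψ (n k) (lp.single 1 k (1 : ℂ) : lp (fun _ : ℕ => ℂ) 1) = (w (n k) : GS d θ →ₗ[ℂ] ℂ) (f k) := by
    change (w (n k) : GS d θ →ₗ[ℂ] ℂ) (GS.sumMap f hC hf _) = _
    congr 1
    ext y
    have hint := GSBound.integrable_smul_seq (fun k => (f k).2.1) hf (lp.single 1 k (1 : ℂ)) y
    change ∫ j, (lp.single 1 k (1 : ℂ) : lp (fun _ : ℕ => ℂ) 1) j * (f j : RSp d → ℂ) y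
      ∂Measure.count = _
    rw [integral_countable hint, tsum_eq_single k fun j hj => by simp [hj]]
    simp
  have h2 := (Ψ (n k)).le_opNorm (lp.single 1 k (1 : ℂ) : lp (fun _ : ℕ => ℂ) 1)
  rw [h1, lp.norm_single (by simp), norm_one, mul_one] at h2
  linarith [hlt k, hK' (n k)]

end UniformBound

namespace FBIPhase

variable {d : ℕ} (φ : FBIPhase d) {θ : ℝ}

/-! ### Derivatives of FBI transforms as functionals of the distribution -/

/-- Operators from ultradistributions to entire functions generated by the FBI transform. -/
inductive IsFBIOp : (GSDual d θ → CSp d → ℂ) → Prop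
  | base (q : CSp d → ℂ) (hq : ContDiff ℂ ∞ q) (P : Module.End ℂ (GSDual d θ))
      (P' : GS d θ → GS d θ)
      (hP : ∀ u f, (P u : GS d θ →ₗ[ℂ] ℂ) f = (u : GS d θ →ₗ[ℂ] ℂ) (P' f)) :
      IsFBIOp fun u z => q z * φ.fbi (P u) z
  | add {F G : GSDual d θ → CSp d → ℂ} (hF : IsFBIOp F) (hG : IsFBIOp G) :
      IsFBIOp fun u z => F u z + G u z

namespace IsFBIOp

variable {φ} {F : GSDual d θ → CSp d → ℂ}

lemma fbi (φ : FBIPhase d) : IsFBIOp (θ := θ) φ φ.fbi := by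
  have := IsFBIOp.base (φ := φ) (θ := θ) (fun _ => 1) contDiff_const LinearMap.id id
    (fun _ _ => rfl)
  simpa using this

lemma sum {ι : Type*} (s : Finset ι) {F : ι → GSDual d θ → CSp d → ℂ}
    (h : ∀ i, IsFBIOp φ (F i)) : IsFBIOp φ fun u z => ∑ i ∈ s, F i u z := by
  classical
  induction s using Finset.induction_on with
  | empty =>
    simpa using IsFBIOp.base (φ := φ) (θ := θ) (fun _ => 0) contDiff_const LinearMap.id id
      (fun _ _ => rfl)
  | insert i s hi ih =>
    simp only [Finset.sum_insert hi]
    exact (h i).add ih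

lemma contDiff (hθ : 1 / 2 ≤ θ) (hθ' : θ < 1) (h : IsFBIOp φ F) (u : GSDual d θ) :
    ContDiff ℂ ∞ (F u) := by
  induction h with
  | base q hq P P' hP => exact hq.mul (φ.contDiff_fbi hθ hθ' _)
  | add hF hG ihF ihG => exact ihF.add ihG

lemma map_add (hθ : 1 / 2 ≤ θ) (hθ' : θ < 1) (h : IsFBIOp φ F) (u v : GSDual d θ) (z : CSp d) :
    F (u + v) z = F u z + F v z := by
  induction h with
  | base q hq P P' hP =>
    simp only [_root_.map_add, φ.fbi_add hθ hθ', Pi.add_apply, mul_add]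
  | add hF hG ihF ihG => simp only [ihF, ihG]; ring

lemma map_smul (hθ : 1 / 2 ≤ θ) (hθ' : θ < 1) (h : IsFBIOp φ F) (c : ℂ) (u : GSDual d θ)
    (z : CSp d) : F (c • u) z = c * F u z := by
  induction h with
  | base q hq P P' hP =>
    simp only [_root_.map_smul, φ.fbi_smul hθ hθ', Pi.smul_apply, smul_eq_mul, mul_left_comm]
  | add hF hG ihF ihG => simp only [ihF, ihG]; ring

/-- The transpose `P'` in `IsFBIOp.base` serves here: at fixed $z$ such an operator evaluates `u` at
finitely many fixed test functions, so weak convergence gives pointwise convergence. -/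
lemma tendsto (hθ : 1 / 2 ≤ θ) (hθ' : θ < 1) (h : IsFBIOp φ F) {w : ℕ → GSDual d θ}
    (hw : ∀ f, Tendsto (fun n => (w n : GS d θ →ₗ[ℂ] ℂ) f) atTop (𝓝 0)) (z : CSp d) :
    Tendsto (fun n => F (w n) z) atTop (𝓝 0) := by
  induction h with
  | base q hq P P' hP =>
    have h1 := ((hw (P' (φ.ker hθ hθ' z))).const_mul (φ.const : ℂ)).const_mul (q z)
    rw [mul_zero, mul_zero] at h1
    simpa only [φ.fbi_eq hθ hθ', hP] using h1
  | add hF hG ihF ihG => simpa using ihF.add ihG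

/-- By the product rule and `pderiv_fbi`, a derivative only changes the polynomial-type factor and
composes `P` with `GSDual.mulX k`, whose transpose is `GS.mulX k`. -/
lemma pderiv (hθ : 1 / 2 ≤ θ) (hθ' : θ < 1) (h : IsFBIOp φ F) (l : Fin d) :
    IsFBIOp φ fun u => _root_.pderiv ℂ l (F u) := by
  induction h with
  | base q hq P P' hP =>
    have e : (fun u => _root_.pderiv ℂ l (fun z => q z * φ.fbi (P u) z)) = fun u z =>
        (_root_.pderiv ℂ l q z + q z * (Complex.I * cop φ.A z l)) * φ.fbi (P u) z +
          ∑ k, (q z * (Complex.I * φ.B k l)) * φ.fbi ((GSDual.mulX k * P : Module.End ℂ (GSDual d θ)) u) z := by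
      funext u z
      have hd : Differentiable ℂ (φ.fbi (P u)) :=
        (φ.contDiff_fbi hθ hθ' (P u)).differentiable (by simp)
      have h1 : _root_.pderiv ℂ l (fun z => q z * φ.fbi (P u) z) z =
          q z * _root_.pderiv ℂ l (φ.fbi (P u)) z + φ.fbi (P u) z * _root_.pderiv ℂ l q z := by
        unfold _root_.pderiv
        rw [fderiv_fun_mul (hq.differentiable (by simp) z) (hd z)]
        rfl
      rw [h1, φ.pderiv_fbi hθ hθ']
      simp only [Module.End.mul_apply, mul_add, Finset.mul_sum]
      rw [add_mul, add_right_comm, add_comm (q z * _)]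
      congr 1
      · ring
      · exact Finset.sum_congr rfl fun k _ => by ring
    rw [e]
    have hA : ContDiff ℂ ∞ fun z : CSp d => cop φ.A z l :=
      ((EuclideanSpace.proj l : CSp d →L[ℂ] ℂ) ∘L cop φ.A).contDiff
    refine (IsFBIOp.base _ ?_ P P' hP).add (IsFBIOp.sum _ fun k =>
      IsFBIOp.base _ (hq.mul contDiff_const) (GSDual.mulX k * P : Module.End ℂ (GSDual d θ)) (fun f => P' (GS.mulX k f)) ?_)
    · exact (contDiff_pderiv_complex l hq).add (hq.mul (contDiff_const.mul hA))
    · intro u f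
      exact hP u (GS.mulX k f)
  | @add F G hF hG ihF ihG =>
    have e : (fun u => _root_.pderiv ℂ l (fun z => F u z + G u z)) = fun u z =>
        _root_.pderiv ℂ l (F u) z + _root_.pderiv ℂ l (G u) z := by
      funext u z
      unfold _root_.pderiv
      rw [fderiv_fun_add ((hF.contDiff hθ hθ' u).differentiable (by simp) z)
        ((hG.contDiff hθ hθ' u).differentiable (by simp) z)]
      rfl
    rw [e]
    exact ihF.add ihG

lemma mderiv (hθ : 1 / 2 ≤ θ) (hθ' : θ < 1) (α : MIdx d) :
    IsFBIOp (θ := θ) φ fun u => _root_.mderiv ℂ α (φ.fbi u) := by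
  unfold _root_.mderiv
  induction List.finRange d with
  | nil => exact IsFBIOp.fbi φ
  | cons i l ih =>
    simp only [List.foldr_cons]
    induction α i with
    | zero => exact ih
    | succ n ihn =>
      simp only [Function.iterate_succ_apply']
      exact ihn.pderiv hθ hθ' i

end IsFBIOp

/-! ### The operators `Σ_α T_φ^* h_α ∂^α T_φ` -/

section Operator

variable {h : MIdx d → CSp d → ℂ}

lemma CoeffBound.mul_mderiv_fbi_mem (hθ : 1 / 2 ≤ θ) (hθ' : θ < 1) (hh : CoeffBound θ h)
    (hd : ∀ α, Differentiable ℂ (h α)) (α : MIdx d) (u : GSDual d θ) :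
    (fun z => h α z * mderiv ℂ α (φ.fbi u) z) ∈ φ.Growth θ := by
  refine ⟨(hd α).continuous.mul
    (contDiff_mderiv_complex α (φ.contDiff_fbi hθ hθ' u)).continuous, fun ε hε => ?_⟩
  obtain ⟨κ, hκ, K, hK, H⟩ := hh.exists_norm_le φ hθ hθ' hε
  obtain ⟨G, hG0, hG⟩ := φ.exists_norm_fbi_le' hθ hθ' u hκ
  exact ⟨_, H (φ.fbi u) G (φ.contDiff_fbi hθ hθ' u) hG α⟩

/-- The map `u ↦ h_α ∂^α T_φ u`. -/
noncomputable def symTerm (hθ : 1 / 2 ≤ θ) (hθ' : θ < 1) (hh : CoeffBound θ h)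
    (hd : ∀ α, Differentiable ℂ (h α)) (α : MIdx d) : GSDual d θ →ₗ[ℂ] φ.Growth θ where
  toFun u := ⟨fun z => h α z * mderiv ℂ α (φ.fbi u) z,
    CoeffBound.mul_mderiv_fbi_mem φ hθ hθ' hh hd α u⟩
  map_add' u v := by
    ext z
    simp [(IsFBIOp.mderiv (φ := φ) hθ hθ' α).map_add hθ hθ' u v z, mul_add]
  map_smul' c u := by
    ext z
    simp [(IsFBIOp.mderiv (φ := φ) hθ hθ' α).map_smul hθ hθ' c u z, mul_left_comm]

variable (hθ : 1 / 2 ≤ θ) (hθ' : θ < 1) (hh : CoeffBound θ h) (hd : ∀ α, Differentiable ℂ (h α))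

/-- Bounds for the integrands in the definition of the operator, uniform on equicontinuous sets. -/
lemma exists_norm_symTerm_le {C : ℝ} (hC : 0 < C) : ∃ C' > 0, ∃ δ > 0, ∃ K > 0,
    ∀ (u : GSDual d θ) (G : ℝ), (∀ (f : GS d θ) (M : ℝ), GSBound θ C' M (f : RSp d → ℂ) →
        ‖(u : GS d θ →ₗ[ℂ] ℂ) f‖ ≤ G * M) →
      ∀ (α : MIdx d) (f : GS d θ) (M : ℝ), GSBound θ C M (f : RSp d → ℂ) →
        (∀ z, ‖φ.adjIntegrand (φ.symTerm hθ hθ' hh hd α u) f z‖ ≤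
          G * K * M * (1 / 2) ^ α.len * Real.exp (-δ * ‖z‖ ^ (1 / θ))) ∧
        ∫ z, ‖φ.adjIntegrand (φ.symTerm hθ hθ' hh hd α u) f z‖ ≤
          G * K * M * (1 / 2) ^ α.len := by
  obtain ⟨δ, hδ, K₁, hK₁, H₁⟩ := φ.exists_norm_adjIntegrand_le hθ hθ' hC
  obtain ⟨κ, hκ, K₂, hK₂, H₂⟩ := hh.exists_norm_le φ hθ hθ' hδ
  obtain ⟨C', hC', K₃, hK₃, H₃⟩ := φ.exists_norm_fbi_le hθ hθ' hκ
  have hint := integrable_exp_neg_rpow (d := d) (by linarith) hθ' hδ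
  set J := ∫ z : CSp d, Real.exp (-δ * ‖z‖ ^ (1 / θ)) with hJ
  have hJ0 : 0 ≤ J := integral_nonneg fun _ => (Real.exp_pos _).le
  refine ⟨C', hC', δ, hδ, K₃ * K₂ * K₁ * (1 + J), by positivity, fun u G hu α f M hf => ?_⟩
  have hM := hf.nonneg
  have h3 := H₃ u G hu
  have hG : 0 ≤ G := by
    have := nonneg_of_mul_nonneg_left ((norm_nonneg _).trans (h3 0)) (Real.exp_pos _)
    exact nonneg_of_mul_nonneg_right this hK₃
  have h2 := H₂ (φ.fbi u) (K₃ * G) (φ.contDiff_fbi hθ hθ' u) h3 α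
  have h1 : ∀ z, ‖φ.adjIntegrand (φ.symTerm hθ hθ' hh hd α u) f z‖ ≤
      G * (K₃ * K₂ * K₁) * M * (1 / 2) ^ α.len * Real.exp (-δ * ‖z‖ ^ (1 / θ)) := fun z => by
    refine (H₁ f M hf (φ.symTerm hθ hθ' hh hd α u) _ z (h2 z)).trans (le_of_eq ?_)
    ring
  refine ⟨fun z => (h1 z).trans ?_, ?_⟩
  · have h4 : K₃ * K₂ * K₁ ≤ K₃ * K₂ * K₁ * (1 + J) :=
      le_mul_of_one_le_right (by positivity) (by linarith)
    gcongr G * ?_ * M * _ * _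
  · calc _ ≤ ∫ z : CSp d, G * (K₃ * K₂ * K₁) * M * (1 / 2) ^ α.len *
          Real.exp (-δ * ‖z‖ ^ (1 / θ)) :=
          integral_mono_of_nonneg (Eventually.of_forall fun _ => norm_nonneg _)
            (hint.const_mul _) (Eventually.of_forall h1)
      _ = G * (K₃ * K₂ * K₁) * M * (1 / 2) ^ α.len * J := by rw [integral_const_mul]
      _ ≤ G * (K₃ * K₂ * K₁) * M * (1 / 2) ^ α.len * (1 + J) := by gcongr; linarith
      _ = _ := by ring

lemma summable_integral_norm_symTerm (u : GSDual d θ) (f : GS d θ) :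
    Summable fun α => ∫ z, ‖φ.adjIntegrand (φ.symTerm hθ hθ' hh hd α u) f z‖ := by
  obtain ⟨hf, C, hC, M, hM⟩ := f.2
  obtain ⟨C', hC', δ, hδ, K, hK, H⟩ := φ.exists_norm_symTerm_le hθ hθ' hh hd hC
  obtain ⟨G, hG⟩ := u.2 C' hC'
  exact Summable.of_nonneg_of_le (fun α => integral_nonneg fun _ => norm_nonneg _)
    (fun α => (H u G hG α f M hM).2)
    ((MIdx.summable_pow_len (by norm_num) (by norm_num)).mul_left _)

lemma summable_adj_symTerm (u : GSDual d θ) (f : GS d θ) :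
    Summable fun α => (φ.adj hθ hθ' (φ.symTerm hθ hθ' hh hd α u) : GS d θ →ₗ[ℂ] ℂ) f :=
  Summable.of_norm_bounded (φ.summable_integral_norm_symTerm hθ hθ' hh hd u f)
    fun _ => norm_integral_le_integral_norm _

/-- Bounds for the operator, uniform on equicontinuous sets. -/
lemma exists_norm_tsum_adj_le {C : ℝ} (hC : 0 < C) : ∃ C' > 0, ∃ K > 0,
    ∀ (u : GSDual d θ) (G : ℝ), (∀ (f : GS d θ) (M : ℝ), GSBound θ C' M (f : RSp d → ℂ) →
        ‖(u : GS d θ →ₗ[ℂ] ℂ) f‖ ≤ G * M) →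
      ∀ (f : GS d θ) (M : ℝ), GSBound θ C M (f : RSp d → ℂ) →
        ‖∑' α, (φ.adj hθ hθ' (φ.symTerm hθ hθ' hh hd α u) : GS d θ →ₗ[ℂ] ℂ) f‖ ≤ G * K * M := by
  obtain ⟨C', hC', δ, hδ, K, hK, H⟩ := φ.exists_norm_symTerm_le hθ hθ' hh hd hC
  have hs : Summable fun α : MIdx d => (1 / 2 : ℝ) ^ α.len :=
    MIdx.summable_pow_len (by norm_num) (by norm_num)
  have hS : 0 < ∑' α : MIdx d, (1 / 2 : ℝ) ^ α.len :=
    hs.tsum_pos (fun _ => by positivity) 0 (by positivity)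
  refine ⟨C', hC', K * ∑' α : MIdx d, (1 / 2 : ℝ) ^ α.len, by positivity, fun u G hu f M hf => ?_⟩
  have := tsum_of_norm_bounded (hs.hasSum.mul_left (G * K * M)) fun α =>
    (norm_integral_le_integral_norm _).trans (H u G hu α f M hf).2
  refine this.trans (le_of_eq ?_)
  ring

/-- The operator `A = Σ_α T_φ^* h_α ∂^α T_φ`. -/
noncomputable def symOp : GSDual d θ →ₗ[ℂ] GSDual d θ where
  toFun u := ⟨{ toFun := fun f =>
                  ∑' α, (φ.adj hθ hθ' (φ.symTerm hθ hθ' hh hd α u) : GS d θ →ₗ[ℂ] ℂ) f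
                map_add' := fun f g => by
                  simp only [map_add]
                  exact (φ.summable_adj_symTerm hθ hθ' hh hd u f).tsum_add
                    (φ.summable_adj_symTerm hθ hθ' hh hd u g)
                map_smul' := fun c f => by
                  simp only [map_smul, smul_eq_mul, tsum_mul_left, RingHom.id_apply] }, by
    intro C hC
    obtain ⟨C', hC', K, hK, H⟩ := φ.exists_norm_tsum_adj_le hθ hθ' hh hd hC
    obtain ⟨G, hG⟩ := u.2 C' hC'
    exact ⟨G * K, H u G hG⟩⟩
  map_add' u v := by
    refine Subtype.ext (LinearMap.ext fun f => ?_)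
    change ∑' α, (φ.adj hθ hθ' (φ.symTerm hθ hθ' hh hd α (u + v)) : GS d θ →ₗ[ℂ] ℂ) f = _
    simp only [map_add]
    exact (φ.summable_adj_symTerm hθ hθ' hh hd u f).tsum_add
      (φ.summable_adj_symTerm hθ hθ' hh hd v f)
  map_smul' c u := by
    refine Subtype.ext (LinearMap.ext fun f => ?_)
    change ∑' α, (φ.adj hθ hθ' (φ.symTerm hθ hθ' hh hd α (c • u)) : GS d θ →ₗ[ℂ] ℂ) f = _
    simp only [map_smul]
    exact tsum_mul_left

lemma hasSum_symOp (u : GSDual d θ) (f : GS d θ) :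
    HasSum (fun α => (φ.adj hθ hθ' (φ.symTerm hθ hθ' hh hd α u) : GS d θ →ₗ[ℂ] ℂ) f)
      ((φ.symOp hθ hθ' hh hd u : GS d θ →ₗ[ℂ] ℂ) f) :=
  (φ.summable_adj_symTerm hθ hθ' hh hd u f).hasSum

/-- `T_φ A u = Σ_α h_α ∂^α T_φ u`. -/
lemma hasSum_fbi_symOp (u : GSDual d θ) (z : CSp d) :
    HasSum (fun α => h α z * mderiv ℂ α (φ.fbi u) z) (φ.fbi (φ.symOp hθ hθ' hh hd u) z) := by
  have h1 := (φ.hasSum_symOp hθ hθ' hh hd u (φ.ker hθ hθ' z)).mul_left (φ.const : ℂ)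
  rw [← φ.fbi_eq hθ hθ'] at h1
  refine h1.congr_fun fun α => ?_
  -- Each term is entire, so $T_\varphi T_\varphi^*$ acts on it as the identity.
  rw [← φ.fbi_eq hθ hθ', φ.fbi_adj hθ hθ' _ ?_]
  · rfl
  · exact (hd α).mul
      ((contDiff_mderiv_complex α (φ.contDiff_fbi hθ hθ' u)).differentiable (by simp))

/-- Local decay is preserved, with uniform bounds. -/
lemma exists_norm_fbi_symOp_le {ε c : ℝ} (hε : 0 < ε) (hc : 0 < c) (hc' : c ≤ 1 / 2) :
    ∃ ε' > 0, ∃ K > 0, ∀ (u : GSDual d θ) (G : ℝ),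
      (∀ z, ‖φ.fbi u z‖ ≤ G * Real.exp (1 * ‖z‖ ^ (1 / θ) + φ.weight z)) → ∀ z,
      (∀ w, ‖w‖ ≤ c * ‖z‖ →
        ‖φ.fbi u (z + w)‖ ≤ G * Real.exp (-ε * ‖z + w‖ ^ (1 / θ) + φ.weight (z + w))) →
      ‖φ.fbi (φ.symOp hθ hθ' hh hd u) z‖ ≤
        G * K * Real.exp (-ε' * ‖z‖ ^ (1 / θ) + φ.weight z) := by
  obtain ⟨ε', hε', K, hK, H⟩ := hh.exists_norm_le_of_decay φ hθ hθ' hε hc hc'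
  have hs : Summable fun α : MIdx d => (1 / 2 : ℝ) ^ α.len :=
    MIdx.summable_pow_len (by norm_num) (by norm_num)
  have hS : 0 < ∑' α : MIdx d, (1 / 2 : ℝ) ^ α.len :=
    hs.tsum_pos (fun _ => by positivity) 0 (by positivity)
  refine ⟨ε', hε', K * ∑' α : MIdx d, (1 / 2 : ℝ) ^ α.len, by positivity, fun u G hG z hz => ?_⟩
  rw [← (φ.hasSum_fbi_symOp hθ hθ' hh hd u z).tsum_eq]
  have := tsum_of_norm_bounded ((hs.hasSum.mul_left (G * K)).mul_right
    (Real.exp (-ε' * ‖z‖ ^ (1 / θ) + φ.weight z)))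
    (H (φ.fbi u) G (φ.contDiff_fbi hθ hθ' u) hG z hz)
  rwa [← mul_assoc]

lemma exists_decaysOn_symOp {L : Set (CSp d)} {z₀ : CSp d} (hL : IsConicNhd L z₀) {ε : ℝ}
    (hε : 0 < ε) : ∃ L', IsConicNhd L' z₀ ∧ ∃ ε' > 0, ∃ K > 0, ∀ (u : GSDual d θ) (G : ℝ),
      (∀ z, ‖φ.fbi u z‖ ≤ G * Real.exp (1 * ‖z‖ ^ (1 / θ) + φ.weight z)) →
      φ.DecaysOn u L G ε → φ.DecaysOn (φ.symOp hθ hθ' hh hd u) L' (G * K) ε' := by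
  obtain ⟨L', hL', c, hc, hc', hshrink⟩ := hL.exists_shrink
  obtain ⟨ε', hε', K, hK, H⟩ := φ.exists_norm_fbi_symOp_le hθ hθ' hh hd hε hc hc'
  exact ⟨L', hL', ε', hε', K, hK, fun u G hG hu z hz =>
    H u G hG z fun w hw => hu _ (hshrink z hz w hw)⟩

lemma DecaysOn.mono {φ : FBIPhase d} {u : GSDual d θ} {L : Set (CSp d)} {K K' ε : ℝ}
    (hu : φ.DecaysOn u L K ε) (hK : K ≤ K') : φ.DecaysOn u L K' ε := fun z hz =>
  (hu z hz).trans (mul_le_mul_of_nonneg_right hK (Real.exp_pos _).le)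

lemma DecaysNear.symOp {φ : FBIPhase d} {u : GSDual d θ} {z₀ : CSp d} (hu : φ.DecaysNear u z₀) :
    φ.DecaysNear (φ.symOp hθ hθ' hh hd u) z₀ := by
  obtain ⟨L, hL, ε, hε, K, hK, H⟩ := hu
  obtain ⟨L', hL', ε', hε', K', hK', H'⟩ := φ.exists_decaysOn_symOp hθ hθ' hh hd hL hε
  obtain ⟨G, hG0, hG⟩ := φ.exists_norm_fbi_le' hθ hθ' u one_pos
  refine ⟨L', hL', ε', hε', max G K * K', by have := lt_max_of_lt_right (b := G) hK; positivity,
    H' u _ (fun z => (hG z).trans ?_) (H.mono (le_max_right _ _))⟩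
  exact mul_le_mul_of_nonneg_right (le_max_left _ _) (Real.exp_pos _).le

lemma WF_symOp_subset (u : GSDual d θ) : φ.WF (φ.symOp hθ hθ' hh hd u) ⊆ φ.WF u :=
  fun _ hp => ⟨hp.1, fun hu => hp.2 (DecaysNear.symOp hθ hθ' hh hd hu)⟩

lemma exists_forall_norm_le_of_tendsto {w : ℕ → GSDual d θ}
    (hw : ∀ f, Tendsto (fun n => (w n : GS d θ →ₗ[ℂ] ℂ) f) atTop (𝓝 0)) {C : ℝ} (hC : 0 < C) :
    ∃ G, ∀ n (f : GS d θ) M, GSBound θ C M (f : RSp d → ℂ) →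
      ‖(w n : GS d θ →ₗ[ℂ] ℂ) f‖ ≤ G * M := by
  refine GSDual.exists_forall_norm_le hC fun f => ?_
  obtain ⟨K, hK⟩ := (hw f).norm.bddAbove_range
  exact ⟨K, fun n => hK ⟨n, rfl⟩⟩

/-- Dominated convergence is used twice, in $z$ for each $\alpha$ and in the sum over $\alpha$. The
majorants do not depend on $n$ because a weakly null sequence is equicontinuous. -/
lemma tendsto_symOp {w : ℕ → GSDual d θ}
    (hw : ∀ f, Tendsto (fun n => (w n : GS d θ →ₗ[ℂ] ℂ) f) atTop (𝓝 0)) (f : GS d θ) :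
    Tendsto (fun n => (φ.symOp hθ hθ' hh hd (w n) : GS d θ →ₗ[ℂ] ℂ) f) atTop (𝓝 0) := by
  obtain ⟨hf, C, hC, M, hM⟩ := f.2
  obtain ⟨C', hC', δ, hδ, K, hK, H⟩ := φ.exists_norm_symTerm_le hθ hθ' hh hd hC
  obtain ⟨G, hG⟩ := exists_forall_norm_le_of_tendsto hw hC'
  have hs : Summable fun α : MIdx d => (1 / 2 : ℝ) ^ α.len :=
    MIdx.summable_pow_len (by norm_num) (by norm_num)
  have hint := integrable_exp_neg_rpow (d := d) (by linarith) hθ' hδ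
  have h0 : ∀ α, Tendsto (fun n => (φ.adj hθ hθ' (φ.symTerm hθ hθ' hh hd α (w n)) :
      GS d θ →ₗ[ℂ] ℂ) f) atTop (𝓝 0) := by
    intro α
    have h1 := tendsto_integral_of_dominated_convergence (μ := volume)
      (F := fun n z => φ.adjIntegrand (φ.symTerm hθ hθ' hh hd α (w n)) f z) (f := fun _ => 0)
      (fun z => G * K * M * (1 / 2) ^ α.len * Real.exp (-δ * ‖z‖ ^ (1 / θ)))
      (fun n => (φ.continuous_adjIntegrand hθ hθ'
        (φ.symTerm hθ hθ' hh hd α (w n)).2.1 f).aestronglyMeasurable)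
      (hint.const_mul _)
      (fun n => Eventually.of_forall ((H (w n) G (hG n) α f M hM).1))
      (Eventually.of_forall fun z => by
        have h2 := (IsFBIOp.mderiv (φ := φ) hθ hθ' α).tendsto hθ hθ' hw z
        have h3 := (((h2.const_mul (h α z)).mul_const (starRingEnd ℂ
          (φ.fbiFun (fun y => starRingEnd ℂ ((f : RSp d → ℂ) y)) z))).mul_const
          (Real.exp (-2 * φ.weight z) : ℂ))
        rw [mul_zero, zero_mul, zero_mul] at h3
        exact h3)
    rw [integral_zero] at h1
    exact h1
  have h1 := tendsto_tsum_of_dominated_convergence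
    (bound := fun α : MIdx d => G * K * M * (1 / 2) ^ α.len) (hs.mul_left _) h0
    (Eventually.of_forall fun n α =>
      (norm_integral_le_integral_norm _).trans (H (w n) G (hG n) α f M hM).2)
  rw [tsum_zero] at h1
  exact h1

lemma TendstoWF.symOp {φ : FBIPhase d} {Γ : Set (RSp d × RSp d)} {u : ℕ → GSDual d θ}
    {v : GSDual d θ} (huv : φ.TendstoWF Γ u v) :
    φ.TendstoWF Γ (fun n => φ.symOp hθ hθ' hh hd (u n)) (φ.symOp hθ hθ' hh hd v) := by
  have e : ∀ n, φ.symOp hθ hθ' hh hd (u n) - φ.symOp hθ hθ' hh hd v =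
      φ.symOp hθ hθ' hh hd (u n - v) := fun n => (map_sub _ _ _).symm
  refine ⟨fun f => ?_, fun p hp hpΓ => ?_⟩
  · simp only [e]
    exact φ.tendsto_symOp hθ hθ' hh hd huv.1 f
  · obtain ⟨L, hL, ε, hε, K, hK, H⟩ := huv.2 p hp hpΓ
    obtain ⟨L', hL', ε', hε', K', hK', H'⟩ := φ.exists_decaysOn_symOp hθ hθ' hh hd hL hε
    -- Besides the uniform decay in `L`, the local estimate needs a global growth bound uniform in
    -- $n$; it comes from equicontinuity of the differences.
    obtain ⟨C, hC, K₁, hK₁, H₁⟩ := φ.exists_norm_fbi_le hθ hθ' one_pos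
    obtain ⟨G, hG⟩ := exists_forall_norm_le_of_tendsto huv.1 hC
    refine ⟨L', hL', ε', hε', max (K₁ * G) K * K',
      by have := lt_max_of_lt_right (b := K₁ * G) hK; positivity, fun n => ?_⟩
    simp only [e]
    refine H' _ _ (fun z => (H₁ _ G (hG n) z).trans ?_) ((H n).mono (le_max_right _ _))
    exact mul_le_mul_of_nonneg_right (le_max_left _ _) (Real.exp_pos _).le

end Operator

end FBIPhase

lemma GSBound.of_le {d : ℕ} {θ C M M' : ℝ} {f : RSp d → ℂ} (h : GSBound θ C M f) (hC : 0 < C)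
    (hM : M ≤ M') : GSBound θ C M' f := fun α β x =>
  (h α β x).trans (mul_le_mul_of_nonneg_right hM (mul_nonneg (mul_nonneg (by positivity)
    (Real.rpow_nonneg (MIdx.fact_pos α).le θ)) (Real.rpow_nonneg (MIdx.fact_pos β).le θ)))

lemma mderiv_zero_idx_complex {d : ℕ} (f : CSp d → ℂ) : mderiv ℂ (0 : MIdx d) f = f := by
  unfold mderiv
  induction List.finRange d with
  | nil => rfl
  | cons i l ih => simp

lemma MIdx.len_single {d : ℕ} (j : Fin d) : MIdx.len (Pi.single j 1 : MIdx d) = 1 := by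
  simp [MIdx.len]

lemma MIdx.fact_single {d : ℕ} (j : Fin d) : MIdx.fact (Pi.single j 1 : MIdx d) = 1 := by
  have h := MIdx.fact_add_single (0 : MIdx d) j
  rw [zero_add] at h
  rw [h]
  simp [MIdx.fact]

namespace FBIPhase

variable {d : ℕ} (φ : FBIPhase d) {θ : ℝ}

/-! ### The operators preserve `S_θ` -/

lemma continuous_kernel_uncurry : Continuous fun p : CSp d × RSp d => φ.kernel p.1 p.2 := by
  unfold kernel val cvec
  fun_prop

/-- The adjoint of `T_φ` as an oscillatory integral. -/
noncomputable def adjKernel (U : CSp d → ℂ) (z : CSp d) (y : RSp d) : ℂ :=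
  (φ.const * U z * (Real.exp (-2 * φ.weight z) : ℂ)) * starRingEnd ℂ (φ.kernel z y)

/-- The seminorm of the conjugated kernel at a fixed scale is
$O(e^{\frac\varepsilon2|z|^{1/\theta}+\Phi})$, so against $Ue^{-2\Phi}$ a decay
$e^{-\frac\varepsilon2|z|^{1/\theta}}$ remains. The oscillatory integral therefore converges in
$\mathcal S_\theta$, and Fubini identifies it with $T_\varphi^*U$. -/
lemma exists_eq_toDual_adj (hθ : 1 / 2 ≤ θ) (hθ' : θ < 1) (U : φ.Growth θ) {G ε : ℝ} (hε : 0 < ε)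
    (hU : ∀ z, ‖(U : CSp d → ℂ) z‖ ≤ G * Real.exp (-ε * ‖z‖ ^ (1 / θ) + φ.weight z)) :
    ∃ g : GS d θ, φ.adj hθ hθ' U = GS.toDual g := by
  have hG : 0 ≤ G := nonneg_of_mul_nonneg_left ((norm_nonneg _).trans (hU 0)) (Real.exp_pos _)
  have hc := φ.const_nonneg
  obtain ⟨C, hC, K, hK, HK⟩ := φ.exists_gsBound_kernel hθ hθ' (half_pos hε)
  have hcoef : ∀ z, ‖φ.const * (U : CSp d → ℂ) z * (Real.exp (-2 * φ.weight z) : ℂ)‖ ≤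
      φ.const * G * Real.exp (-ε * ‖z‖ ^ (1 / θ) - φ.weight z) := fun z => by
    rw [norm_mul, norm_mul, Complex.norm_real, Complex.norm_real, Real.norm_of_nonneg hc,
      Real.norm_of_nonneg (Real.exp_pos _).le]
    calc _ ≤ φ.const * (G * Real.exp (-ε * ‖z‖ ^ (1 / θ) + φ.weight z)) *
          Real.exp (-2 * φ.weight z) := by
          refine mul_le_mul_of_nonneg_right ?_ (Real.exp_pos _).le
          exact mul_le_mul_of_nonneg_left (hU z) hc
      _ = φ.const * G * (Real.exp (-ε * ‖z‖ ^ (1 / θ) + φ.weight z) *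
          Real.exp (-2 * φ.weight z)) := by ring
      _ = _ := by rw [← Real.exp_add]; ring_nf
  have hcont : Continuous fun p : CSp d × RSp d => φ.adjKernel U p.1 p.2 := by
    have h1 : Continuous (U : CSp d → ℂ) := U.2.1
    have h2 := φ.continuous_weight
    have h3 := φ.continuous_kernel_uncurry
    unfold adjKernel
    fun_prop
  have hs : ∀ z, ContDiff ℝ ∞ (φ.adjKernel U z) := fun z =>
    contDiff_const.mul (Complex.conjCLE.contDiff.comp (φ.contDiff_kernel z))
  have hgs : ∀ z, GSBound θ C (φ.const * G * K * Real.exp (-(ε / 2) * ‖z‖ ^ (1 / θ)))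
      (φ.adjKernel U z) := by
    intro z
    have h1 := (HK z).conj.smul (Complex.conjCLE.contDiff.comp (φ.contDiff_kernel z))
      (φ.const * (U : CSp d → ℂ) z * (Real.exp (-2 * φ.weight z) : ℂ))
    refine h1.of_le hC ?_
    calc _ ≤ φ.const * G * Real.exp (-ε * ‖z‖ ^ (1 / θ) - φ.weight z) *
          (K * Real.exp (ε / 2 * ‖z‖ ^ (1 / θ) + φ.weight z)) := by
          exact mul_le_mul_of_nonneg_right (hcoef z) (by positivity)
      _ = φ.const * G * K * (Real.exp (-ε * ‖z‖ ^ (1 / θ) - φ.weight z) *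
          Real.exp (ε / 2 * ‖z‖ ^ (1 / θ) + φ.weight z)) := by ring
      _ = _ := by rw [← Real.exp_add]; ring_nf
  have hint := GSBound.integral (μ := volume) hs
    (fun y => (hcont.comp (Continuous.prodMk_left y)).aestronglyMeasurable)
    ((integrable_exp_neg_rpow (d := d) (by linarith) hθ' (half_pos hε)).const_mul _) hgs
  refine ⟨⟨fun y => ∫ z, φ.adjKernel U z y, hint.1, C, hC, _, hint.2⟩, ?_⟩
  refine Subtype.ext (LinearMap.ext fun f => ?_)
  change ∫ z, φ.adjIntegrand U f z = ∫ y, (∫ z, φ.adjKernel U z y) * (f : RSp d → ℂ) y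
  have hL : ∀ z, φ.adjIntegrand U f z = ∫ y, φ.adjKernel U z y * (f : RSp d → ℂ) y := by
    intro z
    unfold adjIntegrand adjKernel fbiFun
    rw [map_mul, ← integral_conj, Complex.conj_ofReal, mul_comm, ← mul_assoc, ← mul_assoc,
      ← integral_const_mul]
    refine integral_congr_ae (Eventually.of_forall fun y => ?_)
    simp only [map_mul, Complex.conj_conj]
    ring
  simp only [hL, ← integral_mul_const]
  refine integral_integral_swap ?_
  refine (((integrable_exp_neg_rpow (d := d) (by linarith) hθ' hε).const_mul
    (φ.const * G)).mul_prod (GS.integrable f).norm).mono' ?_ (Eventually.of_forall fun p => ?_)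
  · exact (hcont.mul (f.2.1.continuous.comp continuous_snd)).aestronglyMeasurable
  · change ‖φ.adjKernel U p.1 p.2 * (f : RSp d → ℂ) p.2‖ ≤ _
    rw [norm_mul]
    refine mul_le_mul_of_nonneg_right ?_ (norm_nonneg _)
    rw [adjKernel, norm_mul, RCLike.norm_conj]
    have h1 : ‖φ.kernel p.1 p.2‖ ≤ Real.exp (φ.weight p.1) := by
      rw [φ.norm_kernel]
      refine Real.exp_le_exp.2 ?_
      have : 0 ≤ ‖rop φ.rt (p.2 - φ.crit p.1)‖ ^ 2 := by positivity
      linarith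
    calc _ ≤ φ.const * G * Real.exp (-ε * ‖p.1‖ ^ (1 / θ) - φ.weight p.1) *
          Real.exp (φ.weight p.1) :=
          mul_le_mul (hcoef p.1) h1 (norm_nonneg _) (by positivity)
      _ = _ := by rw [mul_assoc, ← Real.exp_add]; ring_nf

section Operator

variable {h : MIdx d → CSp d → ℂ} (hθ : 1 / 2 ≤ θ) (hθ' : θ < 1) (hh : CoeffBound θ h)
  (hd : ∀ α, Differentiable ℂ (h α))

lemma fbi_mem (hθ : 1 / 2 ≤ θ) (hθ' : θ < 1) (u : GSDual d θ) : φ.fbi u ∈ φ.Growth θ :=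
  ⟨φ.continuous_fbi hθ hθ' u, fun _ hε =>
    let ⟨G, _, hG⟩ := φ.exists_norm_fbi_le' hθ hθ' u hε
    ⟨G, hG⟩⟩

/-- The sum over $\alpha$ is exchanged with the integral over $z$. Thus $T_\varphi^*T_\varphi$ is
the identity on the range of the operator without any appeal to an inversion formula on $\mathcal
S'_\theta$. -/
lemma adj_fbi_symOp (u : GSDual d θ) :
    φ.adj hθ hθ' ⟨φ.fbi (φ.symOp hθ hθ' hh hd u), φ.fbi_mem hθ hθ' _⟩ =
      φ.symOp hθ hθ' hh hd u := by
  refine Subtype.ext (LinearMap.ext fun f => ?_)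
  have h1 := hasSum_integral_of_summable_integral_norm
    (fun α => φ.integrable_adjIntegrand hθ hθ' (φ.symTerm hθ hθ' hh hd α u).2 f)
    (φ.summable_integral_norm_symTerm hθ hθ' hh hd u f)
  refine Eq.trans ?_ (h1.unique (φ.hasSum_symOp hθ hθ' hh hd u f))
  refine integral_congr_ae (Eventually.of_forall fun z => ?_)
  have h2 := ((φ.hasSum_fbi_symOp hθ hθ' hh hd u z).mul_right (starRingEnd ℂ
    (φ.fbiFun (fun y => starRingEnd ℂ ((f : RSp d → ℂ) y)) z))).mul_right
    (Real.exp (-2 * φ.weight z) : ℂ)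
  exact h2.tsum_eq.symm

lemma exists_symOp_toDual (f : GS d θ) :
    ∃ g : GS d θ, φ.symOp hθ hθ' hh hd (GS.toDual f) = GS.toDual g := by
  obtain ⟨hf, C, hC, M, hM⟩ := f.2
  obtain ⟨δ, hδ, K, hK, H⟩ := φ.exists_norm_fbi_toDual_le hθ hθ' hC
  obtain ⟨ε', hε', K', hK', H'⟩ :=
    -- The decay of $T_\varphi f$ holds at all points, so any admissible `c` will do.
    φ.exists_norm_fbi_symOp_le hθ hθ' hh hd hδ (by norm_num : (0 : ℝ) < 1 / 2) le_rfl
  have h1 := H f M hM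
  have hM0 := hM.nonneg
  rw [← φ.adj_fbi_symOp hθ hθ' hh hd]
  refine φ.exists_eq_toDual_adj hθ hθ' _ hε' fun z =>
    H' (GS.toDual f) (K * M) (fun z => (h1 z).trans ?_) z fun w _ => h1 _
  refine mul_le_mul_of_nonneg_left (Real.exp_le_exp.2 ?_) (by positivity)
  have : 0 ≤ ‖z‖ ^ (1 / θ) := by positivity
  nlinarith

end Operator

/-! ### Differential operators with polynomial coefficients -/

/-- Cauchy's estimates with $|\alpha|\le1$ carry the decay to first derivatives in a smaller cone,
and half of the rate absorbs the factor $1+|z|$. -/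
lemma DecaysNear.of_fbi_le {φ : FBIPhase d} (hθ : 1 / 2 ≤ θ) (hθ' : θ < 1) {u v : GSDual d θ}
    {z₀ : CSp d} {R : ℝ} (hR : 0 ≤ R) (hu : φ.DecaysNear u z₀)
    (hv : ∀ z, ‖φ.fbi v z‖ ≤ R * (1 + ‖z‖) *
      (‖φ.fbi u z‖ + ∑ l, ‖pderiv ℂ l (φ.fbi u) z‖)) : φ.DecaysNear v z₀ := by
  obtain ⟨L, hL, ε, hε, K, hK, H⟩ := hu
  obtain ⟨L', hL', c, hc, hc', hshrink⟩ := hL.exists_shrink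
  obtain ⟨ε', hε', K', hK', H'⟩ := φ.exists_norm_mderiv_le_of_decay hθ hθ' hε hc hc'
  obtain ⟨G, hG0, hG⟩ := φ.exists_norm_fbi_le' hθ hθ' u one_pos
  set G' := max G K with hG'
  have hG'0 : 0 < G' := lt_max_of_lt_right hK
  have h1 : ∀ z ∈ L', ∀ α : MIdx d, ‖mderiv ℂ α (φ.fbi u) z‖ ≤
      G' * ((α.fact : ℝ) ^ θ * K' ^ (α.len + 1)) *
        Real.exp (-ε' * ‖z‖ ^ (1 / θ) + φ.weight z) := fun z hz =>
    H' (φ.fbi u) G' (φ.contDiff_fbi hθ hθ' u)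
      (fun z => (hG z).trans (mul_le_mul_of_nonneg_right (le_max_left _ _) (Real.exp_pos _).le)) z
      fun w hw => (H _ (hshrink z hz w hw)).trans
        (mul_le_mul_of_nonneg_right (le_max_right _ _) (Real.exp_pos _).le)
  have h2 : ∀ z ∈ L', ‖φ.fbi u z‖ + ∑ l, ‖pderiv ℂ l (φ.fbi u) z‖ ≤
      G' * (K' + d * K' ^ 2) * Real.exp (-ε' * ‖z‖ ^ (1 / θ) + φ.weight z) := by
    intro z hz
    have h0 := h1 z hz 0
    have h1z := h1 z hz
    generalize Real.exp (-ε' * ‖z‖ ^ (1 / θ) + φ.weight z) = X at h0 h1z ⊢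
    rw [mderiv_zero_idx_complex] at h0
    have hl : ∀ l, ‖pderiv ℂ l (φ.fbi u) z‖ ≤ G' * K' ^ 2 * X := fun l => by
      have := h1z (Pi.single l 1)
      rw [mderiv_single_complex, MIdx.len_single, MIdx.fact_single] at this
      simpa using this
    have hsum : ∑ l, ‖pderiv ℂ l (φ.fbi u) z‖ ≤ d * (G' * K' ^ 2 * X) := by
      refine (Finset.sum_le_sum fun l _ => hl l).trans ?_
      simp
    have h0' : ‖φ.fbi u z‖ ≤ G' * K' * X := by simpa [MIdx.len, MIdx.fact] using h0
    refine (add_le_add h0' hsum).trans (le_of_eq ?_)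
    ring
  have h3 : ∀ z : CSp d, 1 + ‖z‖ ≤ (2 + 2 / ε') * Real.exp (ε' / 2 * ‖z‖ ^ (1 / θ)) := by
    intro z
    set s := ‖z‖ ^ (1 / θ) with hs
    have hs0 : 0 ≤ s := by positivity
    have h4 : ‖z‖ ≤ 1 + s := by
      rcases le_total ‖z‖ 1 with h | h
      · linarith
      · have : ‖z‖ ^ (1 : ℝ) ≤ ‖z‖ ^ (1 / θ) :=
          Real.rpow_le_rpow_of_exponent_le h (by rw [le_div_iff₀ (by linarith)]; linarith)
        rw [Real.rpow_one] at this
        linarith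
    have h5 := Real.add_one_le_exp (ε' / 2 * s)
    calc 1 + ‖z‖ ≤ 2 + s := by linarith
      _ ≤ (2 + s) + (ε' * s + 2 / ε') := le_add_of_nonneg_right (by positivity)
      _ = (2 + 2 / ε') * (ε' / 2 * s + 1) := by field_simp; ring
      _ ≤ _ := by gcongr
  refine ⟨L', hL', ε' / 2, by positivity, R * (2 + 2 / ε') * (G' * (K' + d * K' ^ 2)) + 1,
    by positivity, fun z hz => (hv z).trans ?_⟩
  have hX := Real.exp_pos (-(ε' / 2) * ‖z‖ ^ (1 / θ) + φ.weight z)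
  calc _ ≤ R * ((2 + 2 / ε') * Real.exp (ε' / 2 * ‖z‖ ^ (1 / θ))) *
        (G' * (K' + d * K' ^ 2) * Real.exp (-ε' * ‖z‖ ^ (1 / θ) + φ.weight z)) := by
        refine mul_le_mul (mul_le_mul_of_nonneg_left (h3 z) hR) (h2 z hz) (by positivity)
          (by positivity)
    _ = R * (2 + 2 / ε') * (G' * (K' + d * K' ^ 2)) * (Real.exp (ε' / 2 * ‖z‖ ^ (1 / θ)) *
        Real.exp (-ε' * ‖z‖ ^ (1 / θ) + φ.weight z)) := by ring
    _ = R * (2 + 2 / ε') * (G' * (K' + d * K' ^ 2)) *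
        Real.exp (-(ε' / 2) * ‖z‖ ^ (1 / θ) + φ.weight z) := by
        rw [← Real.exp_add]; ring_nf
    _ ≤ _ := by rw [add_mul]; linarith

lemma norm_cop_apply_le (A : Matrix (Fin d) (Fin d) ℂ) (z : CSp d) (l : Fin d) :
    ‖cop A z l‖ ≤ ‖cop A‖ * (1 + ‖z‖) := by
  refine (PiLp.norm_apply_le _ l).trans (((cop A).le_opNorm z).trans ?_)
  gcongr
  linarith

lemma norm_fbi_mulX_le (hθ : 1 / 2 ≤ θ) (hθ' : θ < 1) (k : Fin d) : ∃ R ≥ 0,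
    ∀ (u : GSDual d θ) z, ‖φ.fbi (GSDual.mulX k u) z‖ ≤ R * (1 + ‖z‖) *
      (‖φ.fbi u z‖ + ∑ l, ‖pderiv ℂ l (φ.fbi u) z‖) := by
  set a := ‖cop φ.A‖ with ha
  refine ⟨∑ l, ‖φ.B⁻¹ l k‖ * (1 + a), by positivity, fun u z => ?_⟩
  rw [φ.fbi_mulX hθ hθ', Finset.sum_mul, Finset.sum_mul]
  refine (norm_sum_le _ _).trans (Finset.sum_le_sum fun l _ => ?_)
  rw [norm_mul, mul_assoc, mul_assoc]
  refine mul_le_mul_of_nonneg_left ((norm_sub_le _ _).trans ?_) (norm_nonneg _)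
  rw [norm_mul, norm_mul, norm_neg, Complex.norm_I, one_mul]
  have h1 : ‖pderiv ℂ l (φ.fbi u) z‖ ≤ ∑ l, ‖pderiv ℂ l (φ.fbi u) z‖ :=
    Finset.single_le_sum (f := fun l => ‖pderiv ℂ l (φ.fbi u) z‖) (fun _ _ => norm_nonneg _)
      (Finset.mem_univ l)
  have h2 := norm_cop_apply_le φ.A z l
  set S := ∑ l, ‖pderiv ℂ l (φ.fbi u) z‖
  have hS : 0 ≤ S := by positivity
  have h3 : ‖cop φ.A z l‖ * ‖φ.fbi u z‖ ≤ a * (1 + ‖z‖) * ‖φ.fbi u z‖ := by gcongr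
  have h4 : 0 ≤ a * (1 + ‖z‖) * S := by positivity
  have h5 : 0 ≤ (1 + ‖z‖) * ‖φ.fbi u z‖ := by positivity
  have h6 : 0 ≤ ‖z‖ * S := by positivity
  nlinarith

lemma norm_fbi_deriv_le (hθ : 1 / 2 ≤ θ) (hθ' : θ < 1) (j : Fin d) : ∃ R ≥ 0,
    ∀ (u : GSDual d θ) z, ‖φ.fbi (GSDual.deriv j u) z‖ ≤ R * (1 + ‖z‖) *
      (‖φ.fbi u z‖ + ∑ l, ‖pderiv ℂ l (φ.fbi u) z‖) := by
  choose R hR H using fun k => φ.norm_fbi_mulX_le hθ hθ' k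
  refine ⟨‖cop φ.B‖ + ∑ l, ‖φ.C j l‖ * R l, ?_, fun u z => ?_⟩
  · have : 0 ≤ ∑ l, ‖φ.C j l‖ * R l :=
      Finset.sum_nonneg fun l _ => mul_nonneg (norm_nonneg _) (hR l)
    positivity
  rw [φ.fbi_deriv hθ hθ', norm_mul, norm_neg, Complex.norm_I, one_mul, add_mul, add_mul]
  refine (norm_add_le _ _).trans (add_le_add ?_ ?_)
  · rw [norm_mul]
    refine mul_le_mul (norm_cop_apply_le φ.B z j) ?_ (norm_nonneg _) (by positivity)
    exact le_add_of_nonneg_right (by positivity)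
  · rw [Finset.sum_mul, Finset.sum_mul]
    refine (norm_sum_le _ _).trans (Finset.sum_le_sum fun l _ => ?_)
    rw [norm_mul, mul_assoc, mul_assoc, ← mul_assoc (R l)]
    exact mul_le_mul_of_nonneg_left (H l u z) (norm_nonneg _)

/-- The ultradistributions which decay microlocally near `z₀`. -/
def decaying (hθ : 1 / 2 ≤ θ) (hθ' : θ < 1) {z₀ : CSp d} {L : Set (CSp d)}
    (hL : IsConicNhd L z₀) : Submodule ℂ (GSDual d θ) where
  carrier := {u | φ.DecaysNear u z₀}
  add_mem' {u v} hu hv := hu.of_le (a := 1) (b := 1) φ hv (fun z => by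
    rw [φ.fbi_add hθ hθ', one_mul, one_mul]; exact norm_add_le _ _) zero_le_one zero_le_one
  -- Decay near `z₀` presupposes some conic neighbourhood even for the zero ultradistribution; `hL`
  -- provides it.
  zero_mem' := by
    refine ⟨L, hL, 1, one_pos, 1, one_pos, fun z _ => ?_⟩
    have h0 := φ.fbi_smul hθ hθ' 0 (0 : GSDual d θ)
    rw [zero_smul, zero_smul] at h0
    rw [h0, Pi.zero_apply, norm_zero]
    positivity
  smul_mem' c u hu := hu.of_le (a := ‖c‖) (b := 0) φ hu (fun z => by
    rw [φ.fbi_smul hθ hθ', zero_mul, add_zero, Pi.smul_apply, norm_smul]) (norm_nonneg _) le_rfl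

end FBIPhase

/-! ### Microlocality of polynomial differential operators and the main theorem -/

lemma Module.End.list_prod_pow_apply_mem {R M ι : Type*} [CommSemiring R] [AddCommMonoid M]
    [Module R M] {S : Submodule R M} (T : ι → Module.End R M) (n : ι → ℕ)
    (hT : ∀ i, ∀ u ∈ S, T i u ∈ S) (l : List ι) {u : M} (hu : u ∈ S) :
    (l.map fun i => T i ^ n i).prod u ∈ S := by
  have hpow : ∀ i k, ∀ u ∈ S, (T i ^ k) u ∈ S := by
    intro i k
    induction k with
    | zero => exact fun u hu => hu
    | succ k ih =>
      intro u hu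
      rw [pow_succ', Module.End.mul_apply]
      exact hT i _ (ih u hu)
  induction l with
  | nil => exact hu
  | cons i l ih =>
    rw [List.map_cons, List.prod_cons, Module.End.mul_apply]
    exact hpow i _ _ ih

lemma FBIPhase.DecaysNear.polyDiffOp {d : ℕ} {φ : FBIPhase d} {θ : ℝ} (hθ : 1 / 2 ≤ θ)
    (hθ' : θ < 1) (c : MIdx d × MIdx d →₀ ℂ) {u : GSDual d θ} {z₀ : CSp d}
    (hu : φ.DecaysNear u z₀) : φ.DecaysNear (polyDiffOp θ c u) z₀ := by
  obtain ⟨L, hL, -⟩ := id hu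
  -- The ultradistributions decaying near `z₀` form a subspace, so invariance under the generators
  -- $x_k$ and $\partial_k$ suffices.
  have hX : ∀ k, ∀ v ∈ φ.decaying hθ hθ' hL, GSDual.mulX k v ∈ φ.decaying hθ hθ' hL := by
    intro k v hv
    obtain ⟨R, hR, H⟩ := φ.norm_fbi_mulX_le hθ hθ' k
    exact DecaysNear.of_fbi_le hθ hθ' hR hv (H v)
  have hD : ∀ k, ∀ v ∈ φ.decaying hθ hθ' hL, GSDual.deriv k v ∈ φ.decaying hθ hθ' hL := by
    intro k v hv
    obtain ⟨R, hR, H⟩ := φ.norm_fbi_deriv_le hθ hθ' k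
    exact DecaysNear.of_fbi_le hθ hθ' hR hv (H v)
  suffices _root_.polyDiffOp θ c u ∈ φ.decaying hθ hθ' hL from this
  rw [_root_.polyDiffOp, Finsupp.sum, LinearMap.sum_apply]
  refine Submodule.sum_mem _ fun p _ => ?_
  rw [LinearMap.smul_apply, Module.End.mul_apply]
  exact Submodule.smul_mem _ _ (Module.End.list_prod_pow_apply_mem _ _ hX _
    (Module.End.list_prod_pow_apply_mem _ _ hD _ hu))

lemma FBIPhase.WF_polyDiffOp_subset {d : ℕ} (φ : FBIPhase d) {θ : ℝ} (hθ : 1 / 2 ≤ θ)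
    (hθ' : θ < 1) (c : MIdx d × MIdx d →₀ ℂ) (u : GSDual d θ) :
    φ.WF (polyDiffOp θ c u) ⊆ φ.WF u :=
  fun _ hp => ⟨hp.1, fun hu => hp.2 (FBIPhase.DecaysNear.polyDiffOp hθ hθ' c hu)⟩

theorem mainTheorem6 (d : ℕ) (θ : ℝ) (hθ : 1 / 2 ≤ θ) (hθ' : θ < 1) (φ : FBIPhase d) :
    -- the operator `A`
    (∀ (h : MIdx d → CSp d → ℂ) (D : ℝ → MIdx d → ℝ) (D' : ℝ → ℝ),
      (∀ α, h α ∈ MS d θ) →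
      (∀ ε > 0, ∀ α z, ‖h α z‖ ≤ D ε α * Real.exp (ε * ‖z‖ ^ (1 / θ))) →
      (∀ ε > 0, 0 < D' ε ∧ ∀ α : MIdx d, D ε α ≤ D' ε * ε ^ α.len / (α.fact : ℝ) ^ θ) →
      ∃ A : GSDual d θ →ₗ[ℂ] GSDual d θ,
        -- `A u = Σ_α T_φ^* (h_α ∂_z^α T_φ u)`, with (unconditional) weak convergence in `S'_θ`
        (∀ u : GSDual d θ, ∃ v : MIdx d → GSDual d θ,
          (∀ α, φ.IsAdjoint (fun z => h α z * mderiv ℂ α (φ.fbi u) z) (v α)) ∧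
          ∀ f : GS d θ, HasSum (fun α => (v α : GS d θ →ₗ[ℂ] ℂ) f)
            ((A u : GS d θ →ₗ[ℂ] ℂ) f)) ∧
        -- `A` maps `S'_{θ,Γ}` into itself continuously, for every closed cone `Γ`
        (∀ Γ : Set (RSp d × RSp d), FBIPhase.IsClosedCone Γ →
          (∀ u ∈ φ.DualWF θ Γ, A u ∈ φ.DualWF θ Γ) ∧
          ∀ (u : ℕ → GSDual d θ) (v : GSDual d θ), (∀ n, u n ∈ φ.DualWF θ Γ) →
            v ∈ φ.DualWF θ Γ → φ.TendstoWF Γ u v →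
            φ.TendstoWF Γ (fun n => A (u n)) (A v)) ∧
        -- `A` is microlocal
        (∀ u : GSDual d θ, φ.WF (A u) ⊆ φ.WF u) ∧
        -- `A` maps `S_θ` into itself
        (∀ f : GS d θ, ∃ g : GS d θ, A (GS.toDual f) = GS.toDual g)) ∧
    -- differential operators with polynomial coefficients are microlocal
    (∀ (c : MIdx d × MIdx d →₀ ℂ) (u : GSDual d θ), φ.WF (polyDiffOp θ c u) ⊆ φ.WF u) := by
  refine ⟨fun h D D' hMS hD hD' => ?_, fun c u => φ.WF_polyDiffOp_subset hθ hθ' c u⟩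
  -- The same $\varepsilon$ serves for the growth in $z$ and for the geometric factor
  -- $\varepsilon^{|\alpha|}$.
  have hh : FBIPhase.CoeffBound θ h := fun ε hε =>
    ⟨D' ε, (hD' ε hε).1, fun α z => (hD ε hε α z).trans
      (mul_le_mul_of_nonneg_right ((hD' ε hε).2 α) (Real.exp_pos _).le)⟩
  have hd : ∀ α, Differentiable ℂ (h α) := fun α => (hMS α).1
  refine ⟨φ.symOp hθ hθ' hh hd, fun u => ⟨fun α => φ.adj hθ hθ' (φ.symTerm hθ hθ' hh hd α u),
    fun α => ?_, fun f => ?_⟩, fun Γ _ => ⟨fun u hu => ?_, fun u v _ _ huv => ?_⟩,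
    fun u => ?_, fun f => ?_⟩
  · exact φ.isAdjoint_adj hθ hθ' (φ.symTerm hθ hθ' hh hd α u)
  · exact φ.hasSum_symOp hθ hθ' hh hd u f
  · exact (φ.WF_symOp_subset hθ hθ' hh hd u).trans hu
  · exact FBIPhase.TendstoWF.symOp hθ hθ' hh hd huv
  · exact φ.WF_symOp_subset hθ hθ' hh hd u
  · exact φ.exists_symOp_toDual hθ hθ' hh hd f
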